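/- Let $m\ge 1$, let $M$ be an $m$-dimensional smooth manifold, and let $\mathcal W_\Omega=(M,\mathcal F_1,\dots,\mathcal F_n,\Omega)$ be a divergence-free $n$-web: $\mathcal F_1,\dots,\mathcal F_n$ are smooth foliations of $M$ of codimensions $c_1,\dots,c_n$ with $c_1+\dots+c_n=m$, in general position, i.e. $\operatorname{codim}\bigcap_i T_p\mathcal F_i=\sum_i\operatorname{codim}T_p\mathcal F_i$ for every $p\in M$, and $\Omega$ is a smooth nowhere-vanishing $m$-form on $M$. Definitions. Put $m_i=c_1+\dots+c_{i-1}$ and $\pi_i=\{m_i+1,\dots,m_{i+1}\}$; for $k,l\in\{1,\dots,m\}$ write $k\sim l$ if $k,l$ lie in the same block $\pi_i$. An adapted chart centered at $p$ is a smooth chart $\varphi=(x_1,\dots,x_m)$ on an open set $U\ni p$ with $\varphi(p)=0$, with $\varphi(U)$ an open box $\prod_k(a_k,b_k)$, and with $T\mathcal F_i=\bigcap_{k\in\pi_i}\ker dx_k$ on $U$ for all $i$. An adapted chart is one centered at some point. In such a chart write $\Omega=h\,dx_1\wedge\dots\wedge dx_m$. The web is locally trivial if near each $p\in M$ there is a diffeomorphism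 $\varphi$ from a neighbourhood of $p$ onto an open subset of $\mathbb R^m$, with $\varphi(p)=0$, and a permutation $\sigma$ of $\{1,\dots,n\}$ such that $\varphi$ carries each $\mathcal F_j$ to the foliation $\{x_k=\mathrm{const}\ \ \forall k\in\pi_{\sigma(j)}\}$ and $\varphi^*(dx_1\wedge\dots\wedge dx_m)=\Omega$. A region (bounded by leaves) is a compact set $C\subseteq M$ which in some adapted chart has the form $C_1\times\dots\times C_n$ with $C_i\subseteq\mathbb R^{c_i}$ closed, connected and nonempty; its volume is $|\int_C\Omega|$. A smooth hypersurface $F\subseteq M$ with $T\mathcal F\subseteq TF$ (for a foliation $\mathcal F$ of the web) subdivides a region $K$ into $A$ and $B$ if $A,B$ are regions, $K=A\cup B$ and $A\cap B\subseteq F$. Hypersurfaces $F,G$ with $T\mathcal F\subseteq TF$, $T\mathcal G\subseteq TG$ subdivide a region $K$ into four regions $A,B,C,D$ if $F$ subdivides $K$ into $A\cup B$ and $C\cup D$, and $G$ subdivides $K$ into $A\cup D$ and $B\cup C$. Let $\varphi$ be an adapted chart centered at $p$. For $q,q'\in U$ let $[q,q']\subseteq U$ be the closed coordinate box with opposite corners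 $q,q'$. The volume-preserving reflection $r_{p;k}$ is the germ at $p$ of a smooth local diffeomorphism fixing $p$ such that for each $q$ near $p$ with all $x_l(q)\ne0$, the point $q'=r_{p;k}(q)$ lies in $U$, $q'\ne q$, $[p,q]\cup[p,q']$ is a coordinate box, $[p,q]\cap[p,q']$ lies in a level set of $x_k$, and $[p,q]$ and $[p,q']$ have the same volume. Let $\mathcal R_{p;\varphi}$ be the group generated by $r_{p;1},\dots,r_{p;m}$, and $\mathcal H_{p;\varphi}$ the smallest normal subgroup of $\mathcal R_{p;\varphi}$ containing all loops $r_{p;l}\circ r_{p;k}\circ r_{p;l}\circ r_{p;k}$ with $k\not\sim l$. The reflection holonomy at $p$ is the group $\mathcal H_p$ of germs generated by the union of the $\mathcal H_{p;\varphi}$ over all adapted charts $\varphi$ centered at $p$ (considered, through a chart, up to conjugacy in the group of diffeomorphism-germs of $(\mathbb R^m,0)$). The nonuniformity tensor $\mathcal K(\mathcal W_\Omega)$ is the $2$-tensor field given in every adapted chart by $\sum_{k\not\sim l}\frac{\partial^2\log|h|}{\partial x_k\partial x_l}\,dx_k\,dx_l$. Theorem. The following conditions are equivalent. (1) $\mathcal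 W_\Omega$ is locally trivial. (2) For any two different foliations $\mathcal F,\mathcal G$ of the web, any region $K$, and any two smooth hypersurfaces $F,G$ with $T\mathcal F\subseteq TF$, $T\mathcal G\subseteq TG$ which subdivide $K$ into four regions $A,B,C,D$, the volumes $a,b,c,d$ of $A,B,C,D$ satisfy $ac=bd$. (3) For any $\mathcal F,\mathcal G,K,F,G,A,B,C,D$ as in (2) whose volumes satisfy $a+b=c+d$, the equality $a=b$ implies $a=b=c=d$. (4) The reflection holonomy of $\mathcal W_\Omega$ at each point $p\in M$ is trivial. (5) The nonuniformity tensor $\mathcal K(\mathcal W_\Omega)$ vanishes identically. -/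

import Mathlib

open scoped Manifold ContDiff Topology

noncomputable section

namespace DivFreeWeb

/-- A smooth foliation of codimension `c` on an `m`-manifold, recorded by its tangent distribution
`p ↦ T_p𝓕`, which is integrable: near every point it is the kernel of the differential of a smooth
submersion to `ℝ^c`, the fibres of which are the local leaves (plaques). -/
structure Foliation (m c : ℕ) (M : Type*) [TopologicalSpace M]
    [ChartedSpace (EuclideanSpace ℝ (Fin m)) M] where
  tangent : ∀ p : M, Submodule ℝ (TangentSpace (𝓡 m) p)
  exists_submersion : ∀ p : M, ∃ U : Set M, IsOpen U ∧ p ∈ U ∧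
    ∃ f : M → EuclideanSpace ℝ (Fin c), ContMDiffOn (𝓡 m) (𝓡 c) ∞ f U ∧
      ∀ q ∈ U, Function.Surjective (mfderiv (𝓡 m) (𝓡 c) f q) ∧
        ∀ v : TangentSpace (𝓡 m) q, v ∈ tangent q ↔ mfderiv (𝓡 m) (𝓡 c) f q v = 0

section Forms

variable {m : ℕ} {M : Type*} [TopologicalSpace M] [ChartedSpace (EuclideanSpace ℝ (Fin m)) M]

/-- The coefficient `h` of the top-degree form `Ω = h dx₁ ∧ ⋯ ∧ dxₘ` in the chart `φ`, as a
function of the coordinates: the value of `Ω` on the coordinate vector fields `∂₁, …, ∂ₘ`. -/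
def density (Ω : ∀ p : M, (TangentSpace (𝓡 m) p) [⋀^Fin m]→ₗ[ℝ] ℝ)
    (φ : OpenPartialHomeomorph M (EuclideanSpace ℝ (Fin m))) (x : EuclideanSpace ℝ (Fin m)) : ℝ :=
  Ω (φ.symm x) fun k => mfderiv (𝓡 m) (𝓡 m) φ.symm x (EuclideanSpace.single k (1 : ℝ))

/-- The differential at `q` of the `k`-th coordinate function of the chart `φ`. -/
def coordDiff (φ : OpenPartialHomeomorph M (EuclideanSpace ℝ (Fin m))) (q : M) (k : Fin m)
    (v : TangentSpace (𝓡 m) q) : ℝ :=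
  (show EuclideanSpace ℝ (Fin m) from mfderiv (𝓡 m) (𝓡 m) φ q v) k

end Forms

end DivFreeWeb

open DivFreeWeb in
/-- A divergence-free `n`-web on an `m`-manifold: `n` smooth foliations of codimensions
`c 0, …, c (n - 1)` in general position, whose codimensions add up to `m`, together with a smooth
nowhere-vanishing `m`-form. -/
structure DivFreeWeb (m n : ℕ) (c : Fin n → ℕ) (M : Type*) [TopologicalSpace M]
    [ChartedSpace (EuclideanSpace ℝ (Fin m)) M] [IsManifold (𝓡 m) ∞ M] where
  fol : ∀ i, Foliation m (c i) M
  sum_codim : ∑ i, c i = m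
  general_position : ∀ p : M,
    Module.finrank ℝ (TangentSpace (𝓡 m) p ⧸ ⨅ i, (fol i).tangent p) =
      ∑ i, Module.finrank ℝ (TangentSpace (𝓡 m) p ⧸ (fol i).tangent p)
  vol : ∀ p : M, (TangentSpace (𝓡 m) p) [⋀^Fin m]→ₗ[ℝ] ℝ
  vol_smooth : ∀ φ ∈ IsManifold.maximalAtlas (𝓡 m) ∞ M, ContDiffOn ℝ ∞ (density vol φ) φ.target
  vol_ne_zero : ∀ p, vol p ≠ 0

namespace DivFreeWeb

section Germs

variable {m : ℕ} {M : Type*} [TopologicalSpace M] [ChartedSpace (EuclideanSpace ℝ (Fin m)) M]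

/-- The maps `M → M` that fix `p` and are smooth on a neighbourhood of `p`, under composition. -/
def smoothFixing (m : ℕ) {M : Type*} [TopologicalSpace M]
    [ChartedSpace (EuclideanSpace ℝ (Fin m)) M] (p : M) : Submonoid (Function.End M) where
  carrier := {f | f p = p ∧ ∀ᶠ q in 𝓝 p, ContMDiffAt (𝓡 m) (𝓡 m) ∞ (f : M → M) q}
  one_mem' := ⟨rfl, Filter.Eventually.of_forall fun _ => contMDiffAt_id⟩
  mul_mem' := by
    rintro f g ⟨hf, hfs⟩ ⟨hg, hgs⟩
    refine ⟨?_, ?_⟩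
    · change f (g p) = p
      rw [hg, hf]
    · have hc : Filter.Tendsto (g : M → M) (𝓝 p) (𝓝 p) := by
        have h : Filter.Tendsto (g : M → M) (𝓝 p) (𝓝 (g p)) := hgs.self_of_nhds.continuousAt
        rwa [hg] at h
      filter_upwards [hgs, hc.eventually hfs] with q h1 h2
      exact ContMDiffAt.comp q h2 h1

/-- Two such maps have the same germ at `p`. -/
def germCon (m : ℕ) {M : Type*} [TopologicalSpace M]
    [ChartedSpace (EuclideanSpace ℝ (Fin m)) M] (p : M) : Con (smoothFixing (M := M) m p) where
  r f g := ∀ᶠ q in 𝓝 p, (f : Function.End M) q = (g : Function.End M) q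
  iseqv :=
    { refl := fun _ => Filter.Eventually.of_forall fun _ => rfl
      symm := fun h => h.mono fun _ hq => hq.symm
      trans := fun h h' => (h.and h').mono fun _ hq => hq.1.trans hq.2 }
  mul' := by
    intro f g f' g' h h'
    have hc : Filter.Tendsto ((f' : Function.End M) : M → M) (𝓝 p) (𝓝 p) := by
      have h : Filter.Tendsto ((f' : Function.End M) : M → M) (𝓝 p)
          (𝓝 ((f' : Function.End M) p)) := f'.2.2.self_of_nhds.continuousAt
      rwa [f'.2.1] at h
    filter_upwards [h', hc.eventually h] with q h1 h2
    change (f : Function.End M) ((f' : Function.End M) q) =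
      (g : Function.End M) ((g' : Function.End M) q)
    rw [h2, h1]

/-- The group `Diff(M, p)` of germs at `p` of local diffeomorphisms fixing `p`: the invertible
elements of the monoid of germs of smooth maps `(M, p) → (M, p)`. -/
abbrev DiffGerm (m : ℕ) {M : Type*} [TopologicalSpace M]
    [ChartedSpace (EuclideanSpace ℝ (Fin m)) M] (p : M) : Type _ :=
  (germCon (M := M) m p).Quotientˣ

end Germs

variable {m n : ℕ} {c : Fin n → ℕ} {M : Type*} [TopologicalSpace M]
  [ChartedSpace (EuclideanSpace ℝ (Fin m)) M] [IsManifold (𝓡 m) ∞ M] (W : DivFreeWeb m n c M)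

/-! ### Coordinates -/

/-- The `s`-th coordinate index of the `i`-th block, that is (counting from zero)
`c 0 + ⋯ + c (i - 1) + s`. -/
def idx (i : Fin n) (s : Fin (c i)) : Fin m :=
  Fin.cast W.sum_codim (finSigmaFinEquiv ⟨i, s⟩)

/-- The block to which the `k`-th coordinate belongs; `k ∼ l` means `block k = block l`. -/
def block (k : Fin m) : Fin n :=
  (finSigmaFinEquiv.symm (Fin.cast W.sum_codim.symm k)).1

/-- `φ` is a `W`-adapted chart centered at `p`: a smooth cubical chart around `p` with `φ p = 0`
in which the `i`-th foliation is given by `dx_k = 0` for `k` in the `i`-th block, so that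
its plaques are the level sets of the `i`-th block of coordinates. -/
def IsAdapted (φ : OpenPartialHomeomorph M (EuclideanSpace ℝ (Fin m))) (p : M) : Prop :=
  φ ∈ IsManifold.maximalAtlas (𝓡 m) ∞ M ∧
  p ∈ φ.source ∧ φ p = 0 ∧
  (∃ a b : Fin m → ℝ, φ.target = {x | ∀ k, a k < x k ∧ x k < b k}) ∧
  ∀ i, ∀ q ∈ φ.source, ∀ v : TangentSpace (𝓡 m) q,
    v ∈ (W.fol i).tangent q ↔ ∀ s : Fin (c i), coordDiff φ q (W.idx i s) v = 0

/-- `Vol_Ω(C) = |∫_C Ω|` for a subset `C` of the domain of the chart `φ`. -/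
def volIn (φ : OpenPartialHomeomorph M (EuclideanSpace ℝ (Fin m))) (C : Set M) : ℝ :=
  |∫ x in φ '' C, density W.vol φ x|

/-! ### Local triviality -/

/-- Near every point `p` there is a local equivalence `φ : (M, p) → (ℝᵐ, 0)` of divergence-free
webs with the standard one: it carries the `j`-th foliation to the standard foliation
`{dx_k = 0 for all k in the block σ j}`, for some permutation `σ`, and
`φ^*(dx₁ ∧ ⋯ ∧ dxₘ) = Ω`. -/
def LocallyTrivial : Prop :=
  ∀ p : M, ∃ φ ∈ IsManifold.maximalAtlas (𝓡 m) ∞ M, p ∈ φ.source ∧ φ p = 0 ∧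
    (∃ σ : Equiv.Perm (Fin n), ∀ j, ∀ q ∈ φ.source, ∀ v : TangentSpace (𝓡 m) q,
      v ∈ (W.fol j).tangent q ↔ ∀ s : Fin (c (σ j)), coordDiff φ q (W.idx (σ j) s) v = 0) ∧
    ∀ q ∈ φ.source, ∀ v : Fin m → TangentSpace (𝓡 m) q,
      W.vol q v = Matrix.det (Matrix.of fun k l => coordDiff φ q k (v l))

/-! ### Regions and hypersurfaces -/

/-- In the chart `φ` the compact set `C` is a product `C₁ × ⋯ × Cₙ` of closed connected sets
`Cᵢ ⊆ ℝ^(c i)`. -/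
def IsRegionIn (φ : OpenPartialHomeomorph M (EuclideanSpace ℝ (Fin m))) (C : Set M) : Prop :=
  IsCompact C ∧ C ⊆ φ.source ∧
  ∃ S : ∀ i, Set (Fin (c i) → ℝ), (∀ i, IsClosed (S i) ∧ IsConnected (S i)) ∧
    φ '' C = {x | ∀ i, (fun s => x (W.idx i s)) ∈ S i}

/-- `C` is a region bounded by leaves of `W`. -/
def IsRegion (C : Set M) : Prop := ∃ φ p, W.IsAdapted φ p ∧ W.IsRegionIn φ C

/-- `H` is a smooth (embedded) hypersurface with `T𝓕ᵢ ⊆ TH`; for a local defining function `g`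
of `H` one has `T_qH = ker dg_q`. -/
def IsHypersurfaceAlong (i : Fin n) (H : Set M) : Prop :=
  ∀ p ∈ H, ∃ U : Set M, IsOpen U ∧ p ∈ U ∧ ∃ g : M → ℝ,
    ContMDiffOn (𝓡 m) 𝓘(ℝ, ℝ) ∞ g U ∧
    (∀ q ∈ U, mfderiv (𝓡 m) 𝓘(ℝ, ℝ) g q ≠ 0) ∧
    H ∩ U = {q ∈ U | g q = 0} ∧
    ∀ q ∈ H ∩ U, ∀ v ∈ (W.fol i).tangent q, mfderiv (𝓡 m) 𝓘(ℝ, ℝ) g q v = 0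

/-- The hypersurface `H`, with `T𝓕ᵢ ⊆ TH`, subdivides the region `K` into the subregions `A`
and `B`: these are adjacent regions with union `K`, and `A ∩ B` (which is compact) lies
in `H`. -/
def Subdivides (i : Fin n) (H K A B : Set M) : Prop :=
  W.IsHypersurfaceAlong i H ∧ W.IsRegion K ∧ W.IsRegion A ∧ W.IsRegion B ∧
    K = A ∪ B ∧ A ∩ B ⊆ H

/-- The hypersurfaces `F`, `G`, with `T𝓕ᵢ ⊆ TF` and `T𝓕ⱼ ⊆ TG`, subdivide the region `K` into the
four subregions `A, B, C, D`, with `(A ∪ B) ∩ (C ∪ D) ⊆ F` and `(A ∪ D) ∩ (B ∪ C) ⊆ G`. -/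
def SubdividesInFour (i j : Fin n) (F G K A B C D : Set M) : Prop :=
  W.IsRegion A ∧ W.IsRegion B ∧ W.IsRegion C ∧ W.IsRegion D ∧
    W.Subdivides i F K (A ∪ B) (C ∪ D) ∧ W.Subdivides j G K (A ∪ D) (B ∪ C)

/-- The `ac = bd` condition; volumes are computed in an adapted chart `φ` in which the region `K`
is a product. -/
def VolumeCondition : Prop :=
  ∀ i j, i ≠ j → ∀ φ p, W.IsAdapted φ p → ∀ K, W.IsRegionIn φ K →
    ∀ F G A B C D : Set M, W.SubdividesInFour i j F G K A B C D →
      W.volIn φ A * W.volIn φ C = W.volIn φ B * W.volIn φ D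

/-- The cut condition: if `a + b = c + d` and `a = b`, then `a = b = c = d`. -/
def CutCondition : Prop :=
  ∀ i j, i ≠ j → ∀ φ p, W.IsAdapted φ p → ∀ K, W.IsRegionIn φ K →
    ∀ F G A B C D : Set M, W.SubdividesInFour i j F G K A B C D →
      W.volIn φ A + W.volIn φ B = W.volIn φ C + W.volIn φ D →
      W.volIn φ A = W.volIn φ B →
      W.volIn φ A = W.volIn φ B ∧ W.volIn φ B = W.volIn φ C ∧ W.volIn φ C = W.volIn φ D

/-! ### Reflection holonomy -/

/-- The region `[p, q]` bounded by the coordinate hyperplanes of `φ` crossing `p` and `q`. -/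
def coordBox (φ : OpenPartialHomeomorph M (EuclideanSpace ℝ (Fin m))) (p q : M) : Set M :=
  {x ∈ φ.source | ∀ k, φ x k ∈ Set.uIcc (φ p k) (φ q k)}

/-- For the codimension-`1` web of the level sets of the coordinates of `φ`, the regions `A` and
`B` are adjacent along the `k`-th foliation: `A ∪ B` is such a region too, and `A ∩ B` lies in
a leaf `{x_k = s}`. -/
def BoxAdjacent (φ : OpenPartialHomeomorph M (EuclideanSpace ℝ (Fin m))) (k : Fin m)
    (A B : Set M) : Prop :=
  (∃ u ∈ φ.source, ∃ v ∈ φ.source, A ∪ B = coordBox φ u v) ∧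
    ∃ s : ℝ, ∀ x ∈ A ∩ B, φ x k = s

/-- `r` is the volume-preserving reflection anchored at `p` through the foliation by the level
sets of the `k`-th coordinate of `φ`: for every `q` near `p` which lies on none of the coordinate
hyperplanes crossing `p`, the point `q' = r(q)` is different from `q`, and the regions `[p, q]`
and `[p, q']` are adjacent along the `k`-th coordinate foliation and have the same volume. -/
def IsReflection (φ : OpenPartialHomeomorph M (EuclideanSpace ℝ (Fin m))) (p : M) (k : Fin m)
    (r : DiffGerm m p) : Prop :=
  ∃ f : smoothFixing (M := M) m p, (r : (germCon (M := M) m p).Quotient) = f ∧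
    ∀ᶠ q in 𝓝 p, (∀ l, φ q l ≠ φ p l) →
      (f : Function.End M) q ∈ φ.source ∧ (f : Function.End M) q ≠ q ∧
      BoxAdjacent φ k (coordBox φ p q) (coordBox φ p ((f : Function.End M) q)) ∧
      W.volIn φ (coordBox φ p q) = W.volIn φ (coordBox φ p ((f : Function.End M) q))

/-- The group generated by all the volume-preserving reflections anchored at `p` of the web of
coordinate level sets of `φ`. -/
def reflectionGroup (φ : OpenPartialHomeomorph M (EuclideanSpace ℝ (Fin m))) (p : M) :
    Subgroup (DiffGerm m p) :=
  Subgroup.closure {r | ∃ k, W.IsReflection φ p k r}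

/-- The volume-preserving loops `r_l ∘ r_k ∘ r_l ∘ r_k` with `k ≁ l`. -/
def loops (φ : OpenPartialHomeomorph M (EuclideanSpace ℝ (Fin m))) (p : M) :
    Set (DiffGerm m p) :=
  {g | ∃ k l, W.block k ≠ W.block l ∧ ∃ rk rl, W.IsReflection φ p k rk ∧
    W.IsReflection φ p l rl ∧ g = rl * rk * rl * rk}

/-- The reflection holonomy group of `W` at `p` in the chart `φ`: the smallest normal subgroup of
the group of reflections which contains the loops. -/
def chartHolonomy (φ : OpenPartialHomeomorph M (EuclideanSpace ℝ (Fin m))) (p : M) :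
    Subgroup (DiffGerm m p) :=
  (Subgroup.normalClosure {g : W.reflectionGroup φ p | (g : DiffGerm m p) ∈ W.loops φ p}).map
    (W.reflectionGroup φ p).subtype

/-- The group generated by the reflection holonomy groups at `p` in all the `W`-adapted charts
centered at `p`. -/
def holonomy (p : M) : Subgroup (DiffGerm m p) :=
  ⨆ (φ : OpenPartialHomeomorph M (EuclideanSpace ℝ (Fin m))) (_ : W.IsAdapted φ p),
    W.chartHolonomy φ p

/-! ### The nonuniformity tensor -/

/-- The second partial derivative `∂² log |h| / ∂x_k ∂x_l` at `x`, where
`Ω = h dx₁ ∧ ⋯ ∧ dxₘ` in the chart `φ` (in Lean `Real.log h = log |h|`). -/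
def logHess (φ : OpenPartialHomeomorph M (EuclideanSpace ℝ (Fin m))) (x : EuclideanSpace ℝ (Fin m))
    (k l : Fin m) : ℝ :=
  fderiv ℝ (fun y => fderiv ℝ (fun z => Real.log (density W.vol φ z)) y
    (EuclideanSpace.single l (1 : ℝ))) x (EuclideanSpace.single k (1 : ℝ))

/-- The covariant `2`-tensor field `K` is the nonuniformity tensor of `W`: in all `W`-adapted
coordinates, `K = ∑_{k ≁ l} ∂² log |h| / ∂x_k ∂x_l dx_k dx_l`. -/
def IsNonuniformityTensor
    (K : ∀ q : M, TangentSpace (𝓡 m) q → TangentSpace (𝓡 m) q → ℝ) : Prop :=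
  ∀ φ p, W.IsAdapted φ p → ∀ q ∈ φ.source, ∀ v w : TangentSpace (𝓡 m) q,
    K q v w = ∑ k, ∑ l, if W.block k = W.block l then 0 else
      W.logHess φ (φ q) k l * coordDiff φ q k v * coordDiff φ q l w

end DivFreeWeb

end

/-!
Write `Ω = h dx₁ ∧ ⋯ ∧ dxₘ` in an adapted chart. All five conditions are compared with a sixth one,
`Flat`: in every adapted chart `∂² log |h| / ∂x_k ∂x_l = 0` for `k`, `l` in different blocks, which
is the vanishing of the nonuniformity tensor written out in coordinates
(`tensor_eq_zero_iff_flat`).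

Two facts about densities carry the argument.

* If the mixed derivatives vanish on a coordinate box, then `log |h|` is a sum of functions of the
  individual blocks of coordinates (`MixedFlat.log_add`, `MixedFlat.div_eq_prod`). By Fubini the
  masses of four sets `S ∩ T`, `S ∩ T'`, `S' ∩ T`, `S' ∩ T'` are in proportion if `S`, `S'` are cut
  out by one block of coordinates and `T`, `T'` by the other ones
  (`MixedFlat.setIntegral_cross`).
* If `∂² log |h| / ∂x_k ∂x_l ≠ 0` at a point, then the masses of four small boxes around it with a
  common vertex, whose opposite vertices differ in the coordinates `k` and `l`, are not in
  proportion (`exists_box_mul_box_ne`). The reason is that the mass of the box between `w` and `w + q` is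
  `|∏ q_j|` times the average of `h` over it, that this average is a smooth function of `(w, q)`,
  and that its logarithm has at `q = 0` a quarter of the mixed derivative of `log |h|`.

The first fact gives `Flat.volumeCondition`. A region in the sense of one adapted chart is one in
the sense of any other whose domain contains it (`IsRegionIn.of_chart`), and the halves of a subdivided
region are, unless some volume is zero, cut out by the block of coordinates of the foliation along
which it is subdivided (`Subdivides.exists_image_eq`), because a piece of a hypersurface has measure
zero. It also gives `Flat.holonomy_eq_bot`: the volumes of the boxes at the points visited by a loop
of reflections are in proportion, and a box is determined by its volume up to moving one face, so
that the loop returns to its starting point off the coordinate hyperplanes, and everywhere by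
continuity.

The second fact gives `CutCondition.flat`, by cutting a small cube twice in halves of equal volume,
and `flat_of_holonomy_eq_bot`, by looking at the boxes visited by a loop. The latter needs
that reflections exist (`exists_isReflection`): in the coordinates in which `x_k` is replaced by the
average of `h` over the box between `0` and `x`, times `x_k`, they are `x_k ↦ -x_k`.

Finally, a locally trivial web is flat because in an adapted chart `h` is the Jacobian determinant
of a map which sends blocks of coordinates to blocks, and such determinants factorize
(`det_mul_det_of_rows`). Conversely, adapted charts exist by the inverse function theorem applied to
the submersions which define the foliations (`exists_isAdapted`), and if `h` factorizes, integrating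
the factor of each block along the first coordinate of the block gives coordinates with Jacobian
determinant `h` (`MixedFlat.exists_coordinates`).
-/

namespace DivFreeWeb

open MeasureTheory Set Filter

/-! ### Integrals depending smoothly on parameters -/

theorem contDiff_fderiv_left {E H F : Type} [NormedAddCommGroup E] [NormedSpace ℝ E]
    [NormedAddCommGroup H] [NormedSpace ℝ H] [NormedAddCommGroup F] [NormedSpace ℝ F]
    {f : E → H → F} (hf : ContDiff ℝ ∞ ↿f) :
    ContDiff ℝ ∞ fun p : E × H => fderiv ℝ (fun x => f x p.2) p.1 := by
  refine ContDiff.fderiv (m := ∞) (n := ∞) (f := fun (p : E × H) x => f x p.2) ?_ contDiff_fst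
    (by simp)
  exact hf.comp (contDiff_snd.prodMk (contDiff_snd.comp contDiff_fst))

section Parametric

variable {E H F : Type} [NormedAddCommGroup E] [NormedSpace ℝ E] [FiniteDimensional ℝ E]
  [NormedAddCommGroup H] [NormedSpace ℝ H] [FiniteDimensional ℝ H] [MeasurableSpace H]
  [BorelSpace H] [NormedAddCommGroup F] [NormedSpace ℝ F]
  {μ : Measure H} [IsLocallyFiniteMeasure μ] {K : Set H}

theorem hasFDerivAt_setIntegral_param [CompleteSpace F] {f : E → H → F}
    (hf : ContDiff ℝ ∞ ↿f) (hK : IsCompact K) (x₀ : E) :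
    HasFDerivAt (fun x => ∫ τ in K, f x τ ∂μ)
      (∫ τ in K, fderiv ℝ (fun x => f x τ) x₀ ∂μ) x₀ := by
  have hd := (contDiff_fderiv_left hf).continuous
  have hc : Continuous ↿f := hf.continuous
  have hfx : ∀ x, Continuous (f x) := fun x => hc.comp (by fun_prop : Continuous fun τ => (x, τ))
  have : IsFiniteMeasure (μ.restrict K) := ⟨by simpa using hK.measure_lt_top⟩
  obtain ⟨C, hC⟩ := ((isCompact_closedBall x₀ 1).prod hK).exists_bound_of_continuousOn
    hd.continuousOn
  refine hasFDerivAt_integral_of_dominated_of_fderiv_le (𝕜 := ℝ) (bound := fun _ => C)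
    (F' := fun x τ => fderiv ℝ (fun x => f x τ) x)
    (Metric.closedBall_mem_nhds x₀ one_pos) ?_ ?_ ?_ ?_ ?_ ?_
  · exact Eventually.of_forall fun x => (hfx x).aestronglyMeasurable
  · exact (hfx x₀).continuousOn.integrableOn_compact hK
  · exact (hd.comp (by fun_prop : Continuous fun τ : H => (x₀, τ))).aestronglyMeasurable
  · refine (ae_restrict_iff' hK.measurableSet).2 (Eventually.of_forall fun τ hτ x hx => ?_)
    exact hC (x, τ) ⟨hx, hτ⟩
  · exact integrable_const _
  · refine Eventually.of_forall fun τ x _ => ?_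
    have : ContDiff ℝ ∞ fun x => f x τ := hf.comp (contDiff_id.prodMk contDiff_const)
    exact (this.differentiable (by simp) x).hasFDerivAt

/-- The induction passes from `f` to its differential, hence the quantification over all target
spaces. -/
theorem contDiff_setIntegral_param_nat (hK : IsCompact K) (n : ℕ) :
    ∀ {F : Type} [NormedAddCommGroup F] [NormedSpace ℝ F] [CompleteSpace F] {f : E → H → F},
      ContDiff ℝ ∞ ↿f → ContDiff ℝ n fun x => ∫ τ in K, f x τ ∂μ := by
  induction n with
  | zero =>
    intro F _ _ _ f hf
    exact contDiff_zero.2 (continuous_parametric_integral_of_continuous hf.continuous hK)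
  | succ n ih =>
    intro F _ _ _ f hf
    have hd := fun x => hasFDerivAt_setIntegral_param (μ := μ) hf hK x
    push_cast
    rw [contDiff_succ_iff_fderiv]
    refine ⟨fun x => (hd x).differentiableAt, by simp, ?_⟩
    rw [show fderiv ℝ (fun x => ∫ τ in K, f x τ ∂μ) = fun x => ∫ τ in K,
      (fun x τ => fderiv ℝ (fun x => f x τ) x) x τ ∂μ from funext fun x => (hd x).fderiv]
    exact ih (contDiff_fderiv_left hf)

theorem contDiff_setIntegral_param [CompleteSpace F] {f : E → H → F}
    (hf : ContDiff ℝ ∞ ↿f) (hK : IsCompact K) :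
    ContDiff ℝ ∞ fun x => ∫ τ in K, f x τ ∂μ :=
  contDiff_infty.2 fun n => contDiff_setIntegral_param_nat hK n hf

end Parametric

/-- Near a given point a smooth function agrees with one which is smooth on the whole space. -/
theorem exists_contDiff_eventuallyEq {E : Type} [NormedAddCommGroup E] [InnerProductSpace ℝ E]
    [FiniteDimensional ℝ E] {h : E → ℝ} {U : Set E} (hU : IsOpen U) (hh : ContDiffOn ℝ ∞ h U)
    {x₀ : E} (hx : x₀ ∈ U) : ∃ g : E → ℝ, ContDiff ℝ ∞ g ∧ g =ᶠ[𝓝 x₀] h := by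
  obtain ⟨r, hr, hrU⟩ := Metric.isOpen_iff.1 hU x₀ hx
  let χ : ContDiffBump x₀ := ⟨r / 3, r / 2, by positivity, by linarith⟩
  refine ⟨fun x => χ x * h x, ?_, ?_⟩
  · refine contDiff_iff_contDiffAt.2 fun x => ?_
    by_cases hx' : x ∈ Metric.ball x₀ r
    · exact χ.contDiff.contDiffAt.mul (hh.contDiffAt (hU.mem_nhds (hrU hx')))
    · have hcl : IsOpen (Metric.closedBall x₀ (r / 2))ᶜ := Metric.isClosed_closedBall.isOpen_compl
      have hmem : x ∈ (Metric.closedBall x₀ (r / 2))ᶜ := by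
        simp only [Metric.mem_ball, mem_compl_iff, Metric.mem_closedBall] at *
        linarith
      refine (contDiffAt_const (c := (0 : ℝ))).congr_of_eventuallyEq ?_
      filter_upwards [hcl.mem_nhds hmem] with y hy
      have : χ y = 0 := χ.zero_of_le_dist (by
        simp only [mem_compl_iff, Metric.mem_closedBall, not_le] at hy; exact hy.le)
      simp [this]
  · filter_upwards [χ.eventuallyEq_one] with y hy
    simp [hy]

/-! ### Null sets -/

/-- A measurable set on which, locally, some function with nonvanishing differential vanishes has
measure zero: at almost all points of the zero set the differential would have to vanish. -/
theorem volume_eq_zero_of_locally_regular_zero {E : Type} [NormedAddCommGroup E]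
    [InnerProductSpace ℝ E] [FiniteDimensional ℝ E] [MeasurableSpace E] [BorelSpace E]
    {S : Set E} (hS : MeasurableSet S)
    (h : ∀ x ∈ S, ∃ V ∈ 𝓝 x, ∃ g : E → ℝ, ∀ y ∈ S ∩ V, g y = 0 ∧
      ∃ g' : E →L[ℝ] ℝ, g' ≠ 0 ∧ HasFDerivAt g g' y) : volume S = 0 := by
  refine measure_null_of_locally_null S fun x hx => ?_
  obtain ⟨V, hV, g, hg⟩ := h x hx
  have hT : MeasurableSet (S ∩ interior V) := hS.inter isOpen_interior.measurableSet
  refine ⟨S ∩ interior V, inter_mem_nhdsWithin S (interior_mem_nhds.2 hV), ?_⟩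
  obtain ⟨-, g₀, hg₀, -⟩ := hg x ⟨hx, mem_of_mem_nhds hV⟩
  obtain ⟨e, he⟩ : ∃ e : E, e ≠ 0 := by
    by_contra! hall
    exact hg₀ (ContinuousLinearMap.ext fun v => by simp [hall v])
  have hg' : ∀ y ∈ S ∩ interior V, g y = 0 ∧ ∃ g' : E →L[ℝ] ℝ, g' ≠ 0 ∧ HasFDerivAt g g' y :=
    fun y hy => hg y ⟨hy.1, interior_subset hy.2⟩
  choose! h0 d hd0 hd using hg'
  have happ : ApproximatesLinearOn (fun y => g y • e) (0 : E →L[ℝ] E) (S ∩ interior V) 0 := by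
    intro y hy z hz
    simp [h0 y hy, h0 z hz]
  have hae := happ.norm_fderiv_sub_le volume hT (fun y => (d y).smulRight e)
    fun y hy => ((hd y hy).smul_const e).hasFDerivWithinAt
  rw [ae_restrict_iff' hT] at hae
  rw [← nonpos_iff_eq_zero]
  refine (measure_mono_null (fun y hy => ?_) hae).le
  intro hcon
  have h1 := hcon hy
  simp only [sub_zero, nonpos_iff_eq_zero, nnnorm_eq_zero] at h1
  refine hd0 y hy (ContinuousLinearMap.ext fun v => ?_)
  have := DFunLike.congr_fun h1 v
  simpa [he] using this

section Euclid

variable {m : ℕ}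

local notation "𝔼" => EuclideanSpace ℝ (Fin m)

/-! ### Coordinate-wise products and coordinate boxes -/

/-- The coordinate-wise product of two vectors. -/
def had (τ q : 𝔼) : 𝔼 := WithLp.toLp 2 fun k => τ k * q k

@[simp] theorem had_apply (τ q : 𝔼) (k : Fin m) : had τ q k = τ k * q k := rfl

theorem contDiff_had : ContDiff ℝ ∞ fun p : 𝔼 × 𝔼 => had p.1 p.2 := by
  refine contDiff_euclidean.2 fun k => ?_
  simp only [had_apply]
  fun_prop

/-- Coordinate-wise multiplication by `τ`, as a continuous linear map. -/
noncomputable def hadL (τ : 𝔼) : 𝔼 →L[ℝ] 𝔼 :=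
  LinearMap.toContinuousLinearMap
    { toFun := had τ
      map_add' := fun x y => by ext k; simp [mul_add]
      map_smul' := fun r x => by ext k; simp [mul_left_comm] }

@[simp] theorem hadL_apply (τ q : 𝔼) : hadL τ q = had τ q := rfl

theorem det_hadL (τ : 𝔼) : (hadL τ).det = ∏ k, τ k := by
  have : ((hadL τ : 𝔼 →L[ℝ] 𝔼) : 𝔼 →ₗ[ℝ] 𝔼) =
      Matrix.toLin (EuclideanSpace.basisFun (Fin m) ℝ).toBasis
        (EuclideanSpace.basisFun (Fin m) ℝ).toBasis (Matrix.diagonal fun k => τ k) := by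
    refine (EuclideanSpace.basisFun (Fin m) ℝ).toBasis.ext fun i => ?_
    rw [Matrix.toLin_self]
    ext k
    simp [Matrix.diagonal_apply]
    grind
  rw [ContinuousLinearMap.det, this, LinearMap.det_toLin, Matrix.det_diagonal]

/-- The closed coordinate box with opposite corners `u` and `v`. -/
def box (u v : 𝔼) : Set 𝔼 := {x | ∀ k, x k ∈ uIcc (u k) (v k)}

theorem isCompact_box (u v : 𝔼) : IsCompact (box u v) := by
  have : box u v =
      (EuclideanSpace.equiv (Fin m) ℝ).symm '' (Set.univ.pi fun k => uIcc (u k) (v k)) := by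
    ext x
    constructor
    · intro hx
      exact ⟨EuclideanSpace.equiv (Fin m) ℝ x, fun k _ => hx k, by simp⟩
    · rintro ⟨y, hy, rfl⟩ k
      exact hy k trivial
  rw [this]
  exact (isCompact_univ_pi fun k => isCompact_uIcc).image (by fun_prop)

/-- The unit cube. -/
def cube (m : ℕ) : Set (EuclideanSpace ℝ (Fin m)) := {x | ∀ k, x k ∈ Icc (0 : ℝ) 1}

theorem isCompact_cube : IsCompact (cube m) := by
  have : cube m = box 0 (WithLp.toLp 2 fun _ => 1) := by
    ext x; simp [cube, box, uIcc_of_le]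
  rw [this]; exact isCompact_box _ _

/-- The average of `h` over the box with opposite corners `w` and `w + q`. -/
noncomputable def avg (h : 𝔼 → ℝ) (w q : 𝔼) : ℝ := ∫ τ in cube m, h (w + had τ q)

theorem image_cube {w q : 𝔼} : (fun τ => w + had τ q) '' cube m = box w (w + q) := by
  ext x
  constructor
  · rintro ⟨τ, hτ, rfl⟩ k
    have := hτ k
    simp only [PiLp.add_apply, had_apply]
    rw [mem_uIcc]
    rcases le_total 0 (q k) with h | h
    · left; constructor <;> nlinarith [this.1, this.2]
    · right; constructor <;> nlinarith [this.1, this.2]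
  · intro hx
    refine ⟨WithLp.toLp 2 fun k => (x k - w k) / q k, fun k => ?_, ?_⟩
    · have := hx k
      simp only [PiLp.add_apply] at this ⊢
      rw [mem_uIcc] at this
      rcases lt_trichotomy (q k) 0 with h | h | h
      · exact ⟨div_nonneg_of_nonpos (by grind) h.le, by rw [div_le_one_of_neg h]; grind⟩
      · simp [h]
      · exact ⟨div_nonneg (by grind) h.le, by rw [div_le_one h]; grind⟩
    · ext k
      have := hx k
      simp only [PiLp.add_apply, had_apply] at this ⊢
      rw [mem_uIcc] at this
      by_cases h : q k = 0
      · simp only [h, add_zero, div_zero, zero_mul] at this ⊢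
        rcases this with h1 | h1
        · exact le_antisymm h1.1 h1.2
        · exact le_antisymm h1.1 h1.2
      · field_simp; ring

theorem volume_box_of_eq {u v : 𝔼} {k : Fin m} (h : u k = v k) : volume (box u v) = 0 := by
  refine volume_eq_zero_of_locally_regular_zero (isCompact_box u v).measurableSet fun x _ =>
    ⟨univ, univ_mem, fun y => y k - u k, fun y hy => ⟨?_, EuclideanSpace.proj k, ?_, ?_⟩⟩
  · have := hy.1 k
    simp only [h, uIcc_self, mem_singleton_iff] at this
    simp [this, h]
  · intro h0
    have := DFunLike.congr_fun h0 (EuclideanSpace.single k (1 : ℝ))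
    simp at this
  · exact ((EuclideanSpace.proj k : 𝔼 →L[ℝ] ℝ).hasFDerivAt).sub_const _

/-- This includes degenerate boxes, for which both sides vanish. -/
theorem setIntegral_box (h : 𝔼 → ℝ) (w q : 𝔼) :
    ∫ x in box w (w + q), h x = |∏ k, q k| * avg h w q := by
  by_cases hq : ∀ k, q k ≠ 0
  · have hd : ∀ τ ∈ cube m, HasFDerivWithinAt (fun τ => w + had τ q) (hadL q) (cube m) τ := by
      intro τ _
      have : (fun τ => w + had τ q) = fun τ => w + hadL q τ := by
        funext τ; simp only [hadL_apply]; congr 1; ext k; simp [mul_comm]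
      rw [this]
      exact ((hadL q).hasFDerivAt.const_add w).hasFDerivWithinAt
    have hinj : InjOn (fun τ => w + had τ q) (cube m) := by
      intro τ _ τ' _ h'
      ext k
      have := congrArg (fun x : 𝔼 => x k) h'
      simpa [hq k] using this
    rw [← image_cube, integral_image_eq_integral_abs_det_fderiv_smul volume
      isCompact_cube.measurableSet hd hinj]
    simp only [det_hadL, smul_eq_mul, avg]
    rw [integral_const_mul]
  · push Not at hq
    obtain ⟨k, hk⟩ := hq
    rw [Measure.restrict_eq_zero.2 (volume_box_of_eq (k := k) (by simp [hk])),
      Finset.prod_eq_zero (Finset.mem_univ k) hk]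
    simp

/-! ### A Fubini identity for products of functions of complementary groups of coordinates -/

/-- The functionals `α` and `β` integrate over the coordinates in `κ` and over the other ones. No
integrability is required: with the convention that the integral of a function which is not
integrable is zero, the integral of a product of functions of separate variables is always the
product of the integrals. -/
theorem exists_integral_mul_eq (κ : Fin m → Prop) :
    ∃ α β : (𝔼 → ℝ) → ℝ, ∀ a b : 𝔼 → ℝ, (∀ x y, (∀ k, κ k → x k = y k) → a x = a y) →
      (∀ x y, (∀ k, ¬ κ k → x k = y k) → b x = b y) → ∫ x, a x * b x = α a * β b := by
  classical
  let e := MeasurableEquiv.piEquivPiSubtypeProd (fun _ : Fin m => ℝ) κ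
  refine ⟨fun a => ∫ y : {k // κ k} → ℝ, a (WithLp.toLp 2 (e.symm (y, 0))),
    fun b => ∫ z : {k // ¬ κ k} → ℝ, b (WithLp.toLp 2 (e.symm (0, z))), fun a b ha hb => ?_⟩
  rw [← (PiLp.volume_preserving_toLp (Fin m)).integral_comp
      (MeasurableEquiv.toLp 2 (Fin m → ℝ)).measurableEmbedding,
    ← ((volume_preserving_piEquivPiSubtypeProd (fun _ : Fin m => ℝ) κ).symm).integral_comp
      e.symm.measurableEmbedding, ← integral_prod_mul]
  refine integral_congr_ae (Eventually.of_forall fun p => ?_)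
  simp only
  congr 1
  · refine ha _ _ fun k hk => ?_
    simp [MeasurableEquiv.piEquivPiSubtypeProd, Equiv.piEquivPiSubtypeProd, hk, e]
  · refine hb _ _ fun k hk => ?_
    simp [MeasurableEquiv.piEquivPiSubtypeProd, Equiv.piEquivPiSubtypeProd, hk, e]

theorem integral_mul_cross (κ : Fin m → Prop) {a a' b b' : 𝔼 → ℝ}
    (ha : ∀ x y, (∀ k, κ k → x k = y k) → a x = a y)
    (ha' : ∀ x y, (∀ k, κ k → x k = y k) → a' x = a' y)
    (hb : ∀ x y, (∀ k, ¬ κ k → x k = y k) → b x = b y)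
    (hb' : ∀ x y, (∀ k, ¬ κ k → x k = y k) → b' x = b' y) :
    (∫ x, a x * b x) * ∫ x, a' x * b' x = (∫ x, a' x * b x) * ∫ x, a x * b' x := by
  obtain ⟨α, β, h⟩ := exists_integral_mul_eq (m := m) κ
  rw [h a b ha hb, h a' b' ha' hb', h a' b ha' hb, h a b' ha hb']
  ring

end Euclid

/-! ### Mixed second differences and derivatives -/

section Mixed

variable {E : Type} [NormedAddCommGroup E] [NormedSpace ℝ E]

/-- The mean value theorem for mixed second differences. -/
theorem exists_mixed_difference_eq {L : E → ℝ} {B : Set E} (hB : IsOpen B) (hconv : Convex ℝ B)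
    (hL : ContDiffOn ℝ ∞ L B) {p u v : E} (hp : p ∈ B) (hu : p + u ∈ B) (hv : p + v ∈ B)
    (huv : p + u + v ∈ B) :
    ∃ ξ ∈ B, L (p + u + v) - L (p + u) - L (p + v) + L p =
      fderiv ℝ (fun y => fderiv ℝ L y v) ξ u := by
  have hline : ∀ {x w : E}, x ∈ B → x + w ∈ B → ∀ t ∈ Icc (0 : ℝ) 1, x + t • w ∈ B :=
    fun hx hw t ht => hconv.add_smul_mem hx hw ht
  have hda : ∀ x ∈ B, DifferentiableAt ℝ L x := fun x hx =>
    (hL.contDiffAt (hB.mem_nhds hx)).differentiableAt (by simp)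
  have hderiv : ∀ {f : E → ℝ} {x w : E} {t : ℝ}, DifferentiableAt ℝ f (x + t • w) →
      HasDerivAt (fun t : ℝ => f (x + t • w)) (fderiv ℝ f (x + t • w) w) t := by
    intro f x w t hf
    have h1 : HasDerivAt (fun t : ℝ => x + t • w) w t := by
      simpa using ((hasDerivAt_id t).smul_const w).const_add x
    exact hf.hasFDerivAt.comp_hasDerivAt t h1
  have key : ∀ {g g' : ℝ → ℝ}, (∀ t ∈ Icc (0 : ℝ) 1, HasDerivAt g (g' t) t) →
      ∃ t ∈ Icc (0 : ℝ) 1, g 1 - g 0 = g' t := by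
    intro g g' hg
    obtain ⟨t, ht, hslope⟩ := exists_hasDerivAt_eq_slope g g' zero_lt_one
      (fun t ht => (hg t ht).continuousAt.continuousWithinAt) fun t ht => hg t ⟨ht.1.le, ht.2.le⟩
    exact ⟨t, ⟨ht.1.le, ht.2.le⟩, by simpa using hslope.symm⟩
  obtain ⟨t, ht, h1⟩ := key (g := fun t => L (p + u + t • v) - L (p + t • v)) fun t ht =>
    (hderiv (hda _ (hline hu huv t ht))).sub (hderiv (hda _ (hline hp hv t ht)))
  have hpt := hline hp hv t ht
  have hput : p + t • v + u ∈ B := by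
    have := hline hu huv t ht
    rwa [add_right_comm] at this
  have hfd : ∀ x ∈ B, DifferentiableAt ℝ (fun y => fderiv ℝ L y v) x := fun x hx =>
    (((hL.contDiffAt (hB.mem_nhds hx)).fderiv_right (m := ∞) (by simp)).differentiableAt
      (by simp)).clm_apply (differentiableAt_const v)
  obtain ⟨s, hs, h2⟩ := key (g := fun s => fderiv ℝ L (p + t • v + s • u) v) fun s hs =>
    hderiv (f := fun y => fderiv ℝ L y v) (hfd _ (hline hpt hput s hs))
  refine ⟨_, hline hpt hput s hs, ?_⟩
  rw [← h2]
  simp only [one_smul, zero_smul, add_zero] at h1 ⊢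
  rw [show p + t • v + u = p + u + t • v by abel, ← h1]
  ring

theorem fderiv_fderiv_log {f : E → ℝ} {p : E} (hf : ContDiffAt ℝ ∞ f p) (h0 : f p ≠ 0) (u v : E) :
    fderiv ℝ (fun y => fderiv ℝ (fun z => Real.log (f z)) y v) p u =
      fderiv ℝ (fun y => fderiv ℝ f y v) p u / f p - fderiv ℝ f p u * fderiv ℝ f p v / f p ^ 2 := by
  have hev : ∀ᶠ y in 𝓝 p, fderiv ℝ (fun z => Real.log (f z)) y v = (f y)⁻¹ * fderiv ℝ f y v := by
    filter_upwards [(hf.of_le (m := 1) (by simp)).eventually (by simp),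
      hf.continuousAt.eventually_ne h0] with y hy hy0
    have := (hy.differentiableAt (by simp)).hasFDerivAt.log hy0
    rw [this.fderiv]
    simp
  rw [EventuallyEq.fderiv_eq hev]
  have h1 : DifferentiableAt ℝ f p := hf.differentiableAt (by simp)
  have h2 : DifferentiableAt ℝ (fun y => fderiv ℝ f y v) p :=
    ((hf.fderiv_right (m := ∞) (by simp)).differentiableAt
      (by simp)).clm_apply (differentiableAt_const v)
  have h3 : HasFDerivAt (fun y => (f y)⁻¹) (-(f p ^ 2)⁻¹ • fderiv ℝ f p) p := by
    have := (hasDerivAt_inv h0).comp_hasFDerivAt p h1.hasFDerivAt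
    exact this
  have h4 : fderiv ℝ (fun y => (f y)⁻¹ * fderiv ℝ f y v) p = _ := (h3.mul h2.hasFDerivAt).fderiv
  rw [h4]
  simp
  field_simp
  ring

end Mixed

section Euclid

variable {m : ℕ}

local notation "𝔼" => EuclideanSpace ℝ (Fin m)

/-- The vector `q` with its `k`-th coordinate replaced by `a`. -/
def upd (q : 𝔼) (k : Fin m) (a : ℝ) : 𝔼 := WithLp.toLp 2 (Function.update (fun j => q j) k a)

theorem upd_apply (q : 𝔼) (k : Fin m) (a : ℝ) (j : Fin m) :
    upd q k a j = if j = k then a else q j := by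
  simp [upd, Function.update_apply]

@[simp] theorem upd_same (q : 𝔼) (k : Fin m) (a : ℝ) : upd q k a k = a := by simp [upd_apply]

theorem upd_of_ne {q : 𝔼} {k : Fin m} {a : ℝ} {j : Fin m} (h : j ≠ k) : upd q k a j = q j := by
  simp [upd_apply, h]

theorem upd_eq_add (q : 𝔼) (k : Fin m) (a : ℝ) :
    upd q k a = q + (a - q k) • EuclideanSpace.single k (1 : ℝ) := by
  ext j
  by_cases h : j = k
  · subst h; simp
  · simp [upd_apply, h]

theorem upd_comm {q : 𝔼} {k l : Fin m} (h : k ≠ l) (a b : ℝ) :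
    upd (upd q k a) l b = upd (upd q l b) k a := by
  ext j; simp only [upd_apply]; grind

/-! ### Averages over boxes -/

theorem contDiff_box_integrand {c G : 𝔼 → ℝ} (hc : ContDiff ℝ ∞ c) (hG : ContDiff ℝ ∞ G) :
    ContDiff ℝ ∞ ↿(fun (p : 𝔼 × 𝔼) τ => c τ * G (p.1 + had τ p.2)) := by
  have h1 : ContDiff ℝ ∞ fun x : (𝔼 × 𝔼) × 𝔼 => had x.2 x.1.2 :=
    contDiff_had.comp (contDiff_snd.prodMk (contDiff_snd.comp contDiff_fst))
  exact (hc.comp contDiff_snd).mul (hG.comp ((contDiff_fst.comp contDiff_fst).add h1))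

theorem contDiff_weighted_avg {c G : 𝔼 → ℝ} (hc : ContDiff ℝ ∞ c) (hG : ContDiff ℝ ∞ G) :
    ContDiff ℝ ∞ fun p : 𝔼 × 𝔼 => ∫ τ in cube m, c τ * G (p.1 + had τ p.2) :=
  contDiff_setIntegral_param (contDiff_box_integrand hc hG) isCompact_cube

theorem contDiff_avg {h : 𝔼 → ℝ} (hh : ContDiff ℝ ∞ h) :
    ContDiff ℝ ∞ fun p : 𝔼 × 𝔼 => avg h p.1 p.2 := by
  simpa [avg] using contDiff_weighted_avg (c := fun _ => 1) contDiff_const hh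

theorem fderiv_weighted_avg {c G : 𝔼 → ℝ} (hc : ContDiff ℝ ∞ c) (hG : ContDiff ℝ ∞ G) (p : 𝔼 × 𝔼)
    (k : Fin m) :
    fderiv ℝ (fun p : 𝔼 × 𝔼 => ∫ τ in cube m, c τ * G (p.1 + had τ p.2)) p
      (0, EuclideanSpace.single k (1 : ℝ)) =
    ∫ τ in cube m, c τ * τ k *
      fderiv ℝ G (p.1 + had τ p.2) (EuclideanSpace.single k (1 : ℝ)) := by
  have hf := contDiff_box_integrand hc hG
  rw [(hasFDerivAt_setIntegral_param hf isCompact_cube p).fderiv,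
    ContinuousLinearMap.integral_apply]
  · refine integral_congr_ae (Eventually.of_forall fun τ => ?_)
    have h1 : HasFDerivAt (fun p : 𝔼 × 𝔼 => p.1 + had τ p.2)
        (ContinuousLinearMap.fst ℝ 𝔼 𝔼 + (hadL τ).comp (ContinuousLinearMap.snd ℝ 𝔼 𝔼)) p :=
      (hasFDerivAt_fst).add ((hadL τ).hasFDerivAt.comp p hasFDerivAt_snd)
    have h2 := ((hG.differentiable (by simp) (p.1 + had τ p.2)).hasFDerivAt.comp p h1).const_mul
      (c τ)
    have h3 : fderiv ℝ (fun x : 𝔼 × 𝔼 => c τ * G (x.1 + had τ x.2)) p = _ := h2.fderiv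
    simp only [h3]
    have h4 : had τ (EuclideanSpace.single k (1 : ℝ)) =
        τ k • EuclideanSpace.single k (1 : ℝ) := by
      ext j
      by_cases h : j = k
      · subst h; simp
      · simp [h]
    simp [h4]
    ring
  · exact (((contDiff_fderiv_left hf).continuous.comp
      (by fun_prop : Continuous fun τ : 𝔼 => (p, τ))).continuousOn).integrableOn_compact
      isCompact_cube

/-- The coordinates are independent on the unit cube, with mean `1 / 2`. -/
theorem setIntegral_cube_prod (s : Finset (Fin m)) :
    ∫ τ in cube m, ∏ j ∈ s, τ j = (1 / 2) ^ s.card := by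
  classical
  have h1 : ∫ τ in cube m, ∏ j ∈ s, τ j =
      ∫ y : Fin m → ℝ, ∏ j, (Icc (0 : ℝ) 1).indicator (fun t => if j ∈ s then t else 1) (y j) := by
    rw [← integral_indicator isCompact_cube.measurableSet,
      ← (PiLp.volume_preserving_toLp (Fin m)).integral_comp
        (MeasurableEquiv.toLp 2 (Fin m → ℝ)).measurableEmbedding]
    refine integral_congr_ae (Eventually.of_forall fun y => ?_)
    simp only
    by_cases hy : ∀ k, y k ∈ Icc (0 : ℝ) 1
    · rw [indicator_of_mem (show WithLp.toLp 2 y ∈ cube m from hy)]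
      simp only [indicator_of_mem (hy _), Finset.prod_ite_mem, Finset.univ_inter]
    · rw [indicator_of_notMem (show WithLp.toLp 2 y ∉ cube m from hy)]
      push Not at hy
      obtain ⟨k, hk⟩ := hy
      rw [Finset.prod_eq_zero (Finset.mem_univ k) (indicator_of_notMem hk _)]
  rw [h1, integral_fintype_prod_volume_eq_prod
    (f := fun j => (Icc (0 : ℝ) 1).indicator (fun t => if j ∈ s then t else 1))]
  have h2 : ∀ j, ∫ t, (Icc (0 : ℝ) 1).indicator (fun t => if j ∈ s then t else 1) t =
      if j ∈ s then 1 / 2 else 1 := by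
    intro j
    rw [integral_indicator measurableSet_Icc, integral_Icc_eq_integral_Ioc,
      ← intervalIntegral.integral_of_le zero_le_one]
    split_ifs <;> simp
  simp only [h2, Finset.prod_ite_mem, Finset.univ_inter, Finset.prod_const]

theorem avg_zero (h : 𝔼 → ℝ) (x : 𝔼) : avg h x 0 = h x := by
  have h0 : ∀ τ : 𝔼, had τ 0 = 0 := fun τ => by ext; simp
  have := setIntegral_cube_prod (∅ : Finset (Fin m))
  simp only [Finset.prod_empty, Finset.card_empty, pow_zero] at this
  simp only [avg, h0, add_zero]
  calc ∫ _ in cube m, h x = ∫ τ in cube m, h x * 1 := by simp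
    _ = h x := by rw [integral_const_mul, this, mul_one]

/-- At `q = 0` the mixed second derivative, with respect to the corner `w + q`, of the logarithm
of the average of `h` over the box between `w` and `w + q` is a quarter of that of `log h`,
since `τ_k`, `τ_l` and `τ_k τ_l` have averages `1/2`, `1/2` and `1/4` over the unit cube. -/
theorem fderiv_fderiv_log_avg {h : 𝔼 → ℝ} (hh : ContDiff ℝ ∞ h) {x : 𝔼} (h0 : h x ≠ 0)
    {k l : Fin m} (hkl : k ≠ l) :
    fderiv ℝ (fun p => fderiv ℝ (fun p : 𝔼 × 𝔼 => Real.log (avg h p.1 p.2)) p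
        (0, EuclideanSpace.single l (1 : ℝ))) (x, 0) (0, EuclideanSpace.single k (1 : ℝ)) =
      1 / 4 * fderiv ℝ (fun y => fderiv ℝ (fun z => Real.log (h z)) y
        (EuclideanSpace.single l (1 : ℝ))) x (EuclideanSpace.single k (1 : ℝ)) := by
  have hA := contDiff_avg hh
  have hfst : ∀ p : 𝔼 × 𝔼, ∀ j, fderiv ℝ (fun p : 𝔼 × 𝔼 => avg h p.1 p.2) p
      (0, EuclideanSpace.single j (1 : ℝ)) = ∫ τ in cube m, τ j *
        fderiv ℝ h (p.1 + had τ p.2) (EuclideanSpace.single j (1 : ℝ)) := by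
    intro p j
    have := fderiv_weighted_avg (c := fun _ => 1) contDiff_const hh p j
    simpa [avg] using this
  have hd0 : ∀ τ : 𝔼, had τ 0 = 0 := fun τ => by ext; simp
  have h1 : ∀ j : Fin m, ∫ τ in cube m, τ j = 1 / 2 := fun j => by
    simpa using setIntegral_cube_prod {j}
  have h2 : ∫ τ in cube m, τ l * τ k = 1 / 4 := by
    have := setIntegral_cube_prod {l, k}
    rw [Finset.card_pair hkl.symm] at this
    simp only [Finset.prod_pair hkl.symm] at this
    rw [this]; norm_num
  have hl : ContDiff ℝ ∞ fun y => fderiv ℝ h y (EuclideanSpace.single l (1 : ℝ)) :=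
    (hh.fderiv_right (m := ∞) (by simp)).clm_apply contDiff_const
  rw [fderiv_fderiv_log hA.contDiffAt (by simpa [avg_zero] using h0),
    fderiv_fderiv_log hh.contDiffAt h0]
  simp only [hfst]
  rw [fderiv_weighted_avg (c := fun τ => τ l) (by fun_prop) hl]
  simp only [hd0, add_zero, avg_zero, integral_mul_const, h1, h2]
  field_simp
  ring

/-- If a mixed second derivative of `log |h|` does not vanish at `x₀`, then the averages of `h` over
four small boxes near `x₀` with a common vertex, which differ by the `k`-th and the `l`-th
coordinate of the opposite vertex, are not in proportion. -/
theorem exists_avg_mul_avg_ne {h : 𝔼 → ℝ} {U : Set 𝔼} (hU : IsOpen U) (hh : ContDiffOn ℝ ∞ h U)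
    {x₀ : 𝔼} (hx : x₀ ∈ U) (h0 : h x₀ ≠ 0) {k l : Fin m} (hkl : k ≠ l)
    (hne : fderiv ℝ (fun y => fderiv ℝ (fun z => Real.log (h z)) y
      (EuclideanSpace.single l (1 : ℝ))) x₀ (EuclideanSpace.single k (1 : ℝ)) ≠ 0) :
    ∃ ε > 0, ∀ w ∈ Metric.ball x₀ ε, ∀ q ∈ Metric.ball (0 : 𝔼) ε, ∀ a b : ℝ,
      upd q k a ∈ Metric.ball (0 : 𝔼) ε → upd q l b ∈ Metric.ball (0 : 𝔼) ε →
      upd (upd q k a) l b ∈ Metric.ball (0 : 𝔼) ε → a ≠ q k → b ≠ q l →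
      |avg h w q| * |avg h w (upd (upd q k a) l b)| ≠
        |avg h w (upd q k a)| * |avg h w (upd q l b)| := by
  obtain ⟨g, hg, hgh⟩ := exists_contDiff_eventuallyEq hU hh hx
  have hgx : g x₀ = h x₀ := hgh.self_of_nhds
  have hlog : (fun z => Real.log (g z)) =ᶠ[𝓝 x₀] fun z => Real.log (h z) :=
    hgh.fun_comp Real.log
  have hne' : fderiv ℝ (fun y => fderiv ℝ (fun z => Real.log (g z)) y
      (EuclideanSpace.single l (1 : ℝ))) x₀ (EuclideanSpace.single k (1 : ℝ)) ≠ 0 := by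
    have : (fun y => fderiv ℝ (fun z => Real.log (g z)) y
      (EuclideanSpace.single l (1 : ℝ))) =ᶠ[𝓝 x₀] fun y => fderiv ℝ (fun z => Real.log (h z)) y
      (EuclideanSpace.single l (1 : ℝ)) := by
      filter_upwards [hlog.fderiv (𝕜 := ℝ)] with y hy
      rw [hy]
    rwa [this.fderiv_eq]
  set A : 𝔼 × 𝔼 → ℝ := fun p => avg g p.1 p.2 with hAdef
  have hA : ContDiff ℝ ∞ A := contDiff_avg hg
  have hA0 : A (x₀, 0) ≠ 0 := by simpa [hAdef, avg_zero, hgx] using h0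
  set L : 𝔼 × 𝔼 → ℝ := fun p => Real.log (A p) with hLdef
  let v : 𝔼 × 𝔼 := (0, EuclideanSpace.single l (1 : ℝ))
  let u : 𝔼 × 𝔼 := (0, EuclideanSpace.single k (1 : ℝ))
  have hopen : IsOpen {p | A p ≠ 0} := isOpen_ne_fun hA.continuous continuous_const
  have hL : ContDiffOn ℝ ∞ L {p | A p ≠ 0} := fun p hp => (hA.contDiffAt.log hp).contDiffWithinAt
  have hM0 : fderiv ℝ (fun p => fderiv ℝ L p v) (x₀, 0) u ≠ 0 := by
    have := fderiv_fderiv_log_avg hg (x := x₀) (by rwa [hgx]) hkl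
    intro h'
    rw [h'] at this
    exact hne' (by linarith)
  have hMc : ContinuousAt (fun q => fderiv ℝ (fun p => fderiv ℝ L p v) q u) (x₀, 0) := by
    have h1 : ContDiffAt ℝ ∞ (fun p => fderiv ℝ L p v) (x₀, 0) :=
      ((hL.contDiffAt (hopen.mem_nhds hA0)).fderiv_right (m := ∞) (by simp)).clm_apply
        contDiffAt_const
    exact ((h1.fderiv_right (m := ∞) (by simp)).clm_apply contDiffAt_const).continuousAt
  have hcube : ∀ᶠ p : 𝔼 × 𝔼 in 𝓝 (x₀, 0), avg h p.1 p.2 = avg g p.1 p.2 := by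
    have hc : Continuous fun x : (𝔼 × 𝔼) × 𝔼 => x.1.1 + had x.2 x.1.2 :=
      (continuous_fst.comp continuous_fst).add
        (contDiff_had.continuous.comp (by fun_prop : Continuous fun x : (𝔼 × 𝔼) × 𝔼 => (x.2, x.1.2)))
    have h0' : ∀ τ : 𝔼, had τ 0 = 0 := fun τ => by ext; simp
    have := isCompact_cube (m := m).eventually_forall_of_forall_eventually (x₀ := ((x₀, 0) : 𝔼 × 𝔼))
      (P := fun p τ => g (p.1 + had τ p.2) = h (p.1 + had τ p.2)) fun τ _ => by
        have ht : Tendsto (fun x : (𝔼 × 𝔼) × 𝔼 => x.1.1 + had x.2 x.1.2) (𝓝 ((x₀, 0), τ))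
            (𝓝 x₀) := by simpa [h0'] using hc.tendsto ((x₀, 0), τ)
        exact ht.eventually hgh
    filter_upwards [this] with p hp
    exact (setIntegral_congr_fun isCompact_cube.measurableSet fun τ hτ => hp τ hτ).symm
  obtain ⟨ε, hε, hball⟩ := Metric.eventually_nhds_iff_ball.1
    (hcube.and ((hMc.eventually_ne hM0).and (hopen.eventually_mem hA0)))
  refine ⟨ε, hε, fun w hw q hq a b hqa hqb hqab ha hb => ?_⟩
  have hmem : ∀ {q : 𝔼}, q ∈ Metric.ball (0 : 𝔼) ε → (w, q) ∈ Metric.ball ((x₀, 0) : 𝔼 × 𝔼) ε := by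
    intro q hq
    rw [← ball_prod_same]
    exact ⟨hw, hq⟩
  have e1 : (w, q) + (a - q k) • u = (w, upd q k a) := by simp [u, upd_eq_add]
  have e2 : (w, q) + (b - q l) • v = (w, upd q l b) := by simp [v, upd_eq_add]
  have e3 : (w, q) + (a - q k) • u + (b - q l) • v = (w, upd (upd q k a) l b) := by
    rw [e1]; simp [v, upd_eq_add _ l, upd_of_ne hkl.symm]
  obtain ⟨ξ, hξ, heq⟩ := exists_mixed_difference_eq (B := Metric.ball ((x₀, 0) : 𝔼 × 𝔼) ε)
    Metric.isOpen_ball (convex_ball _ _) (hL.mono fun p hp => (hball p hp).2.2)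
    (p := (w, q)) (u := (a - q k) • u) (v := (b - q l) • v) (hmem hq)
    (by rw [e1]; exact hmem hqa) (by rw [e2]; exact hmem hqb) (by rw [e3]; exact hmem hqab)
  rw [e3, e1, e2] at heq
  have hnz : ∀ {q : 𝔼}, q ∈ Metric.ball (0 : 𝔼) ε → avg g w q ≠ 0 := fun hq =>
    (hball _ (hmem hq)).2.2
  have hsc : fderiv ℝ (fun y => fderiv ℝ L y ((b - q l) • v)) ξ ((a - q k) • u) =
      (a - q k) * (b - q l) * fderiv ℝ (fun y => fderiv ℝ L y v) ξ u := by
    simp only [map_smul, smul_eq_mul]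
    rw [fderiv_const_mul]
    · simp; ring
    · exact (((hL.contDiffAt (hopen.mem_nhds (hball ξ hξ).2.2)).fderiv_right (m := ∞)
        (by simp)).differentiableAt (by simp)).clm_apply (differentiableAt_const v)
  have hlhs : L (w, upd (upd q k a) l b) - L (w, upd q k a) - L (w, upd q l b) + L (w, q) ≠ 0 := by
    rw [heq, hsc]
    exact mul_ne_zero (mul_ne_zero (sub_ne_zero.2 ha) (sub_ne_zero.2 hb)) (hball ξ hξ).2.1
  intro hcon
  apply hlhs
  have hav : ∀ {q : 𝔼}, q ∈ Metric.ball (0 : 𝔼) ε → avg h w q = avg g w q := fun hq =>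
    (hball _ (hmem hq)).1
  rw [hav hq, hav hqa, hav hqb, hav hqab] at hcon
  have := congrArg Real.log hcon
  rw [Real.log_mul (abs_ne_zero.2 (hnz hq)) (abs_ne_zero.2 (hnz hqab)),
    Real.log_mul (abs_ne_zero.2 (hnz hqa)) (abs_ne_zero.2 (hnz hqb))] at this
  simp only [Real.log_abs] at this
  simp only [hLdef, hAdef]
  linarith

end Euclid

section Euclid

variable {m : ℕ}

local notation "𝔼" => EuclideanSpace ℝ (Fin m)

/-! ### Integrals of positive functions over boxes -/

theorem box_eq_union {u v : 𝔼} {k : Fin m} {s : ℝ} (hs : s ∈ uIcc (u k) (v k)) :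
    box u v = box u (upd v k s) ∪ box (upd u k s) v := by
  ext x
  simp only [box, mem_union, mem_ofPred_eq, upd_apply]
  constructor
  · intro hx
    have hk := hx k
    rw [mem_uIcc] at hk hs
    by_cases h : x k ∈ uIcc (u k) s
    · left
      intro j
      by_cases hj : j = k
      · subst hj; simpa using h
      · simpa [hj] using hx j
    · right
      intro j
      by_cases hj : j = k
      · subst hj
        rw [mem_uIcc] at h
        simp only [if_true, mem_uIcc]
        grind
      · simpa [hj] using hx j
  · rintro (hx | hx) j <;> have := hx j <;> by_cases hj : j = k
    · subst hj
      simp only [if_true, mem_uIcc] at *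
      grind
    · simpa [hj] using this
    · subst hj
      simp only [if_true, mem_uIcc] at *
      grind
    · simpa [hj] using this

theorem volume_level (k : Fin m) (s : ℝ) : volume {x : 𝔼 | x k = s} = 0 := by
  refine volume_eq_zero_of_locally_regular_zero ?_ fun x _ =>
    ⟨univ, univ_mem, fun y => y k - s, fun y hy => ⟨?_, EuclideanSpace.proj k, ?_, ?_⟩⟩
  · exact (isClosed_eq (by fun_prop) continuous_const).measurableSet
  · simpa [sub_eq_zero] using hy.1
  · intro h0
    have := DFunLike.congr_fun h0 (EuclideanSpace.single k (1 : ℝ))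
    simp at this
  · exact ((EuclideanSpace.proj k : 𝔼 →L[ℝ] ℝ).hasFDerivAt).sub_const _

theorem setIntegral_box_split {f : 𝔼 → ℝ} {u v : 𝔼} (hf : ContinuousOn f (box u v)) {k : Fin m}
    {s : ℝ} (hs : s ∈ uIcc (u k) (v k)) :
    ∫ x in box u v, f x = (∫ x in box u (upd v k s), f x) + ∫ x in box (upd u k s) v, f x := by
  have hU := box_eq_union hs
  have hint : IntegrableOn f (box u v) := hf.integrableOn_compact (isCompact_box u v)
  have h1 : box u (upd v k s) ⊆ box u v := hU ▸ subset_union_left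
  have h2 : box (upd u k s) v ⊆ box u v := hU ▸ subset_union_right
  conv_lhs => rw [hU]
  refine setIntegral_union₀ ?_ (isCompact_box _ _).measurableSet.nullMeasurableSet
    (hint.mono_set h1) (hint.mono_set h2)
  refine measure_mono_null ?_ (volume_level k s)
  rintro x ⟨hx1, hx2⟩
  have e1 := hx1 k
  have e2 := hx2 k
  simp only [upd_same, mem_uIcc] at e1 e2 hs
  simp only [mem_ofPred_eq]
  grind

theorem avg_pos {f : 𝔼 → ℝ} {w q : 𝔼} (hf : ContinuousOn f (box w (w + q)))
    (h0 : ∀ x ∈ box w (w + q), 0 < f x) : 0 < avg f w q := by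
  have hmaps : ∀ τ ∈ cube m, w + had τ q ∈ box w (w + q) := fun τ hτ =>
    image_cube ▸ mem_image_of_mem _ hτ
  have hc : ContinuousOn (fun τ : 𝔼 => f (w + had τ q)) (cube m) := by
    refine hf.comp ?_ hmaps
    exact (continuous_const.add (contDiff_had.continuous.comp
      (by fun_prop : Continuous fun τ : 𝔼 => (τ, q)))).continuousOn
  have hne : (cube m).Nonempty := ⟨0, fun k => by simp⟩
  obtain ⟨τ₀, hτ₀, hmin⟩ := isCompact_cube.exists_isMinOn hne hc
  have hvol : ∫ τ in cube m, f (w + had τ₀ q) = f (w + had τ₀ q) := by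
    have := setIntegral_cube_prod (∅ : Finset (Fin m))
    simp only [Finset.prod_empty, Finset.card_empty, pow_zero] at this
    calc ∫ _ in cube m, f (w + had τ₀ q) = ∫ τ in cube m, f (w + had τ₀ q) * 1 := by simp
      _ = _ := by rw [integral_const_mul, this, mul_one]
  refine (h0 _ (hmaps τ₀ hτ₀)).trans_le ?_
  rw [avg, ← hvol]
  exact setIntegral_mono_on (continuousOn_const.integrableOn_compact isCompact_cube)
    (hc.integrableOn_compact isCompact_cube) isCompact_cube.measurableSet fun τ hτ => hmin hτ

theorem setIntegral_box_pos {f : 𝔼 → ℝ} {u v : 𝔼} (hf : ContinuousOn f (box u v))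
    (h0 : ∀ x ∈ box u v, 0 < f x) (huv : ∀ k, u k ≠ v k) : 0 < ∫ x in box u v, f x := by
  have e : u + (v - u) = v := by abel
  rw [← e, setIntegral_box]
  rw [← e] at hf h0
  refine mul_pos (abs_pos.2 (Finset.prod_ne_zero_iff.2 fun k _ => ?_)) (avg_pos hf h0)
  simpa [sub_eq_zero] using (huv k).symm

/-- The integral of a positive function over a box determines the position of a face, on a given
side of the opposite face. -/
theorem eq_of_setIntegral_box_eq {f : 𝔼 → ℝ} {q : 𝔼} {k : Fin m} {a b : ℝ}
    (hq : ∀ j, j ≠ k → q j ≠ 0) (hab : 0 < a * b)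
    (hfa : ContinuousOn f (box 0 (upd q k a))) (hfb : ContinuousOn f (box 0 (upd q k b)))
    (ha : ∀ x ∈ box 0 (upd q k a), 0 < f x) (hb : ∀ x ∈ box 0 (upd q k b), 0 < f x)
    (h : ∫ x in box 0 (upd q k a), f x = ∫ x in box 0 (upd q k b), f x) : a = b := by
  wlog hle : |a| ≤ |b| generalizing a b
  · exact (this (by linarith [mul_comm a b]) hfb hfa hb ha h.symm (not_le.1 hle).le).symm
  by_contra hne
  have hmem : a ∈ uIcc ((0 : 𝔼) k) (upd q k b k) := by
    simp only [PiLp.zero_apply, upd_same, mem_uIcc]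
    rcases pos_and_pos_or_neg_and_neg_of_mul_pos hab with ⟨h1, h2⟩ | ⟨h1, h2⟩
    · rw [abs_of_pos h1, abs_of_pos h2] at hle; left; exact ⟨h1.le, hle⟩
    · rw [abs_of_neg h1, abs_of_neg h2] at hle; right; exact ⟨by linarith, h1.le⟩
  have hsplit := setIntegral_box_split hfb hmem
  have e : upd (upd q k b) k a = upd q k a := by ext j; simp only [upd_apply]; grind
  rw [e, h] at hsplit
  have hsub : box (upd 0 k a) (upd q k b) ⊆ box 0 (upd q k b) := by
    rw [box_eq_union hmem]; exact subset_union_right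
  have := setIntegral_box_pos (hfb.mono hsub) (fun x hx => hb x (hsub hx)) fun j => by
    by_cases hj : j = k
    · subst hj; simpa using hne
    · simpa [upd_apply, hj] using (hq j hj).symm
  linarith

/-! ### Factorization of densities with vanishing mixed derivatives -/

/-- The open coordinate box with corners `a` and `b`. -/
def openBox (a b : Fin m → ℝ) : Set 𝔼 := {x | ∀ k, a k < x k ∧ x k < b k}

theorem isOpen_openBox (a b : Fin m → ℝ) : IsOpen (openBox a b) := by
  have : openBox a b = ⋂ k, {x : 𝔼 | a k < x k ∧ x k < b k} := by ext; simp [openBox]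
  rw [this]
  refine isOpen_iInter_of_finite fun k => ?_
  have hc : Continuous fun x : 𝔼 => x k := by fun_prop
  exact (isOpen_lt continuous_const hc).inter (isOpen_lt hc continuous_const)

theorem convex_openBox (a b : Fin m → ℝ) : Convex ℝ (openBox a b) := by
  intro x hx y hy s t hs ht hst k
  have h := convex_Ioo (a k) (b k) (hx k) (hy k) hs ht hst
  simpa using h

theorem box_subset_openBox {a b : Fin m → ℝ} {u v : 𝔼} (hu : u ∈ openBox a b)
    (hv : v ∈ openBox a b) : box u v ⊆ openBox a b := by
  intro x hx k
  have h1 := hx k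
  have h2 := hu k
  have h3 := hv k
  rw [mem_uIcc] at h1
  constructor <;> rcases h1 with h1 | h1 <;> linarith [h1.1, h1.2]

theorem upd_mem_openBox {a b : Fin m → ℝ} {u v : 𝔼} (hu : u ∈ openBox a b)
    (hv : v ∈ openBox a b) (k : Fin m) : upd u k (v k) ∈ openBox a b := by
  intro j
  by_cases h : j = k
  · subst h; simpa using hv j
  · simpa [upd_apply, h] using hu j

open Classical in
/-- The vector `x` with the coordinates outside `κ` replaced by zero. -/
noncomputable def mask (κ : Fin m → Prop) (x : 𝔼) : 𝔼 :=
  WithLp.toLp 2 fun k => if κ k then x k else 0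

open Classical in
theorem mask_apply (κ : Fin m → Prop) (x : 𝔼) (k : Fin m) :
    mask κ x k = if κ k then x k else 0 := rfl

theorem mask_mem_openBox {a b : Fin m → ℝ} {x : 𝔼} (h0 : (0 : 𝔼) ∈ openBox a b)
    (hx : x ∈ openBox a b) (κ : Fin m → Prop) : mask κ x ∈ openBox a b := by
  intro k
  rw [mask_apply]
  split_ifs
  · exact hx k
  · exact h0 k

theorem mask_congr {κ : Fin m → Prop} {x y : 𝔼} (h : ∀ k, κ k → x k = y k) :
    mask κ x = mask κ y := by
  ext k; simp only [mask_apply]; grind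

/-- The mixed second derivatives of `log |h|` vanish in all pairs of coordinates which belong to
different blocks. -/
def MixedFlat {ι : Type} (β : Fin m → ι) (h : 𝔼 → ℝ) (U : Set 𝔼) : Prop :=
  ∀ x ∈ U, ∀ k l, β k ≠ β l → fderiv ℝ (fun y => fderiv ℝ (fun z => Real.log (h z)) y
    (EuclideanSpace.single l (1 : ℝ))) x (EuclideanSpace.single k (1 : ℝ)) = 0

theorem sum_smul_single (x : 𝔼) : x = ∑ k, x k • EuclideanSpace.single k (1 : ℝ) := by
  ext j; simp [Finset.sum_apply, Pi.single_apply]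

theorem MixedFlat.fderiv_eq_zero {ι : Type} {β : Fin m → ι} {h : 𝔼 → ℝ} {U : Set 𝔼}
    (hflat : MixedFlat β h U) (hU : IsOpen U) (hh : ContDiffOn ℝ ∞ h U) (h0 : ∀ x ∈ U, h x ≠ 0)
    {y z : 𝔼} (hyz : ∀ k l, β k = β l → y k = 0 ∨ z l = 0) {x : 𝔼} (hx : x ∈ U) :
    fderiv ℝ (fun p => fderiv ℝ (fun z => Real.log (h z)) p z) x y = 0 := by
  have hlog : ContDiffAt ℝ ∞ (fun z => Real.log (h z)) x :=
    (hh.contDiffAt (hU.mem_nhds hx)).log (h0 x hx)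
  have hd : ∀ v : 𝔼, DifferentiableAt ℝ (fun p => fderiv ℝ (fun z => Real.log (h z)) p v) x :=
    fun v => ((hlog.fderiv_right (m := ∞) (by simp)).differentiableAt
      (by simp)).clm_apply (differentiableAt_const v)
  have hz : (fun p => fderiv ℝ (fun z => Real.log (h z)) p z) = fun p => ∑ l, z l *
      fderiv ℝ (fun z => Real.log (h z)) p (EuclideanSpace.single l (1 : ℝ)) := by
    funext p
    conv_lhs => rw [sum_smul_single z]
    simp
  rw [hz, fderiv_fun_sum fun l _ => (hd _).const_mul (z l)]
  conv_lhs => rw [sum_smul_single y]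
  rw [map_sum]
  refine Finset.sum_eq_zero fun k _ => ?_
  rw [map_smul, _root_.sum_apply, smul_eq_mul, Finset.mul_sum]
  refine Finset.sum_eq_zero fun l _ => ?_
  rw [fderiv_const_mul (hd _)]
  by_cases hb : β k = β l
  · rcases hyz k l hb with h | h <;> simp [h]
  · simp [hflat x hx k l hb]

/-- Up to a constant, `log |h|` is additive on pairs of vectors whose nonzero coordinates lie in
disjoint sets of blocks: the mixed difference is a mixed second derivative at another point. -/
theorem MixedFlat.log_add {ι : Type} {β : Fin m → ι} {h : 𝔼 → ℝ} {a b : Fin m → ℝ}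
    (hflat : MixedFlat β h (openBox a b)) (hh : ContDiffOn ℝ ∞ h (openBox a b))
    (h0 : ∀ x ∈ openBox a b, h x ≠ 0)
    {y z : 𝔼} (hyz : ∀ k l, β k = β l → y k = 0 ∨ z l = 0) (h00 : (0 : 𝔼) ∈ openBox a b)
    (hy : y ∈ openBox a b) (hz : z ∈ openBox a b) (hs : y + z ∈ openBox a b) :
    Real.log (h (y + z)) + Real.log (h 0) = Real.log (h y) + Real.log (h z) := by
  have hL : ContDiffOn ℝ ∞ (fun x => Real.log (h x)) (openBox a b) := hh.log h0
  obtain ⟨ξ, hξ, he⟩ := exists_mixed_difference_eq (isOpen_openBox a b) (convex_openBox a b) hL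
    (p := 0) (u := y) (v := z) h00 (by simpa) (by simpa) (by simpa)
  rw [hflat.fderiv_eq_zero (isOpen_openBox a b) hh h0 hyz hξ] at he
  simp only [zero_add] at he
  linarith

theorem MixedFlat.abs_mul {ι : Type} {β : Fin m → ι} {h : 𝔼 → ℝ} {a b : Fin m → ℝ}
    (hflat : MixedFlat β h (openBox a b)) (hh : ContDiffOn ℝ ∞ h (openBox a b))
    (h0 : ∀ x ∈ openBox a b, h x ≠ 0) (h00 : (0 : 𝔼) ∈ openBox a b) {x : 𝔼} (hx : x ∈ openBox a b)
    (i : ι) :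
    |h 0| * |h x| = |h (mask (fun k => β k = i) x)| * |h (mask (fun k => ¬ β k = i) x)| := by
  have hy := mask_mem_openBox h00 hx fun k => β k = i
  have hz := mask_mem_openBox h00 hx fun k => ¬ β k = i
  have hs : mask (fun k => β k = i) x + mask (fun k => ¬ β k = i) x = x := by
    ext k; simp only [PiLp.add_apply, mask_apply]; grind
  have := hflat.log_add hh h0 (y := mask (fun k => β k = i) x)
    (z := mask (fun k => ¬ β k = i) x) (fun k l hkl => by simp only [mask_apply]; grind) h00 hy hz
    (by rwa [hs])
  rw [hs] at this
  have h1 := abs_pos.2 (h0 _ hx)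
  have h2 := abs_pos.2 (h0 _ h00)
  have h3 := abs_pos.2 (h0 _ hy)
  have h4 := abs_pos.2 (h0 _ hz)
  refine Real.log_injOn_pos (mem_Ioi.2 (mul_pos h2 h1)) (mem_Ioi.2 (mul_pos h3 h4)) ?_
  rw [Real.log_mul h2.ne' h1.ne', Real.log_mul h3.ne' h4.ne']
  simp only [Real.log_abs]
  linarith

/-- For a density with vanishing mixed derivatives, the masses of the four intersections of two
sets cut out by the coordinates of one block with two sets cut out by the other coordinates
are in proportion. -/
theorem MixedFlat.setIntegral_cross {ι : Type} {β : Fin m → ι} {h : 𝔼 → ℝ} {a b : Fin m → ℝ}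
    (hflat : MixedFlat β h (openBox a b)) (hh : ContDiffOn ℝ ∞ h (openBox a b))
    (h0 : ∀ x ∈ openBox a b, h x ≠ 0) (h00 : (0 : 𝔼) ∈ openBox a b) (i : ι) {S S' T T' : Set 𝔼}
    (hS : ∀ x y : 𝔼, (∀ k, β k = i → x k = y k) → (x ∈ S ↔ y ∈ S))
    (hS' : ∀ x y : 𝔼, (∀ k, β k = i → x k = y k) → (x ∈ S' ↔ y ∈ S'))
    (hT : ∀ x y : 𝔼, (∀ k, β k ≠ i → x k = y k) → (x ∈ T ↔ y ∈ T))
    (hT' : ∀ x y : 𝔼, (∀ k, β k ≠ i → x k = y k) → (x ∈ T' ↔ y ∈ T'))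
    (mST : MeasurableSet (S ∩ T)) (mST' : MeasurableSet (S ∩ T'))
    (mS'T : MeasurableSet (S' ∩ T)) (mS'T' : MeasurableSet (S' ∩ T'))
    (bST : S ∩ T ⊆ openBox a b) (bST' : S ∩ T' ⊆ openBox a b)
    (bS'T : S' ∩ T ⊆ openBox a b) (bS'T' : S' ∩ T' ⊆ openBox a b) :
    (∫ x in S ∩ T, |h x|) * ∫ x in S' ∩ T', |h x| =
      (∫ x in S' ∩ T, |h x|) * ∫ x in S ∩ T', |h x| := by
  classical
  let F : Set 𝔼 → 𝔼 → ℝ := fun S x => if x ∈ S then |h (mask (fun k => β k = i) x)| else 0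
  let G : Set 𝔼 → 𝔼 → ℝ := fun T x => if x ∈ T then |h (mask (fun k => ¬ β k = i) x)| else 0
  have key : ∀ {S T : Set 𝔼}, MeasurableSet (S ∩ T) → S ∩ T ⊆ openBox a b →
      |h 0| * ∫ x in S ∩ T, |h x| = ∫ x, F S x * G T x := by
    intro S T hm hb
    rw [← integral_const_mul, ← integral_indicator hm]
    refine integral_congr_ae (Eventually.of_forall fun x => ?_)
    by_cases hx : x ∈ S ∩ T
    · simp only [indicator_of_mem hx, F, G, hx.1, hx.2, if_true]
      exact hflat.abs_mul hh h0 h00 (hb hx) i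
    · simp only [indicator_of_notMem hx, F, G]
      simp only [mem_inter_iff, not_and] at hx
      by_cases h1 : x ∈ S <;> simp [h1, hx]
  have hF : ∀ {S : Set 𝔼}, (∀ x y : 𝔼, (∀ k, β k = i → x k = y k) → (x ∈ S ↔ y ∈ S)) →
      ∀ x y : 𝔼, (∀ k, β k = i → x k = y k) → F S x = F S y := by
    intro S hS x y hxy
    simp only [F, hS x y hxy, mask_congr (κ := fun k => β k = i) hxy]
  have hG : ∀ {S : Set 𝔼}, (∀ x y : 𝔼, (∀ k, β k ≠ i → x k = y k) → (x ∈ S ↔ y ∈ S)) →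
      ∀ x y : 𝔼, (∀ k, ¬ β k = i → x k = y k) → G S x = G S y := by
    intro S hS x y hxy
    simp only [G, hS x y hxy, mask_congr (κ := fun k => ¬ β k = i) hxy]
  have hcross := integral_mul_cross (fun k => β k = i) (hF hS) (hF hS') (hG hT) (hG hT')
  rw [← key mST bST, ← key mS'T' bS'T', ← key mS'T bS'T, ← key mST' bST'] at hcross
  have h2 := abs_pos.2 (h0 _ h00)
  have h3 : |h 0| * |h 0| ≠ 0 := by positivity
  refine mul_left_cancel₀ h3 ?_
  linear_combination hcross

end Euclid

/-! ### Differentials of charts and transition maps -/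

section Charts

variable {m : ℕ} {M : Type*} [TopologicalSpace M] [ChartedSpace (EuclideanSpace ℝ (Fin m)) M]

local notation "𝔼" => EuclideanSpace ℝ (Fin m)

theorem mdifferentiable_of_mem_maximalAtlas {φ : OpenPartialHomeomorph M 𝔼}
    (hφ : φ ∈ IsManifold.maximalAtlas (𝓡 m) ∞ M) : φ.MDifferentiable (𝓡 m) (𝓡 m) :=
  ⟨(contMDiffOn_of_mem_maximalAtlas hφ).mdifferentiableOn (by simp),
    (contMDiffOn_symm_of_mem_maximalAtlas hφ).mdifferentiableOn (by simp)⟩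

/-- The tangent vector at the point with coordinates `x` whose coordinates are `v`. -/
noncomputable def lift (φ : OpenPartialHomeomorph M 𝔼) (x v : 𝔼) :
    TangentSpace (𝓡 m) (φ.symm x) :=
  mfderiv (𝓡 m) (𝓡 m) φ.symm x v

/-- The coordinates of a tangent vector. -/
noncomputable def coordVec (φ : OpenPartialHomeomorph M 𝔼) (q : M) (v : TangentSpace (𝓡 m) q) :
    𝔼 :=
  mfderiv (𝓡 m) (𝓡 m) φ q v

theorem coordDiff_eq (φ : OpenPartialHomeomorph M 𝔼) (q : M) (k : Fin m)
    (v : TangentSpace (𝓡 m) q) : coordDiff φ q k v = coordVec φ q v k := rfl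

theorem coordVec_lift {φ : OpenPartialHomeomorph M 𝔼}
    (hφ : φ ∈ IsManifold.maximalAtlas (𝓡 m) ∞ M) {x : 𝔼} (hx : x ∈ φ.target) (v : 𝔼) :
    coordVec φ (φ.symm x) (lift φ x v) = v :=
  DFunLike.congr_fun ((mdifferentiable_of_mem_maximalAtlas hφ).comp_symm_deriv hx) v

theorem lift_coordVec {φ : OpenPartialHomeomorph M 𝔼}
    (hφ : φ ∈ IsManifold.maximalAtlas (𝓡 m) ∞ M) {x : 𝔼} (hx : x ∈ φ.target)
    (v : TangentSpace (𝓡 m) (φ.symm x)) : lift φ x (coordVec φ (φ.symm x) v) = v := by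
  have h1 := (mdifferentiable_of_mem_maximalAtlas hφ).symm_comp_deriv (φ.map_target hx)
  have h2 := DFunLike.congr_fun h1 v
  rw [φ.right_inv hx] at h2
  exact h2

theorem hasFDerivAt_comp_symm {F : Type} [NormedAddCommGroup F] [NormedSpace ℝ F]
    {ψ : OpenPartialHomeomorph M 𝔼}
    (hψ : ψ ∈ IsManifold.maximalAtlas (𝓡 m) ∞ M) {x : 𝔼} (hx : x ∈ ψ.target)
    {f : M → F} (hf : MDifferentiableAt (𝓡 m) 𝓘(ℝ, F) f (ψ.symm x)) :
    HasFDerivAt (f ∘ ψ.symm) (fderiv ℝ (f ∘ ψ.symm) x) x ∧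
      ∀ v, fderiv ℝ (f ∘ ψ.symm) x v = mfderiv (𝓡 m) 𝓘(ℝ, F) f (ψ.symm x) (lift ψ x v) := by
  have h1 := (mdifferentiable_of_mem_maximalAtlas hψ).mdifferentiableAt_symm hx
  have h2 := hf.comp x h1
  refine ⟨(mdifferentiableAt_iff_differentiableAt.1 h2).hasFDerivAt, fun v => ?_⟩
  rw [← mfderiv_eq_fderiv, mfderiv_comp x hf h1]
  rfl

/-- The differential of a transition map. -/
theorem hasFDerivAt_transition {φ ψ : OpenPartialHomeomorph M 𝔼}
    (hφ : φ ∈ IsManifold.maximalAtlas (𝓡 m) ∞ M) (hψ : ψ ∈ IsManifold.maximalAtlas (𝓡 m) ∞ M)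
    {x : 𝔼} (hx : x ∈ ψ.target) (hx' : ψ.symm x ∈ φ.source) :
    HasFDerivAt (φ ∘ ψ.symm) (fderiv ℝ (φ ∘ ψ.symm) x) x ∧
      ∀ v, fderiv ℝ (φ ∘ ψ.symm) x v = coordVec φ (ψ.symm x) (lift ψ x v) :=
  hasFDerivAt_comp_symm hψ hx ((mdifferentiable_of_mem_maximalAtlas hφ).mdifferentiableAt hx')

end Charts

theorem image_symm_image {X Y : Type*} [TopologicalSpace X] [TopologicalSpace Y]
    {φ : OpenPartialHomeomorph X Y} {B : Set Y} (hB : B ⊆ φ.target) :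
    φ '' (φ.symm '' B) = B := by
  rw [image_image]
  exact (image_congr fun x hx => φ.right_inv (hB hx)).trans (image_id' B)

/-- A function on a convex open set is constant along segments in directions in which its
differential vanishes. -/
theorem eq_of_fderiv_apply_eq_zero {E : Type} [NormedAddCommGroup E] [NormedSpace ℝ E] {f : E → ℝ}
    {B : Set E} (hconv : Convex ℝ B) {y z : E} (hy : y ∈ B) (hz : z ∈ B)
    (hd : ∀ x ∈ B, ∃ f' : E →L[ℝ] ℝ, HasFDerivAt f f' x ∧ f' (z - y) = 0) : f y = f z := by
  have hline : ∀ t ∈ Icc (0 : ℝ) 1, y + t • (z - y) ∈ B := fun t ht =>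
    hconv.add_smul_sub_mem hy hz ht
  have hder : ∀ t ∈ Icc (0 : ℝ) 1, HasDerivAt (fun t : ℝ => f (y + t • (z - y))) 0 t := by
    intro t ht
    obtain ⟨f', hf', h0⟩ := hd _ (hline t ht)
    have h1 : HasDerivAt (fun t : ℝ => y + t • (z - y)) (z - y) t := by
      simpa using ((hasDerivAt_id t).smul_const (z - y)).const_add y
    have := hf'.comp_hasDerivAt t h1
    rwa [h0] at this
  obtain ⟨t, -, ht⟩ := exists_hasDerivAt_eq_slope (fun t : ℝ => f (y + t • (z - y))) (fun _ => 0)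
    zero_lt_one (fun t ht => (hder t ht).continuousAt.continuousWithinAt)
    fun t ht => hder t ⟨ht.1.le, ht.2.le⟩
  simp only [one_smul, zero_smul, add_zero, add_sub_cancel, sub_zero, div_one] at ht
  linarith

section Web

variable {m n : ℕ} {c : Fin n → ℕ} {M : Type*} [TopologicalSpace M]
  [ChartedSpace (EuclideanSpace ℝ (Fin m)) M] [IsManifold (𝓡 m) ∞ M] (W : DivFreeWeb m n c M)

local notation "𝔼" => EuclideanSpace ℝ (Fin m)

/-! ### Blocks of coordinates -/

theorem block_idx (i : Fin n) (s : Fin (c i)) : W.block (W.idx i s) = i := by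
  simp [block, idx]

theorem exists_idx_eq (k : Fin m) : ∃ s, W.idx (W.block k) s = k := by
  refine ⟨(finSigmaFinEquiv.symm (Fin.cast W.sum_codim.symm k)).2, ?_⟩
  simp [block, idx]

theorem forall_idx_iff {P : Fin m → Prop} {i : Fin n} :
    (∀ s, P (W.idx i s)) ↔ ∀ k, W.block k = i → P k := by
  constructor
  · rintro h k rfl
    obtain ⟨s, hs⟩ := W.exists_idx_eq k
    exact hs ▸ h s
  · exact fun h s => h _ (W.block_idx i s)

/-- The coordinates of `x` in the `i`-th block. -/
def blk (i : Fin n) (x : 𝔼) : Fin (c i) → ℝ := fun s => x (W.idx i s)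

theorem blk_eq_iff {i : Fin n} {x y : 𝔼} :
    W.blk i x = W.blk i y ↔ ∀ k, W.block k = i → x k = y k := by
  rw [← W.forall_idx_iff, funext_iff]; rfl

theorem continuous_blk (i : Fin n) : Continuous (W.blk i) :=
  continuous_pi fun s => by unfold blk; fun_prop

/-- The vector with prescribed blocks of coordinates. -/
def ofBlks (y : ∀ i, Fin (c i) → ℝ) : 𝔼 :=
  WithLp.toLp 2 fun k => y (finSigmaFinEquiv.symm (Fin.cast W.sum_codim.symm k)).1
    (finSigmaFinEquiv.symm (Fin.cast W.sum_codim.symm k)).2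

theorem blk_ofBlks (y : ∀ i, Fin (c i) → ℝ) (i : Fin n) : W.blk i (W.ofBlks y) = y i := by
  funext s
  have : finSigmaFinEquiv.symm (Fin.cast W.sum_codim.symm (W.idx i s)) = ⟨i, s⟩ := by simp [idx]
  simp only [blk, ofBlks]
  rw [this]

theorem continuous_ofBlks : Continuous W.ofBlks := by
  unfold ofBlks
  fun_prop

theorem eq_of_blk_eq {x y : 𝔼} (h : ∀ i, W.blk i x = W.blk i y) : x = y := by
  ext k
  exact W.blk_eq_iff.1 (h (W.block k)) k rfl

theorem ofBlks_blk (x : 𝔼) : W.ofBlks (fun i => W.blk i x) = x :=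
  W.eq_of_blk_eq fun i => W.blk_ofBlks _ i

/-! ### Charts adapted to the foliations -/

/-- In the chart `φ` the `j`-th foliation is given by the coordinates in the block `σ j`. -/
def Straightens (φ : OpenPartialHomeomorph M 𝔼) (σ : Fin n → Fin n) : Prop :=
  ∀ j, ∀ q ∈ φ.source, ∀ v : TangentSpace (𝓡 m) q,
    v ∈ (W.fol j).tangent q ↔ ∀ k, W.block k = σ j → coordVec φ q v k = 0

theorem straightens_iff {φ : OpenPartialHomeomorph M 𝔼} {σ : Fin n → Fin n} :
    W.Straightens φ σ ↔ ∀ j, ∀ q ∈ φ.source, ∀ v : TangentSpace (𝓡 m) q,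
      v ∈ (W.fol j).tangent q ↔ ∀ s : Fin (c (σ j)), coordDiff φ q (W.idx (σ j) s) v = 0 := by
  simp only [Straightens, ← W.forall_idx_iff]
  rfl

variable {W}

theorem IsAdapted.straightens {φ : OpenPartialHomeomorph M 𝔼} {p : M} (h : W.IsAdapted φ p) :
    W.Straightens φ id :=
  W.straightens_iff.2 h.2.2.2.2

theorem IsAdapted.exists_target {φ : OpenPartialHomeomorph M 𝔼} {p : M} (h : W.IsAdapted φ p) :
    ∃ a b : Fin m → ℝ, φ.target = openBox a b :=
  h.2.2.2.1

theorem IsAdapted.zero_mem {φ : OpenPartialHomeomorph M 𝔼} {p : M} (h : W.IsAdapted φ p) :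
    (0 : 𝔼) ∈ φ.target :=
  h.2.2.1 ▸ φ.map_source h.2.1

theorem IsAdapted.symm_zero {φ : OpenPartialHomeomorph M 𝔼} {p : M} (h : W.IsAdapted φ p) :
    φ.symm 0 = p := by
  rw [← h.2.2.1, φ.left_inv h.2.1]

theorem Straightens.fderiv_transition {φ ψ : OpenPartialHomeomorph M 𝔼} {σ : Fin n → Fin n}
    (hφ : φ ∈ IsManifold.maximalAtlas (𝓡 m) ∞ M) (hψ : ψ ∈ IsManifold.maximalAtlas (𝓡 m) ∞ M)
    (sφ : W.Straightens φ σ) (sψ : W.Straightens ψ id)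
    {x : 𝔼} (hx : x ∈ ψ.target) (hx' : ψ.symm x ∈ φ.source) (j : Fin n) (v : 𝔼) :
    (∀ k, W.block k = j → v k = 0) ↔
      ∀ k, W.block k = σ j → fderiv ℝ (φ ∘ ψ.symm) x v k = 0 := by
  rw [(hasFDerivAt_transition hφ hψ hx hx').2, ← sφ j _ hx', sψ j _ (ψ.map_target hx),
    coordVec_lift hψ hx]
  rfl

/-- Transition maps between charts which straighten the foliations map blocks of coordinates to
blocks of coordinates, locally. -/
theorem Straightens.transition_eq {φ ψ : OpenPartialHomeomorph M 𝔼} {σ : Fin n → Fin n}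
    (hφ : φ ∈ IsManifold.maximalAtlas (𝓡 m) ∞ M) (hψ : ψ ∈ IsManifold.maximalAtlas (𝓡 m) ∞ M)
    (sφ : W.Straightens φ σ) (sψ : W.Straightens ψ id) {B : Set 𝔼} (hB : Convex ℝ B)
    (hBψ : ∀ x ∈ B, x ∈ ψ.target ∧ ψ.symm x ∈ φ.source) {y z : 𝔼} (hy : y ∈ B) (hz : z ∈ B)
    {j : Fin n} (hyz : ∀ k, W.block k = j → y k = z k) {k : Fin m} (hk : W.block k = σ j) :
    φ (ψ.symm y) k = φ (ψ.symm z) k := by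
  refine eq_of_fderiv_apply_eq_zero (f := fun y => φ (ψ.symm y) k) hB hy hz fun x hx => ?_
  have h1 := (hasFDerivAt_transition hφ hψ (hBψ x hx).1 (hBψ x hx).2).1
  refine ⟨(EuclideanSpace.proj k : 𝔼 →L[ℝ] ℝ).comp (fderiv ℝ (φ ∘ ψ.symm) x),
    (EuclideanSpace.proj k : 𝔼 →L[ℝ] ℝ).hasFDerivAt.comp x h1, ?_⟩
  exact (sφ.fderiv_transition hφ hψ sψ (hBψ x hx).1 (hBψ x hx).2 j (z - y)).1
    (fun k hk => by simp [hyz k hk]) k hk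

/-! ### Densities -/

theorem density_ne_zero {φ : OpenPartialHomeomorph M 𝔼}
    (hφ : φ ∈ IsManifold.maximalAtlas (𝓡 m) ∞ M) {x : 𝔼} (hx : x ∈ φ.target) :
    density W.vol φ x ≠ 0 := by
  have hx' : φ.symm x ∈ φ.source := φ.map_target hx
  let e : 𝔼 ≃ₗ[ℝ] TangentSpace (𝓡 m) (φ.symm x) :=
    { toFun := lift φ x
      invFun := coordVec φ (φ.symm x)
      map_add' := fun u v => map_add (mfderiv (𝓡 m) (𝓡 m) φ.symm x) u v
      map_smul' := fun r v => map_smul (mfderiv (𝓡 m) (𝓡 m) φ.symm x) r v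
      left_inv := fun v => coordVec_lift hφ hx v
      right_inv := fun v => lift_coordVec hφ hx v }
  have h1 := (W.vol (φ.symm x)).map_basis_ne_zero_iff
    ((EuclideanSpace.basisFun (Fin m) ℝ).toBasis.map e)
  have h2 := h1.2 (W.vol_ne_zero _)
  convert h2 using 1
  simp only [density]
  congr 1
  funext k
  simp [e]
  rfl

theorem contDiffOn_density {φ : OpenPartialHomeomorph M 𝔼}
    (hφ : φ ∈ IsManifold.maximalAtlas (𝓡 m) ∞ M) : ContDiffOn ℝ ∞ (density W.vol φ) φ.target :=
  W.vol_smooth φ hφ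

/-- The volume of a set is the integral of `|h|`, since `h` has constant sign. -/
theorem IsAdapted.volIn_eq {φ : OpenPartialHomeomorph M 𝔼} {p : M} (h : W.IsAdapted φ p)
    {C : Set M} (hC : C ⊆ φ.source) (hm : MeasurableSet (φ '' C)) :
    W.volIn φ C = ∫ x in φ '' C, |density W.vol φ x| := by
  obtain ⟨a, b, hab⟩ := h.exists_target
  have hsub : φ '' C ⊆ φ.target := by rintro _ ⟨q, hq, rfl⟩; exact φ.map_source (hC hq)
  have hc := (contDiffOn_density h.1 (W := W)).continuousOn
  have hpre : IsPreconnected (density W.vol φ '' φ.target) := by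
    refine IsPreconnected.image ?_ _ hc
    rw [hab]; exact (convex_openBox a b).isPreconnected
  have hnz : (0 : ℝ) ∉ density W.vol φ '' φ.target := by
    rintro ⟨x, hx, h0⟩
    exact density_ne_zero h.1 hx h0
  have hsign : (∀ x ∈ φ.target, 0 < density W.vol φ x) ∨ ∀ x ∈ φ.target, density W.vol φ x < 0 := by
    by_contra! hcon
    obtain ⟨⟨x, hx, hx0⟩, y, hy, hy0⟩ := hcon
    exact hnz (hpre.ordConnected.out (mem_image_of_mem _ hx) (mem_image_of_mem _ hy) ⟨hx0, hy0⟩)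
  rw [volIn]
  rcases hsign with hs | hs
  · have e : ∫ x in φ '' C, |density W.vol φ x| = ∫ x in φ '' C, density W.vol φ x :=
      setIntegral_congr_fun hm fun x hx => abs_of_pos (hs x (hsub hx))
    rw [← e]
    exact abs_of_nonneg (integral_nonneg fun _ => abs_nonneg _)
  · have e : ∫ x in φ '' C, |density W.vol φ x| = ∫ x in φ '' C, -density W.vol φ x :=
      setIntegral_congr_fun hm fun x hx => abs_of_neg (hs x (hsub hx))
    rw [← abs_neg, ← integral_neg, ← e]
    exact abs_of_nonneg (integral_nonneg fun _ => abs_nonneg _)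

theorem image_coordBox {φ : OpenPartialHomeomorph M 𝔼} {p q r : M} (h : W.IsAdapted φ p)
    (hq : q ∈ φ.source) (hr : r ∈ φ.source) : φ '' coordBox φ q r = box (φ q) (φ r) := by
  obtain ⟨a, b, hab⟩ := h.exists_target
  ext x
  constructor
  · rintro ⟨y, hy, rfl⟩
    exact hy.2
  · intro hx
    have hx' : x ∈ φ.target := by
      have := box_subset_openBox (hab ▸ φ.map_source hq) (hab ▸ φ.map_source hr) hx
      rwa [hab]
    refine ⟨φ.symm x, ⟨φ.map_target hx', fun k => ?_⟩, φ.right_inv hx'⟩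
    rw [φ.right_inv hx']
    exact hx k

/-! ### The nonuniformity tensor -/

variable (W) in
/-- In all adapted charts the mixed second derivatives of `log |h|` vanish in all pairs of
coordinates which belong to different blocks. -/
def Flat : Prop :=
  ∀ φ p, W.IsAdapted φ p → MixedFlat W.block (density W.vol φ) φ.target

variable (W) in
/-- The mixed derivatives of `log |h|` are the values of the tensor on pairs of coordinate
fields. -/
theorem tensor_eq_zero_iff_flat :
    (∃ K, W.IsNonuniformityTensor K ∧ ∀ p v w, K p v w = 0) ↔ W.Flat := by
  constructor
  · rintro ⟨K, hK, h0⟩ φ p hφ x hx k l hkl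
    have hq := φ.map_target hx
    have h1 := hK φ p hφ _ hq (lift φ x (EuclideanSpace.single k (1 : ℝ)))
      (lift φ x (EuclideanSpace.single l (1 : ℝ)))
    rw [h0] at h1
    simp only [coordDiff_eq, coordVec_lift hφ.1 hx, φ.right_inv hx] at h1
    rw [Finset.sum_eq_single k, Finset.sum_eq_single l, if_neg hkl] at h1
    · simpa [logHess] using h1.symm
    · intro j _ hj; simp [hj]
    · simp
    · intro j _ hj
      refine Finset.sum_eq_zero fun i _ => ?_
      simp [hj]
    · simp
  · intro h
    refine ⟨fun _ _ _ => 0, fun φ p hφ q hq v w => ?_, fun _ _ _ => rfl⟩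
    refine (Finset.sum_eq_zero fun k _ => Finset.sum_eq_zero fun l _ => ?_).symm
    split_ifs with hkl
    · rfl
    · have := h φ p hφ _ (φ.map_source hq) k l hkl
      simp [logHess, this]

end Web

section Web

variable {m n : ℕ} {c : Fin n → ℕ} {M : Type*} [TopologicalSpace M]
  [ChartedSpace (EuclideanSpace ℝ (Fin m)) M] [IsManifold (𝓡 m) ∞ M] {W : DivFreeWeb m n c M}

local notation "𝔼" => EuclideanSpace ℝ (Fin m)

/-! ### Regions -/

/-- A product of connected sets in one adapted chart is such a product in all adapted charts whose
domain contains it: the `i`-th block of coordinates of one chart is constant on the slices of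
the product on which the `i`-th block of coordinates of the other is. -/
theorem IsRegionIn.of_chart {φ ψ : OpenPartialHomeomorph M 𝔼} {p p' : M} (hφ : W.IsAdapted φ p)
    (hψ : W.IsAdapted ψ p') {A : Set M} (hA : W.IsRegionIn ψ A) (hAφ : A ⊆ φ.source) :
    W.IsRegionIn φ A := by
  obtain ⟨hcomp, hAψ, S, hS, hAS⟩ := hA
  have hAS' : ∀ x, x ∈ ψ '' A ↔ ∀ i, W.blk i x ∈ S i := fun x => by rw [hAS]; rfl
  have hmem : ∀ x ∈ ψ '' A, x ∈ ψ.target ∧ ψ.symm x ∈ A := by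
    rintro _ ⟨q, hq, rfl⟩
    exact ⟨ψ.map_source (hAψ hq), by rwa [ψ.left_inv (hAψ hq)]⟩
  have himg : ψ '' A = W.ofBlks '' univ.pi S := by
    ext x
    rw [hAS']
    constructor
    · intro h
      exact ⟨fun i => W.blk i x, fun i _ => h i, W.ofBlks_blk x⟩
    · rintro ⟨y, hy, rfl⟩ i
      rw [W.blk_ofBlks]
      exact hy i trivial
  have hconn : IsConnected A := by
    have h1 : IsConnected (ψ '' A) := by
      rw [himg]
      exact (isConnected_univ_pi.2 fun i => (hS i).2).image _ W.continuous_ofBlks.continuousOn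
    have h2 := h1.image ψ.symm (ψ.continuousOn_symm.mono fun x hx => (hmem x hx).1)
    rwa [image_image, image_congr (fun q hq => ψ.left_inv (hAψ hq)), image_id'] at h2
  have hopen : IsOpen (ψ.target ∩ ψ.symm ⁻¹' φ.source) :=
    ψ.symm.isOpen_inter_preimage φ.open_source
  have hslice : ∀ i, ∀ y ∈ ψ '' A, ∀ z ∈ ψ '' A, W.blk i y = W.blk i z →
      W.blk i (φ (ψ.symm y)) = W.blk i (φ (ψ.symm z)) := by
    intro i y hy z hz hyz
    classical
    let T : ∀ j, Set (Fin (c j) → ℝ) := fun j => {t ∈ S j | ∀ h : j = i, t = h ▸ W.blk i y}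
    have hTS : ∀ x, x ∈ W.ofBlks '' univ.pi T ↔ x ∈ ψ '' A ∧ W.blk i x = W.blk i y := by
      intro x
      rw [hAS']
      constructor
      · rintro ⟨t, ht, rfl⟩
        simp only [W.blk_ofBlks]
        exact ⟨fun j => (ht j trivial).1, (ht i trivial).2 rfl⟩
      · rintro ⟨h1, h2⟩
        refine ⟨fun j => W.blk j x, fun j _ => ⟨h1 j, ?_⟩, W.ofBlks_blk x⟩
        rintro rfl
        exact h2
    have hT : IsPreconnected (W.ofBlks '' univ.pi T) := by
      refine (isPreconnected_univ_pi fun j => ?_).image _ W.continuous_ofBlks.continuousOn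
      by_cases h : j = i
      · subst h
        exact Set.Subsingleton.isPreconnected fun s hs t ht => (hs.2 rfl).trans (ht.2 rfl).symm
      · have : T j = S j := by
          ext t
          exact ⟨fun ht => ht.1, fun ht => ⟨ht, fun h' => absurd h' h⟩⟩
        rw [this]; exact (hS j).2.isPreconnected
    refine hT.induction₂ (fun y z => W.blk i (φ (ψ.symm y)) = W.blk i (φ (ψ.symm z)))
      (fun x hx => ?_) (fun a b d _ _ _ h1 h2 => h1.trans h2) (fun a b _ _ h => h.symm)
      ((hTS y).2 ⟨hy, rfl⟩) ((hTS z).2 ⟨hz, hyz.symm⟩)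
    have hxA := hmem x ((hTS x).1 hx).1
    obtain ⟨r, hr, hball⟩ := Metric.isOpen_iff.1 hopen x ⟨hxA.1, hAφ hxA.2⟩
    filter_upwards [self_mem_nhdsWithin, mem_nhdsWithin_of_mem_nhds (Metric.ball_mem_nhds x hr)]
      with w hw hwb
    refine W.blk_eq_iff.2 fun k hk => ?_
    refine hφ.straightens.transition_eq hφ.1 hψ.1 hψ.straightens (convex_ball x r)
      (fun v hv => hball hv) (Metric.mem_ball_self hr) hwb (j := i) ?_ hk
    exact W.blk_eq_iff.1 (((hTS x).1 hx).2.trans ((hTS w).1 hw).2.symm)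
  have hc : ContinuousOn φ A := φ.continuousOn.mono hAφ
  refine ⟨hcomp, hAφ, fun i => W.blk i '' (φ '' A), fun i => ⟨?_, ?_⟩, ?_⟩
  · exact ((hcomp.image_of_continuousOn hc).image (W.continuous_blk i)).isClosed
  · exact (hconn.image _ hc).image _ (W.continuous_blk i).continuousOn
  · ext x
    constructor
    · intro hx i
      exact ⟨x, hx, rfl⟩
    · intro hx
      have hx' : ∀ i, ∃ q ∈ A, W.blk i (φ q) = W.blk i x := by
        intro i
        obtain ⟨_, ⟨q, hq, rfl⟩, h⟩ := hx i
        exact ⟨q, hq, h⟩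
      choose q hq hqx using hx'
      have hw : W.ofBlks (fun i => W.blk i (ψ (q i))) ∈ ψ '' A := by
        rw [hAS']
        intro i
        rw [W.blk_ofBlks]
        exact (hAS' _).1 (mem_image_of_mem ψ (hq i)) i
      refine ⟨_, (hmem _ hw).2, W.eq_of_blk_eq fun i => ?_⟩
      rw [← hqx i, hslice i _ hw (ψ (q i)) (mem_image_of_mem ψ (hq i)) (W.blk_ofBlks _ i),
        ψ.left_inv (hAψ (hq i))]

theorem IsRegion.isRegionIn {φ : OpenPartialHomeomorph M 𝔼} {p : M} (hφ : W.IsAdapted φ p)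
    {A : Set M} (hA : W.IsRegion A) (hAφ : A ⊆ φ.source) : W.IsRegionIn φ A := by
  obtain ⟨ψ, p', hψ, h⟩ := hA
  exact h.of_chart hφ hψ hAφ

/-! ### Subdivided regions -/

/-- Sets which are mapped into a hypersurface with `T𝓕ᵢ ⊆ TH` by a map that is the identity in the
`i`-th block of coordinates are null sets. -/
theorem IsHypersurfaceAlong.volume_eq_zero {φ : OpenPartialHomeomorph M 𝔼} {p : M}
    (hφ : W.IsAdapted φ p) {i : Fin n} {H : Set M} (hH : W.IsHypersurfaceAlong i H) {S : Set 𝔼}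
    (hS : MeasurableSet S) {P : 𝔼 → 𝔼} {P' : 𝔼 →L[ℝ] 𝔼} (hP : ∀ x, HasFDerivAt P P' x)
    (hP' : ∀ v k, W.block k = i → P' v k = v k)
    (h : ∀ x ∈ S, P x ∈ φ.target ∧ φ.symm (P x) ∈ H) : volume S = 0 := by
  refine volume_eq_zero_of_locally_regular_zero hS fun x hx => ?_
  obtain ⟨U, hU, hxU, g, hg, hg0, hHU, hgT⟩ := hH _ (h x hx).2
  have hopen : IsOpen (φ.target ∩ φ.symm ⁻¹' U) := φ.symm.isOpen_inter_preimage hU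
  refine ⟨P ⁻¹' (φ.target ∩ φ.symm ⁻¹' U), (hP x).continuousAt.preimage_mem_nhds
    (hopen.mem_nhds ⟨(h x hx).1, hxU⟩), fun y => g (φ.symm (P y)), fun y hy => ?_⟩
  obtain ⟨hyS, hyt, hyU⟩ := hy
  have hyH : φ.symm (P y) ∈ H ∩ U := ⟨(h y hyS).2, hyU⟩
  refine ⟨(hHU ▸ hyH : φ.symm (P y) ∈ {q ∈ U | g q = 0}).2, _, ?_,
    (hasFDerivAt_comp_symm hφ.1 hyt ((hg.contMDiffAt (hU.mem_nhds hyU)).mdifferentiableAt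
      (by simp))).1.comp y (hP y)⟩
  have hd := (hasFDerivAt_comp_symm hφ.1 hyt ((hg.contMDiffAt (hU.mem_nhds hyU)).mdifferentiableAt
      (by simp))).2
  intro hzero
  apply hg0 _ hyU
  refine ContinuousLinearMap.ext fun v => ?_
  rw [← lift_coordVec hφ.1 hyt v]
  set w : 𝔼 := coordVec φ (φ.symm (P y)) v
  refine (hd w).symm.trans ?_
  have e1 : fderiv ℝ (g ∘ φ.symm) (P y) (P' w) = 0 := DFunLike.congr_fun hzero w
  have e2 : fderiv ℝ (g ∘ φ.symm) (P y) (w - P' w) = 0 := by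
    rw [hd]
    refine hgT _ hyH _ ((hφ.straightens i _ (φ.map_target hyt) _).2 fun k hk => ?_)
    rw [coordVec_lift hφ.1 hyt]
    simp [hP' w k hk]
  rw [map_sub, e1, sub_zero] at e2
  exact e2

theorem IsRegionIn.measurableSet {φ : OpenPartialHomeomorph M 𝔼} {C : Set M}
    (h : W.IsRegionIn φ C) : MeasurableSet (φ '' C) :=
  (h.1.image_of_continuousOn (φ.continuousOn.mono h.2.1)).measurableSet

theorem Subdivides.symm {i : Fin n} {H K A B : Set M} (h : W.Subdivides i H K A B) :
    W.Subdivides i H K B A :=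
  ⟨h.1, h.2.1, h.2.2.2.1, h.2.2.1, by rw [union_comm]; exact h.2.2.2.2.1,
    by rw [inter_comm]; exact h.2.2.2.2.2⟩

theorem Subdivides.volume_inter {φ : OpenPartialHomeomorph M 𝔼} {p : M} (hφ : W.IsAdapted φ p)
    {i : Fin n} {H K A B : Set M} (h : W.Subdivides i H K A B) (hA : W.IsRegionIn φ A)
    (hB : W.IsRegionIn φ B) : volume (φ '' (A ∩ B)) = 0 := by
  have hm : MeasurableSet (φ '' (A ∩ B)) := by
    rw [φ.injOn.image_inter hA.2.1 hB.2.1]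
    exact hA.measurableSet.inter hB.measurableSet
  refine h.1.volume_eq_zero hφ hm (P := id) (P' := ContinuousLinearMap.id ℝ 𝔼)
    (fun x => hasFDerivAt_id x) (fun v k _ => rfl) ?_
  rintro _ ⟨q, hq, rfl⟩
  have hqs := hA.2.1 hq.1
  exact ⟨φ.map_source hqs, by simpa [φ.left_inv hqs] using h.2.2.2.2.2 hq⟩

/-- One half of a subdivided region is the whole region in all blocks of coordinates but the one of
the foliation along which it is subdivided, unless one of the sets in question has volume zero. -/
theorem Subdivides.eq_of_blk_ne {φ : OpenPartialHomeomorph M 𝔼} {p : M} (hφ : W.IsAdapted φ p)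
    {i : Fin n} {H K A B : Set M} (h : W.Subdivides i H K A B)
    {S SA SB : ∀ i, Set (Fin (c i) → ℝ)} (hK : W.IsRegionIn φ K) (hA : W.IsRegionIn φ A)
    (hB : W.IsRegionIn φ B)
    (eK : φ '' K = {x | ∀ i, W.blk i x ∈ S i}) (eA : φ '' A = {x | ∀ i, W.blk i x ∈ SA i})
    (eB : φ '' B = {x | ∀ i, W.blk i x ∈ SB i})
    (hS : ∀ i, IsConnected (S i)) (hSA : ∀ i, IsClosed (SA i) ∧ IsConnected (SA i))
    (hSB : ∀ i, IsClosed (SB i) ∧ IsConnected (SB i))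
    (vK : volume (φ '' K) ≠ 0) (vA : volume (φ '' A) ≠ 0) {j : Fin n} (hj : j ≠ i) :
    S j ⊆ SA j := by
  classical
  have hunion : ∀ x, x ∈ φ '' K → x ∈ φ '' A ∨ x ∈ φ '' B := fun x hx => by
    rw [h.2.2.2.2.1, image_union] at hx; exact hx
  have hBK : φ '' B ⊆ φ '' K := image_mono (h.2.2.2.2.1 ▸ subset_union_right)
  have hAK : φ '' A ⊆ φ '' K := image_mono (h.2.2.2.2.1 ▸ subset_union_left)
  simp only [eK, eA, eB, subset_def, mem_ofPred_eq] at hunion hBK hAK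
  choose s hs using fun i => (hS i).nonempty
  choose sA hsA using fun i => (hSA i).2.nonempty
  choose sB hsB using fun i => (hSB i).2.nonempty
  -- a point of `S j` outside one of the halves forces the other half to be full in all
  -- the other blocks
  have full : ∀ {SA SB : ∀ i, Set (Fin (c i) → ℝ)},
      (∀ x : 𝔼, (∀ i, W.blk i x ∈ S i) → (∀ i, W.blk i x ∈ SA i) ∨ ∀ i, W.blk i x ∈ SB i) →
      ∀ {t}, t ∈ S j → t ∉ SA j → ∀ l, l ≠ j → S l ⊆ SB l := by
    intro SA SB hu t ht htA l hl u hu'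
    let y : ∀ i, Fin (c i) → ℝ := Function.update (Function.update s j t) l u
    have hyj : y j = t := by simp [y, Function.update_of_ne hl.symm]
    have hyl : y l = u := by simp [y]
    have := hu (W.ofBlks y) fun i => by
      rw [W.blk_ofBlks]
      by_cases h1 : i = l
      · subst h1; rwa [hyl]
      · by_cases h2 : i = j
        · subst h2; rwa [hyj]
        · simpa [y, Function.update_of_ne h1, Function.update_of_ne h2] using hs i
    simp only [W.blk_ofBlks] at this
    rcases this with h1 | h1
    · exact absurd (hyj ▸ h1 j) htA
    · exact hyl ▸ h1 l
  intro t ht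
  by_contra htA
  have hSBl := full hunion ht htA
  by_cases hSBj : S j ⊆ SB j
  · -- then `B` is the whole region
    apply vA
    have : A ∩ B = A := by
      refine inter_eq_left.2 fun q hq => ?_
      have hq' : φ q ∈ φ '' B := by
        rw [eB]
        have := hAK (φ q) (fun i => by
          have : φ q ∈ φ '' A := mem_image_of_mem φ hq
          rw [eA] at this
          exact this i)
        intro i
        by_cases hi : i = j
        · subst hi; exact hSBj (this i)
        · exact hSBl i hi (this i)
      obtain ⟨q', hq', e⟩ := hq'
      rwa [← φ.injOn (hB.2.1 hq') (hA.2.1 hq) e]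
    rw [← this]
    exact h.volume_inter hφ hA hB
  · obtain ⟨u, hu, huB⟩ := not_subset.1 hSBj
    have hSAl := full (fun x hx => (hunion x hx).symm) hu huB
    have hSj : S j ⊆ SA j ∪ SB j := by
      intro r hr
      have := hunion (W.ofBlks (Function.update s j r)) fun i => by
        rw [W.blk_ofBlks]
        by_cases h2 : i = j
        · subst h2; simpa
        · simpa [Function.update_of_ne h2] using hs i
      simp only [W.blk_ofBlks] at this
      rcases this with h1 | h1
      · left; simpa using h1 j
      · right; simpa using h1 j
    have hsub : ∀ {x : 𝔼}, (∀ i, W.blk i x ∈ SA i) → W.blk j x ∈ S j := fun hx => hAK _ hx j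
    have hAj : (S j ∩ SA j).Nonempty := ⟨sA j, by
      have := hAK (W.ofBlks sA) (fun i => by rw [W.blk_ofBlks]; exact hsA i) j
      rwa [W.blk_ofBlks] at this, hsA j⟩
    have hBj : (S j ∩ SB j).Nonempty := ⟨sB j, by
      have := hBK (W.ofBlks sB) (fun i => by rw [W.blk_ofBlks]; exact hsB i) j
      rwa [W.blk_ofBlks] at this, hsB j⟩
    obtain ⟨r, hrS, hrA, hrB⟩ := isPreconnected_closed_iff.1 (hS j).isPreconnected _ _ (hSA j).1
      (hSB j).1 hSj hAj hBj
    -- the slice of the region through `r` in the direction of the `i`-th block lies in `H`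
    apply vK
    let w : 𝔼 := W.ofBlks (Function.update s j r)
    let κ : Fin m → Prop := fun k => W.block k = i
    let χ : 𝔼 := WithLp.toLp 2 fun k => if κ k then 1 else 0
    have hblk_i : ∀ x, W.blk i (hadL χ x + mask (fun k => ¬ κ k) w) = W.blk i x := fun x =>
      W.blk_eq_iff.2 fun k hk => by simp [χ, κ, hk, mask_apply]
    have hblk_ne : ∀ x l, l ≠ i → W.blk l (hadL χ x + mask (fun k => ¬ κ k) w) = W.blk l w :=
      fun x l hl => W.blk_eq_iff.2 fun k hk => by
        have : ¬ κ k := fun h' => hl (hk.symm.trans h')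
        simp [χ, mask_apply, this]
    refine h.1.volume_eq_zero hφ hK.measurableSet
      (P := fun x => hadL χ x + mask (fun k => ¬ κ k) w) (P' := hadL χ)
      (fun x => (hadL χ).hasFDerivAt.add_const _) (fun v k hk => by simp [χ, κ, hk]) ?_
    intro x hx
    rw [eK] at hx
    have hmem : ∀ l, W.blk l (hadL χ x + mask (fun k => ¬ κ k) w) ∈ SA l ∩ SB l := by
      intro l
      by_cases hl : l = i
      · subst hl
        rw [hblk_i]
        exact ⟨hSAl l hj.symm (hx l), hSBl l hj.symm (hx l)⟩
      · rw [hblk_ne x l hl, W.blk_ofBlks]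
        by_cases hl' : l = j
        · subst hl'; simpa using ⟨hrA, hrB⟩
        · rw [Function.update_of_ne hl']
          exact ⟨hSAl l hl' (hs l), hSBl l hl' (hs l)⟩
    have hPA : hadL χ x + mask (fun k => ¬ κ k) w ∈ φ '' A := by
      rw [eA]; exact fun l => (hmem l).1
    have hPB : hadL χ x + mask (fun k => ¬ κ k) w ∈ φ '' B := by
      rw [eB]; exact fun l => (hmem l).2
    obtain ⟨q, hq, e⟩ := hPA
    obtain ⟨q', hq', e'⟩ := hPB
    have hqq : q = q' := φ.injOn (hA.2.1 hq) (hB.2.1 hq') (e.trans e'.symm)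
    rw [← e, φ.left_inv (hA.2.1 hq)]
    exact ⟨φ.map_source (hA.2.1 hq), h.2.2.2.2.2 ⟨hq, hqq ▸ hq'⟩⟩

/-- A half of a subdivided region is cut out by the coordinates of the block of the foliation along
which the region is subdivided, unless one of the sets in question has volume zero. -/
theorem Subdivides.exists_image_eq {φ : OpenPartialHomeomorph M 𝔼} {p : M} (hφ : W.IsAdapted φ p)
    {i : Fin n} {H K A B : Set M} (h : W.Subdivides i H K A B)
    {S : ∀ i, Set (Fin (c i) → ℝ)} (hK : W.IsRegionIn φ K)
    (eK : φ '' K = {x | ∀ i, W.blk i x ∈ S i}) (hS : ∀ i, IsConnected (S i))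
    (vK : volume (φ '' K) ≠ 0) (vA : volume (φ '' A) ≠ 0) :
    ∃ P : Set (Fin (c i) → ℝ), φ '' A = {x | W.blk i x ∈ P ∧ ∀ j, W.blk j x ∈ S j} := by
  have hAK : A ⊆ K := h.2.2.2.2.1 ▸ subset_union_left
  have hBK : B ⊆ K := h.2.2.2.2.1 ▸ subset_union_right
  have hA := h.2.2.1.isRegionIn hφ (hAK.trans hK.2.1)
  have hB := h.2.2.2.1.isRegionIn hφ (hBK.trans hK.2.1)
  obtain ⟨SA, hSA, eA⟩ := hA.2.2
  obtain ⟨SB, hSB, eB⟩ := hB.2.2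
  refine ⟨SA i, ?_⟩
  ext x
  constructor
  · intro hx
    have h1 : x ∈ φ '' K := image_mono hAK hx
    rw [eK] at h1
    rw [eA] at hx
    exact ⟨hx i, h1⟩
  · rintro ⟨h1, h2⟩
    rw [eA]
    intro j
    by_cases hj : j = i
    · subst hj; exact h1
    · exact h.eq_of_blk_ne hφ hK hA hB eK eA eB hS hSA hSB vK vA hj (h2 j)

/-- The volume of a set may be computed on a larger set which differs from it by a null set. -/
theorem volIn_congr {φ : OpenPartialHomeomorph M 𝔼} {p : M} (hφ : W.IsAdapted φ p)
    {A X N : Set M} (hAX : A ⊆ X) (hXN : X ⊆ A ∪ N)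
    (hX : X ⊆ φ.source) (mA : MeasurableSet (φ '' A)) (vN : volume (φ '' N) = 0) :
    W.volIn φ A = ∫ x in φ '' X, |density W.vol φ x| := by
  rw [hφ.volIn_eq (hAX.trans hX) mA]
  refine setIntegral_congr_set ?_
  refine (LE.le.eventuallyLE (image_mono hAX)).antisymm ?_
  rw [ae_le_set]
  refine measure_mono_null ?_ vN
  rintro _ ⟨⟨q, hq, rfl⟩, hqA⟩
  rcases hXN hq with h | h
  · exact absurd (mem_image_of_mem φ h) hqA
  · exact mem_image_of_mem φ h

/-- Each half of the region is cut out by the coordinates of a single block, so the four regions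
are, up to null sets, the intersections of two sets cut out by one block of coordinates with two
sets cut out by the other ones. If one of the halves is a null set, both sides are zero. -/
theorem Flat.volumeCondition (hflat : W.Flat) : W.VolumeCondition := by
  intro i j hij φ p hφ K hK F G A B C D hsub
  obtain ⟨rA, rB, rC, rD, hF, hG⟩ := hsub
  have hABK : A ∪ B ⊆ K := hF.2.2.2.2.1 ▸ subset_union_left
  have hCDK : C ∪ D ⊆ K := hF.2.2.2.2.1 ▸ subset_union_right
  have hs := hK.2.1
  have sA : A ⊆ K := subset_union_left.trans hABK
  have sB : B ⊆ K := subset_union_right.trans hABK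
  have sC : C ⊆ K := subset_union_left.trans hCDK
  have sD : D ⊆ K := subset_union_right.trans hCDK
  have mA := (rA.isRegionIn hφ (sA.trans hs)).measurableSet
  have mB := (rB.isRegionIn hφ (sB.trans hs)).measurableSet
  have mC := (rC.isRegionIn hφ (sC.trans hs)).measurableSet
  have mD := (rD.isRegionIn hφ (sD.trans hs)).measurableSet
  have hnull : ∀ {X Z : Set M}, X ⊆ Z → Z ⊆ K → MeasurableSet (φ '' X) → volume (φ '' Z) = 0 →
      W.volIn φ X = 0 := by
    intro X Z hXZ hZ hm h0
    rw [hφ.volIn_eq (hXZ.trans (hZ.trans hs)) hm,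
      Measure.restrict_eq_zero.2 (measure_mono_null (image_mono hXZ) h0), integral_zero_measure]
  by_cases vK : volume (φ '' K) = 0
  · rw [hnull sA subset_rfl mA vK, hnull sB subset_rfl mB vK]; ring
  by_cases vX : volume (φ '' (A ∪ B)) = 0
  · rw [hnull subset_union_left hABK mA vX, hnull subset_union_right hABK mB vX]; ring
  by_cases vX' : volume (φ '' (C ∪ D)) = 0
  · rw [hnull subset_union_left hCDK mC vX', hnull subset_union_right hCDK mD vX']; ring
  by_cases vY : volume (φ '' (A ∪ D)) = 0
  · rw [hnull subset_union_left (union_subset sA sD) mA vY,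
      hnull subset_union_right (union_subset sA sD) mD vY]; ring
  by_cases vY' : volume (φ '' (B ∪ C)) = 0
  · rw [hnull subset_union_left (union_subset sB sC) mB vY',
      hnull subset_union_right (union_subset sB sC) mC vY']; ring
  obtain ⟨S, hS, eK⟩ := hK.2.2
  have hSc : ∀ i, IsConnected (S i) := fun i => (hS i).2
  obtain ⟨P, eX⟩ := hF.exists_image_eq hφ hK eK hSc vK vX
  obtain ⟨P', eX'⟩ := hF.symm.exists_image_eq hφ hK eK hSc vK vX'
  obtain ⟨Q, eY⟩ := hG.exists_image_eq hφ hK eK hSc vK vY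
  obtain ⟨Q', eY'⟩ := hG.symm.exists_image_eq hφ hK eK hSc vK vY'
  have rX := hF.2.2.1.isRegionIn hφ (hABK.trans hs)
  have rX' := hF.2.2.2.1.isRegionIn hφ (hCDK.trans hs)
  have rY := hG.2.2.1.isRegionIn hφ ((union_subset sA sD).trans hs)
  have rY' := hG.2.2.2.1.isRegionIn hφ ((union_subset sB sC).trans hs)
  have v0 := hF.volume_inter hφ rX rX'
  -- each of the four regions is, up to a null set, an intersection of two halves
  have hA : W.volIn φ A = ∫ x in φ '' ((A ∪ B) ∩ (A ∪ D)), |density W.vol φ x| :=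
    volIn_congr hφ (fun q hq => ⟨Or.inl hq, Or.inl hq⟩)
      (by rintro q ⟨h1 | h1, h2 | h2⟩ <;> simp [h1, h2]) (inter_subset_left.trans (hABK.trans hs))
      mA v0
  have hB : W.volIn φ B = ∫ x in φ '' ((A ∪ B) ∩ (B ∪ C)), |density W.vol φ x| :=
    volIn_congr hφ (fun q hq => ⟨Or.inr hq, Or.inl hq⟩)
      (by rintro q ⟨h1 | h1, h2 | h2⟩ <;> simp [h1, h2]) (inter_subset_left.trans (hABK.trans hs))
      mB v0
  have hC : W.volIn φ C = ∫ x in φ '' ((C ∪ D) ∩ (B ∪ C)), |density W.vol φ x| :=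
    volIn_congr hφ (fun q hq => ⟨Or.inl hq, Or.inr hq⟩)
      (by rintro q ⟨h1 | h1, h2 | h2⟩ <;> simp [h1, h2]) (inter_subset_left.trans (hCDK.trans hs))
      mC v0
  have hD : W.volIn φ D = ∫ x in φ '' ((C ∪ D) ∩ (A ∪ D)), |density W.vol φ x| :=
    volIn_congr hφ (fun q hq => ⟨Or.inr hq, Or.inr hq⟩)
      (by rintro q ⟨h1 | h1, h2 | h2⟩ <;> simp [h1, h2]) (inter_subset_left.trans (hCDK.trans hs))
      mD v0
  obtain ⟨a, b, hab⟩ := hφ.exists_target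
  let cutI : Set (Fin (c i) → ℝ) → Set 𝔼 := fun P => {x | W.blk i x ∈ P ∧ W.blk i x ∈ S i}
  let cutJ : Set (Fin (c j) → ℝ) → Set 𝔼 :=
    fun Q => {x | W.blk j x ∈ Q ∧ ∀ l, l ≠ i → W.blk l x ∈ S l}
  have hcut : ∀ {X Y : Set M} {P Q}, W.IsRegionIn φ X → W.IsRegionIn φ Y →
      φ '' X = {x | W.blk i x ∈ P ∧ ∀ j, W.blk j x ∈ S j} →
      φ '' Y = {x | W.blk j x ∈ Q ∧ ∀ j, W.blk j x ∈ S j} →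
      φ '' (X ∩ Y) = cutI P ∩ cutJ Q ∧ MeasurableSet (cutI P ∩ cutJ Q) ∧
        cutI P ∩ cutJ Q ⊆ openBox a b := by
    intro X Y P Q hX hY hXe hYe
    have h1 := φ.injOn.image_inter hX.2.1 hY.2.1
    have h2 : φ '' (X ∩ Y) = cutI P ∩ cutJ Q := by
      rw [h1, hXe, hYe]
      ext x
      constructor
      · rintro ⟨⟨e1, e2⟩, e3, -⟩
        exact ⟨⟨e1, e2 i⟩, e3, fun l _ => e2 l⟩
      · rintro ⟨⟨e1, e2⟩, e3, e4⟩
        have : ∀ l, W.blk l x ∈ S l := fun l => by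
          by_cases hl : l = i
          · subst hl; exact e2
          · exact e4 l hl
        exact ⟨⟨e1, this⟩, e3, this⟩
    refine ⟨h2, ?_, ?_⟩
    · rw [← h2, h1]; exact hX.measurableSet.inter hY.measurableSet
    · rw [← h2, ← hab]
      rintro _ ⟨q, hq, rfl⟩
      exact φ.map_source (hX.2.1 hq.1)
  have dI : ∀ P, ∀ x y : 𝔼, (∀ k, W.block k = i → x k = y k) → (x ∈ cutI P ↔ y ∈ cutI P) := by
    intro P x y hxy
    simp only [cutI, mem_ofPred_eq, W.blk_eq_iff.2 hxy]
  have dJ : ∀ Q, ∀ x y : 𝔼, (∀ k, W.block k ≠ i → x k = y k) → (x ∈ cutJ Q ↔ y ∈ cutJ Q) := by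
    intro Q x y hxy
    have : ∀ l, l ≠ i → W.blk l x = W.blk l y := fun l hl =>
      W.blk_eq_iff.2 fun k hk => hxy k (by rwa [hk])
    simp only [cutJ, mem_ofPred_eq, this j hij.symm]
    refine and_congr_right fun _ => forall_congr' fun l => ?_
    refine forall_congr' fun hl => ?_
    rw [this l hl]
  obtain ⟨e1, m1, b1⟩ := hcut rX rY eX eY
  obtain ⟨e2, m2, b2⟩ := hcut rX rY' eX eY'
  obtain ⟨e3, m3, b3⟩ := hcut rX' rY eX' eY
  obtain ⟨e4, m4, b4⟩ := hcut rX' rY' eX' eY'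
  rw [hA, hB, hC, hD, e1, e2, e3, e4]
  have hsm : ContDiffOn ℝ ∞ (density W.vol φ) (openBox a b) := hab ▸ contDiffOn_density hφ.1
  have := MixedFlat.setIntegral_cross (hab ▸ hflat φ p hφ) hsm
    (fun x hx => density_ne_zero hφ.1 (hab ▸ hx)) (hab ▸ hφ.zero_mem) i
    (dI P) (dI P') (dJ Q) (dJ Q') m1 m2 m3 m4 b1 b2 b3 b4
  rw [this]; ring

theorem VolumeCondition.cutCondition (h : W.VolumeCondition) : W.CutCondition := by
  intro i j hij φ p hφ K hK F G A B C D hsub h1 h2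
  have h3 := h i j hij φ p hφ K hK F G A B C D hsub
  have hc : 0 ≤ W.volIn φ C := abs_nonneg _
  have hd : 0 ≤ W.volIn φ D := abs_nonneg _
  rw [← h2] at h1 h3 ⊢
  have h4 : W.volIn φ A * (W.volIn φ C - W.volIn φ D) = 0 := by rw [mul_sub, h3, sub_self]
  rcases mul_eq_zero.1 h4 with h5 | h5
  · rw [h5] at h1 ⊢
    exact ⟨rfl, by linarith, by linarith⟩
  · exact ⟨rfl, by linarith, by linarith⟩

end Web

section Euclid

variable {m : ℕ}

local notation "𝔼" => EuclideanSpace ℝ (Fin m)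

/-! ### Masses of boxes with a common vertex -/

theorem exists_forall_abs_le_mem {N : Set 𝔼} (hN : N ∈ 𝓝 (0 : 𝔼)) :
    ∃ δ > 0, ∀ q : 𝔼, (∀ j, |q j| ≤ δ) → q ∈ N := by
  have h1 : (WithLp.toLp 2 : (Fin m → ℝ) → 𝔼) ⁻¹' N ∈ 𝓝 (0 : Fin m → ℝ) :=
    (PiLp.continuous_toLp 2 _).continuousAt.preimage_mem_nhds hN
  obtain ⟨δ, hδ, hsub⟩ := Metric.nhds_basis_closedBall.mem_iff.1 h1
  refine ⟨δ, hδ, fun q hq => ?_⟩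
  have : (fun j => q j) ∈ Metric.closedBall (0 : Fin m → ℝ) δ := by
    rw [mem_closedBall_zero_iff, pi_norm_le_iff_of_nonneg hδ.le]
    exact hq
  exact hsub this

theorem prod_upd (q : 𝔼) (k : Fin m) (a : ℝ) : (∏ j, upd q k a j) * q k = (∏ j, q j) * a := by
  rw [← Finset.mul_prod_erase _ _ (Finset.mem_univ k),
    ← Finset.mul_prod_erase _ (fun j => q j) (Finset.mem_univ k)]
  have : ∏ j ∈ Finset.univ.erase k, upd q k a j = ∏ j ∈ Finset.univ.erase k, q j :=
    Finset.prod_congr rfl fun j hj => upd_of_ne (Finset.ne_of_mem_erase hj)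
  rw [this, upd_same]
  ring

/-- If a mixed second derivative of `log |h|` does not vanish at `x₀`, then the masses of four small
boxes near `x₀` around a common vertex are not in proportion. -/
theorem exists_box_mul_box_ne {h : 𝔼 → ℝ} {U : Set 𝔼} (hU : IsOpen U) (hh : ContDiffOn ℝ ∞ h U)
    {x₀ : 𝔼} (hx : x₀ ∈ U) (h0 : h x₀ ≠ 0) {k l : Fin m} (hkl : k ≠ l)
    (hne : fderiv ℝ (fun y => fderiv ℝ (fun z => Real.log (h z)) y
      (EuclideanSpace.single l (1 : ℝ))) x₀ (EuclideanSpace.single k (1 : ℝ)) ≠ 0) :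
    ∃ ε > 0, ∀ w ∈ Metric.ball x₀ ε, ∀ q ∈ Metric.ball (0 : 𝔼) ε, ∀ a b : ℝ,
      upd q k a ∈ Metric.ball (0 : 𝔼) ε → upd q l b ∈ Metric.ball (0 : 𝔼) ε →
      upd (upd q k a) l b ∈ Metric.ball (0 : 𝔼) ε → a ≠ q k → b ≠ q l →
      (∀ j, q j ≠ 0) → a ≠ 0 → b ≠ 0 →
      |∫ x in box w (w + q), h x| * |∫ x in box w (w + upd (upd q k a) l b), h x| ≠
        |∫ x in box w (w + upd q k a), h x| * |∫ x in box w (w + upd q l b), h x| := by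
  obtain ⟨ε, hε, H⟩ := exists_avg_mul_avg_ne hU hh hx h0 hkl hne
  refine ⟨ε, hε, fun w hw q hq a b h1 h2 h3 ha hb hq0 ha0 hb0 heq => ?_⟩
  refine H w hw q hq a b h1 h2 h3 ha hb ?_
  simp only [setIntegral_box, abs_mul, abs_abs] at heq
  have hP : (∏ j, q j) ≠ 0 := Finset.prod_ne_zero_iff.2 fun j _ => hq0 j
  have e1 := prod_upd q k a
  have e2 := prod_upd q l b
  have e3 := prod_upd (upd q k a) l b
  rw [upd_of_ne hkl.symm] at e3
  have hPa : (∏ j, upd q k a j) ≠ 0 := fun h' => by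
    rw [h', zero_mul] at e1; exact mul_ne_zero hP ha0 e1.symm
  have hPb : (∏ j, upd q l b j) ≠ 0 := fun h' => by
    rw [h', zero_mul] at e2; exact mul_ne_zero hP hb0 e2.symm
  have e4 : (∏ j, q j) * ∏ j, upd (upd q k a) l b j = (∏ j, upd q k a j) * ∏ j, upd q l b j := by
    refine mul_right_cancel₀ (hq0 l) ?_
    linear_combination (∏ j, q j) * e3 - (∏ j, upd q k a j) * e2
  have e5 : |∏ j, q j| * |∏ j, upd (upd q k a) l b j| =
      |∏ j, upd q k a j| * |∏ j, upd q l b j| := by rw [← abs_mul, e4, abs_mul]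
  have hne' : |∏ j, upd q k a j| * |∏ j, upd q l b j| ≠ 0 :=
    mul_ne_zero (abs_ne_zero.2 hPa) (abs_ne_zero.2 hPb)
  refine mul_left_cancel₀ hne' ?_
  linear_combination heq - |avg h w q| * |avg h w (upd (upd q k a) l b)| * e5

theorem continuous_abs_setIntegral_box {g : 𝔼 → ℝ} (hg : ContDiff ℝ ∞ g) :
    Continuous fun p : 𝔼 × 𝔼 => |∫ x in box p.1 p.2, g x| := by
  have h1 : ∀ p : 𝔼 × 𝔼, ∫ x in box p.1 p.2, g x =
      |∏ k, (p.2 - p.1) k| * avg g p.1 (p.2 - p.1) := fun p => by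
    rw [← setIntegral_box, add_sub_cancel]
  simp only [h1]
  have h2 : Continuous fun p : 𝔼 × 𝔼 => avg g p.1 (p.2 - p.1) :=
    (contDiff_avg hg).continuous.comp (by fun_prop : Continuous fun p : 𝔼 × 𝔼 => (p.1, p.2 - p.1))
  have h3 : ∀ k, Continuous fun p : 𝔼 × 𝔼 => (p.2 - p.1) k := fun k => by fun_prop
  exact (((continuous_finsetProd _ fun k _ => h3 k).abs).mul h2).abs

theorem continuous_upd (q : 𝔼) (k : Fin m) : Continuous fun a => upd q k a := by
  simp only [upd_eq_add]
  fun_prop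

theorem box_congr {u v u' v' : 𝔼} (h : ∀ k, u k = u' k ∧ v k = v' k ∨ u k = v' k ∧ v k = u' k) :
    box u v = box u' v' := by
  ext x
  refine forall_congr' fun k => ?_
  rcases h k with ⟨h1, h2⟩ | ⟨h1, h2⟩
  · rw [h1, h2]
  · rw [h1, h2, uIcc_comm]

end Euclid

section Web

variable {m n : ℕ} {c : Fin n → ℕ} {M : Type*} [TopologicalSpace M]
  [ChartedSpace (EuclideanSpace ℝ (Fin m)) M] [IsManifold (𝓡 m) ∞ M] {W : DivFreeWeb m n c M}

local notation "𝔼" => EuclideanSpace ℝ (Fin m)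

/-! ### Subdivisions of coordinate boxes -/

theorem isRegionIn_box {φ : OpenPartialHomeomorph M 𝔼} {p : M} (hφ : W.IsAdapted φ p) {u v : 𝔼}
    (hu : u ∈ φ.target) (hv : v ∈ φ.target) : W.IsRegionIn φ (φ.symm '' box u v) := by
  obtain ⟨a, b, hab⟩ := hφ.exists_target
  have hsub : box u v ⊆ φ.target := hab ▸ box_subset_openBox (hab ▸ hu) (hab ▸ hv)
  refine ⟨(isCompact_box u v).image_of_continuousOn (φ.continuousOn_symm.mono hsub), ?_,
    fun i => univ.pi fun s => uIcc (u (W.idx i s)) (v (W.idx i s)), fun i => ⟨?_, ?_⟩, ?_⟩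
  · rintro _ ⟨x, hx, rfl⟩
    exact φ.map_target (hsub hx)
  · exact isClosed_set_pi fun s _ => isClosed_Icc
  · exact isConnected_univ_pi.2 fun s => isConnected_Icc inf_le_sup
  · rw [image_symm_image hsub]
    ext x
    constructor
    · intro hx i s _
      exact hx _
    · intro hx k
      obtain ⟨s, hs⟩ := W.exists_idx_eq k
      have := hx (W.block k) s trivial
      beta_reduce at this
      rwa [hs] at this

theorem isHypersurfaceAlong_level {φ : OpenPartialHomeomorph M 𝔼} {p : M} (hφ : W.IsAdapted φ p)
    (k : Fin m) (s : ℝ) : W.IsHypersurfaceAlong (W.block k) {q ∈ φ.source | φ q k = s} := by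
  rintro q ⟨hq, -⟩
  have hsm : ContDiff ℝ ∞ fun x : 𝔼 => x k - s := by fun_prop
  have hd : ∀ q ∈ φ.source, ∀ v, mfderiv (𝓡 m) 𝓘(ℝ, ℝ) (fun q => φ q k - s) q v =
      coordVec φ q v k := by
    intro q hq v
    have h1 : mfderiv (𝓡 m) 𝓘(ℝ, ℝ) (fun q => φ q k - s) q =
        (mfderiv (𝓡 m) 𝓘(ℝ, ℝ) (fun x : 𝔼 => x k - s) (φ q)).comp
          (mfderiv (𝓡 m) (𝓡 m) φ q) :=
      mfderiv_comp (I' := 𝓡 m) q (g := fun x : 𝔼 => x k - s)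
        (hsm.contMDiff.mdifferentiable (by simp) (φ q))
        ((mdifferentiable_of_mem_maximalAtlas hφ.1).mdifferentiableAt hq)
    have h2 : mfderiv (𝓡 m) 𝓘(ℝ, ℝ) (fun x : 𝔼 => x k - s) (φ q) =
        (EuclideanSpace.proj k : 𝔼 →L[ℝ] ℝ) := by
      rw [mfderiv_eq_fderiv]
      exact ((EuclideanSpace.proj k : 𝔼 →L[ℝ] ℝ).hasFDerivAt.sub_const s).fderiv
    rw [h1, h2]
    rfl
  refine ⟨φ.source, φ.open_source, hq, fun q => φ q k - s, ?_, ?_, ?_, ?_⟩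
  · exact hsm.contMDiff.comp_contMDiffOn (contMDiffOn_of_mem_maximalAtlas hφ.1)
  · intro q hq h0
    obtain ⟨x, hx, rfl⟩ : ∃ x ∈ φ.target, φ.symm x = q :=
      ⟨φ q, φ.map_source hq, φ.left_inv hq⟩
    have h3 := hd _ hq (lift φ x (EuclideanSpace.single k 1))
    rw [h0, coordVec_lift hφ.1 hx] at h3
    have h4 : (0 : ℝ) = EuclideanSpace.single (𝕜 := ℝ) k 1 k := h3
    simp at h4
  · ext q
    simp only [mem_inter_iff, mem_ofPred_eq, sub_eq_zero]
    tauto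
  · rintro q ⟨⟨hq, -⟩, -⟩ v hv
    rw [hd q hq]
    exact (hφ.straightens _ q hq v).1 hv k rfl

theorem isRegion_box {φ : OpenPartialHomeomorph M 𝔼} {p : M} (hφ : W.IsAdapted φ p) {u v : 𝔼}
    (hu : u ∈ φ.target) (hv : v ∈ φ.target) : W.IsRegion (φ.symm '' box u v) :=
  ⟨φ, p, hφ, isRegionIn_box hφ hu hv⟩

theorem subdivides_box {φ : OpenPartialHomeomorph M 𝔼} {p : M} (hφ : W.IsAdapted φ p) {u v : 𝔼}
    (hu : u ∈ φ.target) (hv : v ∈ φ.target) {k : Fin m} {s : ℝ} (hs : s ∈ Icc (u k) (v k))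
    (hu' : upd u k s ∈ φ.target) (hv' : upd v k s ∈ φ.target) :
    W.Subdivides (W.block k) {q ∈ φ.source | φ q k = s} (φ.symm '' box u v)
      (φ.symm '' box u (upd v k s)) (φ.symm '' box (upd u k s) v) := by
  refine ⟨isHypersurfaceAlong_level hφ k s, isRegion_box hφ hu hv, isRegion_box hφ hu hv',
    isRegion_box hφ hu' hv, ?_, ?_⟩
  · rw [← image_union, ← box_eq_union (Icc_subset_uIcc hs)]
  · obtain ⟨a, b, hab⟩ := hφ.exists_target
    have hsub : ∀ {u v : 𝔼}, u ∈ φ.target → v ∈ φ.target → box u v ⊆ φ.target :=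
      fun hu hv => hab ▸ box_subset_openBox (hab ▸ hu) (hab ▸ hv)
    rintro _ ⟨⟨x, hx, rfl⟩, ⟨y, hy, hxy⟩⟩
    have hxt := hsub hu hv' hx
    have hyt := hsub hu' hv hy
    have := φ.symm.injOn hyt hxt hxy
    subst this
    refine ⟨φ.map_target hxt, ?_⟩
    rw [φ.right_inv hxt]
    have e1 := hx k
    have e2 := hy k
    simp only [upd_same, uIcc_of_le hs.1, uIcc_of_le hs.2] at e1 e2
    exact le_antisymm e1.2 e2.1

theorem volIn_box {φ : OpenPartialHomeomorph M 𝔼} {p : M} (hφ : W.IsAdapted φ p) {u v : 𝔼}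
    (hu : u ∈ φ.target) (hv : v ∈ φ.target) :
    W.volIn φ (φ.symm '' box u v) = ∫ x in box u v, |density W.vol φ x| := by
  obtain ⟨a, b, hab⟩ := hφ.exists_target
  have hsub : box u v ⊆ φ.target := hab ▸ box_subset_openBox (hab ▸ hu) (hab ▸ hv)
  have h := isRegionIn_box hφ hu hv
  rw [hφ.volIn_eq h.2.1 h.measurableSet, image_symm_image hsub]

/-- If a mixed second derivative of `log |h|` in the coordinates `k` and `l` does not vanish at
`x₀`, then a small cube around `x₀` is cut by a hyperplane `x_k = s` into two halves of equal volume, and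
so is the lower half by a hyperplane `x_l = t`. By the cut condition the four boxes have equal
volumes, which contradicts `exists_box_mul_box_ne`. -/
theorem CutCondition.flat (hcut : W.CutCondition) : W.Flat := by
  intro φ p hφ x₀ hx₀ k l hkl
  by_contra hne
  have hkl' : k ≠ l := fun h => hkl (by rw [h])
  obtain ⟨a, b, hab⟩ := hφ.exists_target
  have hh := contDiffOn_density (W := W) hφ.1
  have hc : ContinuousOn (fun x => |density W.vol φ x|) φ.target := hh.continuousOn.abs
  obtain ⟨ε, hε, hcore⟩ := exists_box_mul_box_ne φ.open_target hh hx₀ (density_ne_zero hφ.1 hx₀)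
    hkl' hne
  obtain ⟨g, hg, hgh⟩ := exists_contDiff_eventuallyEq φ.open_target hh hx₀
  -- a cube around `x₀`, of size `δ`, in which everything takes place
  obtain ⟨δ, hδ, hsmall⟩ : ∃ δ > 0, ∀ q : 𝔼, (∀ j, |q j| ≤ δ) → q ∈ Metric.ball (0 : 𝔼) ε ∧
      x₀ + q ∈ φ.target ∧ g (x₀ + q) = density W.vol φ (x₀ + q) := by
    have ht : Tendsto (fun q : 𝔼 => x₀ + q) (𝓝 0) (𝓝 x₀) := by
      have : Continuous fun q : 𝔼 => x₀ + q := by fun_prop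
      simpa using this.tendsto 0
    have hb : ∀ᶠ q in 𝓝 (0 : 𝔼), q ∈ Metric.ball (0 : 𝔼) ε := Metric.ball_mem_nhds 0 hε
    exact exists_forall_abs_le_mem (hb.and
      ((ht.eventually (φ.open_target.mem_nhds hx₀)).and (ht.eventually hgh)))
  have hnear : ∀ x : 𝔼, (∀ j, |x j - x₀ j| ≤ δ) → x ∈ φ.target ∧ g x = density W.vol φ x ∧
      x ∈ Metric.ball x₀ ε := by
    intro x hx
    obtain ⟨h1, h2, h3⟩ := hsmall (x - x₀) (by simpa using hx)
    rw [add_sub_cancel] at h2 h3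
    refine ⟨h2, h3, ?_⟩
    rwa [mem_ball_zero_iff, ← mem_ball_iff_norm] at h1
  let u : 𝔼 := WithLp.toLp 2 fun j => x₀ j - δ / 2
  let v : 𝔼 := WithLp.toLp 2 fun j => x₀ j + δ / 2
  have hIn : ∀ x : 𝔼, (∀ j, x j ∈ Icc (u j) (v j)) → ∀ j, |x j - x₀ j| ≤ δ := by
    intro x hx j
    have := hx j
    simp only [u, v, mem_Icc] at this
    rw [abs_le]; constructor <;> linarith
  have huv : ∀ j, u j < v j := fun j => by simp only [u, v]; linarith
  have hself : ∀ j, u j ∈ Icc (u j) (v j) := fun j => left_mem_Icc.2 (huv j).le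
  have hself' : ∀ j, v j ∈ Icc (u j) (v j) := fun j => right_mem_Icc.2 (huv j).le
  have hupd : ∀ {x : 𝔼} {k s}, (∀ j, x j ∈ Icc (u j) (v j)) → s ∈ Icc (u k) (v k) →
      ∀ j, upd x k s j ∈ Icc (u j) (v j) := by
    intro x k s hx hs j
    by_cases h : j = k
    · subst h; simpa using hs
    · simpa [upd_apply, h] using hx j
  have htar : ∀ {x : 𝔼}, (∀ j, x j ∈ Icc (u j) (v j)) → x ∈ φ.target := fun hx =>
    (hnear _ (hIn _ hx)).1
  have hbox : ∀ {y z : 𝔼}, (∀ j, y j ∈ Icc (u j) (v j)) → (∀ j, z j ∈ Icc (u j) (v j)) →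
      ∀ x ∈ box y z, ∀ j, x j ∈ Icc (u j) (v j) := fun hy hz x hx j =>
    uIcc_subset_Icc (hy j) (hz j) (hx j)
  let μ : 𝔼 → 𝔼 → ℝ := fun y z => W.volIn φ (φ.symm '' box y z)
  have hμ : ∀ {y z : 𝔼}, (∀ j, y j ∈ Icc (u j) (v j)) → (∀ j, z j ∈ Icc (u j) (v j)) →
      μ y z = ∫ x in box y z, |density W.vol φ x| := fun hy hz =>
    volIn_box hφ (htar hy) (htar hz)
  have hμ' : ∀ {y z : 𝔼}, (∀ j, y j ∈ Icc (u j) (v j)) → (∀ j, z j ∈ Icc (u j) (v j)) →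
      μ y z = |∫ x in box y z, density W.vol φ x| := fun {y z} hy hz => by
    have : φ '' (φ.symm '' box y z) = box y z :=
      image_symm_image fun x hx => htar (hbox hy hz x hx)
    simp only [μ, volIn, this]
  have hμg : ∀ {y z : 𝔼}, (∀ j, y j ∈ Icc (u j) (v j)) → (∀ j, z j ∈ Icc (u j) (v j)) →
      μ y z = |∫ x in box y z, g x| := fun {y z} hy hz => by
    rw [hμ' hy hz, setIntegral_congr_fun (isCompact_box y z).measurableSet fun x hx =>
      (hnear x (hIn x (hbox hy hz x hx))).2.1.symm]
  have hμ0 : ∀ {y z : 𝔼} {j}, (∀ j, y j ∈ Icc (u j) (v j)) → (∀ j, z j ∈ Icc (u j) (v j)) →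
      y j = z j → μ y z = 0 := fun {y z j} hy hz h => by
    rw [hμ hy hz, Measure.restrict_eq_zero.2 (volume_box_of_eq h), integral_zero_measure]
  have hμpos : ∀ y z, 0 ≤ μ y z := fun y z => abs_nonneg _
  have hsplit : ∀ {y z : 𝔼} {k s}, (∀ j, y j ∈ Icc (u j) (v j)) → (∀ j, z j ∈ Icc (u j) (v j)) →
      s ∈ Icc (u k) (v k) → s ∈ uIcc (y k) (z k) →
      μ y z = μ y (upd z k s) + μ (upd y k s) z := by
    intro y z k s hy hz hs hs'
    rw [hμ hy hz, hμ hy (hupd hz hs), hμ (hupd hy hs) hz]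
    exact setIntegral_box_split (hc.mono fun x hx => htar (hbox hy hz x hx)) hs'
  -- every box can be cut in two halves of equal volume by a hyperplane
  have hhalf : ∀ {z : 𝔼} (k), (∀ j, z j ∈ Icc (u j) (v j)) → z k = v k →
      ∃ s ∈ Icc (u k) (v k), μ u (upd z k s) = μ (upd u k s) z := by
    intro z k hz hzk
    have hcont : ContinuousOn (fun s => μ u (upd z k s) - μ (upd u k s) z) (Icc (u k) (v k)) := by
      have h1 : Continuous fun s => |∫ x in box u (upd z k s), g x| -
          |∫ x in box (upd u k s) z, g x| :=
        ((continuous_abs_setIntegral_box hg).comp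
          (continuous_const.prodMk (continuous_upd z k))).sub
        ((continuous_abs_setIntegral_box hg).comp ((continuous_upd u k).prodMk continuous_const))
      refine h1.continuousOn.congr fun s hs => ?_
      simp only
      rw [hμg hself (hupd hz hs), hμg (hupd hself hs) hz]
    have h0 : (0 : ℝ) ∈ Icc (μ u (upd z k (u k)) - μ (upd u k (u k)) z)
        (μ u (upd z k (v k)) - μ (upd u k (v k)) z) := by
      rw [hμ0 (j := k) hself (hupd hz (hself k)) (by simp),
        hμ0 (j := k) (hupd hself (hself' k)) hz (by simp [hzk])]
      constructor
      · simpa using hμpos _ _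
      · simpa using hμpos _ _
    obtain ⟨s, hs, h⟩ := intermediate_value_Icc (huv k).le hcont h0
    exact ⟨s, hs, sub_eq_zero.1 h⟩
  obtain ⟨s, hs, hs1⟩ := hhalf k hself' rfl
  have hvs := hupd hself' hs
  have hus := hupd hself hs
  obtain ⟨t, ht, ht1⟩ := hhalf l hvs (upd_of_ne hkl'.symm)
  have hvt := hupd hself' ht
  have hut := hupd hself ht
  have hvst := hupd hvs ht
  have hust := hupd hus ht
  have ht_v : t ∈ uIcc (u l) (upd v k s l) := by
    rw [upd_of_ne hkl'.symm]; exact Icc_subset_uIcc ht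
  have ht_u : t ∈ uIcc (upd u k s l) (v l) := by
    rw [upd_of_ne hkl'.symm]; exact Icc_subset_uIcc ht
  have hs_v : s ∈ uIcc (u k) (upd v l t k) := by
    rw [upd_of_ne hkl']; exact Icc_subset_uIcc hs
  have hs_u : s ∈ uIcc (upd u l t k) (v k) := by
    rw [upd_of_ne hkl']; exact Icc_subset_uIcc hs
  have eAB : φ.symm '' box u (upd v k s) = φ.symm '' box u (upd (upd v k s) l t) ∪
      φ.symm '' box (upd u l t) (upd v k s) := by rw [← image_union, ← box_eq_union ht_v]
  have eCD : φ.symm '' box (upd u k s) v = φ.symm '' box (upd (upd u k s) l t) v ∪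
      φ.symm '' box (upd u k s) (upd v l t) := by
    rw [← image_union, union_comm, ← box_eq_union ht_u]
  have eAD : φ.symm '' box u (upd v l t) = φ.symm '' box u (upd (upd v k s) l t) ∪
      φ.symm '' box (upd u k s) (upd v l t) := by
    rw [upd_comm hkl', ← image_union, ← box_eq_union hs_v]
  have eBC : φ.symm '' box (upd u l t) v = φ.symm '' box (upd u l t) (upd v k s) ∪
      φ.symm '' box (upd (upd u k s) l t) v := by
    rw [upd_comm hkl', ← image_union, ← box_eq_union hs_u]
  have hsub : W.SubdividesInFour (W.block k) (W.block l) {q ∈ φ.source | φ q k = s}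
      {q ∈ φ.source | φ q l = t} (φ.symm '' box u v) (φ.symm '' box u (upd (upd v k s) l t))
      (φ.symm '' box (upd u l t) (upd v k s)) (φ.symm '' box (upd (upd u k s) l t) v)
      (φ.symm '' box (upd u k s) (upd v l t)) := by
    refine ⟨isRegion_box hφ (htar hself) (htar hvst), isRegion_box hφ (htar hut) (htar hvs),
      isRegion_box hφ (htar hust) (htar hself'), isRegion_box hφ (htar hus) (htar hvt), ?_, ?_⟩
    · rw [← eAB, ← eCD]
      exact subdivides_box hφ (htar hself) (htar hself') hs (htar hus) (htar hvs)
    · rw [← eAD, ← eBC]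
      exact subdivides_box hφ (htar hself) (htar hself') ht (htar hut) (htar hvt)
  have sAB := hsplit hself hvs ht ht_v
  have sCD := hsplit hus hself' ht ht_u
  have sK := hsplit hself hself' hs (Icc_subset_uIcc hs)
  obtain ⟨q1, q2, q3⟩ := hcut _ _ hkl φ p hφ _ (isRegionIn_box hφ (htar hself) (htar hself'))
    _ _ _ _ _ _ hsub (by change μ _ _ + μ _ _ = μ _ _ + μ _ _; linarith) ht1
  change μ _ _ = μ _ _ at q1 q2 q3
  have hKpos : 0 < μ u v := by
    rw [hμ hself hself']
    exact setIntegral_box_pos (hc.mono fun x hx => htar (hbox hself hself' x hx))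
      (fun x hx => abs_pos.2 (density_ne_zero hφ.1 (htar (hbox hself hself' x hx))))
      fun j => (huv j).ne
  have hpos : 0 < μ u (upd (upd v k s) l t) := by linarith
  have hsu : s ≠ u k := fun h => hpos.ne' (hμ0 (j := k) hself hvst (by simp [upd_apply, hkl', h]))
  have htu : t ≠ u l := fun h => hpos.ne' (hμ0 (j := l) hself hvst (by simp [h]))
  have hsv : s ≠ v k := fun h => (show μ (upd (upd u k s) l t) v ≠ 0 by linarith)
    (hμ0 (j := k) hust hself' (by simp [upd_apply, hkl', h]))
  have htv : t ≠ v l := fun h => (show μ (upd (upd u k s) l t) v ≠ 0 by linarith)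
    (hμ0 (j := l) hust hself' (by simp [h]))
  -- the four boxes have the common vertex `z`
  set z := upd (upd u k s) l t with hz
  have hdiff : ∀ {x : 𝔼}, (∀ j, x j ∈ Icc (u j) (v j)) → x - z ∈ Metric.ball (0 : 𝔼) ε := by
    intro x hx
    refine (hsmall (x - z) fun j => ?_).1
    have h1 := hx j
    have h2 := hust j
    simp only [u, v, mem_Icc] at h1 h2
    rw [PiLp.sub_apply, abs_le]; constructor <;> linarith
  have hzk : z k = s := by simp [hz, upd_of_ne hkl']
  have hzl : z l = t := by simp [hz]
  have hzj : ∀ j, j ≠ k → j ≠ l → z j = u j := fun j h1 h2 => by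
    simp [hz, upd_of_ne h1, upd_of_ne h2]
  have hupdsub : ∀ (x : 𝔼) (j : Fin m) (r : ℝ), upd (x - z) j (r - z j) = upd x j r - z := by
    intro x j r
    ext i
    simp only [PiLp.sub_apply, upd_apply]
    split_ifs with h
    · rw [h]
    · rfl
  have ek : u k - s = u k - z k := by rw [hzk]
  have el : u l - t = u l - z l := by rw [hzl]
  have huk := hupd hself' (hself k)
  have hul := hupd hself' (hself l)
  have hukl := hupd huk (hself l)
  refine hcore z (hnear z (hIn z hust)).2.2 (v - z) (hdiff hself') (u k - s) (u l - t) ?_ ?_ ?_ ?_ ?_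
    ?_ (sub_ne_zero.2 hsu.symm) (sub_ne_zero.2 htu.symm) ?_
  · rw [ek, hupdsub]; exact hdiff huk
  · rw [el, hupdsub]; exact hdiff hul
  · rw [ek, el, hupdsub, hupdsub]; exact hdiff hukl
  · simp [hzk, (huv k).ne]
  · simp [hzl, (huv l).ne]
  · intro j
    rw [PiLp.sub_apply, sub_ne_zero]
    by_cases h1 : j = k
    · subst h1; rw [hzk]; exact hsv.symm
    · by_cases h2 : j = l
      · subst h2; rw [hzl]; exact htv.symm
      · rw [hzj j h1 h2]; exact (huv j).ne'
  · rw [ek, el, hupdsub, hupdsub, hupdsub, add_sub_cancel, add_sub_cancel, add_sub_cancel,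
      add_sub_cancel, ← hμ' hust hself', ← hμ' hust hukl, ← hμ' hust huk, ← hμ' hust hul]
    have bA : box z (upd (upd v k (u k)) l (u l)) = box u (upd (upd v k s) l t) :=
      box_congr fun j => by simp only [hz, upd_apply]; grind
    have bB : box z (upd v k (u k)) = box (upd u l t) (upd v k s) :=
      box_congr fun j => by simp only [hz, upd_apply]; grind
    have bD : box z (upd v l (u l)) = box (upd u k s) (upd v l t) :=
      box_congr fun j => by simp only [hz, upd_apply]; grind
    simp only [μ] at q1 q2 q3 ⊢
    rw [bA, bB, bD, ← q3, ← q2, q1]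

end Web

section Euclid

variable {m : ℕ}

local notation "𝔼" => EuclideanSpace ℝ (Fin m)

/-! ### Local diffeomorphisms of Euclidean space and changes of charts -/

/-- The inverse function theorem, with smoothness of the inverse on a whole neighbourhood. -/
theorem exists_openPartialHomeomorph {f : 𝔼 → 𝔼} {U : Set 𝔼} (hU : IsOpen U)
    (hf : ContDiffOn ℝ ∞ f U) {a : 𝔼} (ha : a ∈ U) (hinj : Function.Injective (fderiv ℝ f a)) :
    ∃ Ψ : OpenPartialHomeomorph 𝔼 𝔼, a ∈ Ψ.source ∧ Ψ.source ⊆ U ∧ (∀ x, Ψ x = f x) ∧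
      ContDiffOn ℝ ∞ Ψ Ψ.source ∧ ContDiffOn ℝ ∞ Ψ.symm Ψ.target := by
  have hfa : ContDiffAt ℝ ∞ f a := hf.contDiffAt (hU.mem_nhds ha)
  let e : 𝔼 ≃L[ℝ] 𝔼 :=
    (LinearEquiv.ofInjectiveEndo (fderiv ℝ f a : 𝔼 →ₗ[ℝ] 𝔼) hinj).toContinuousLinearEquiv
  have he : (e : 𝔼 →L[ℝ] 𝔼) = fderiv ℝ f a := by ext v; rfl
  have hd : HasFDerivAt f (e : 𝔼 →L[ℝ] 𝔼) a := by
    rw [he]; exact (hfa.differentiableAt (by simp)).hasFDerivAt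
  let Φ := hfa.toOpenPartialHomeomorph f hd (by simp)
  have hc : ContinuousAt (fderiv ℝ f) a := (hfa.fderiv_right (m := ∞) (by simp)).continuousAt
  have hinv : ∀ᶠ x in 𝓝 a, fderiv ℝ f x ∈ range ((↑) : (𝔼 ≃L[ℝ] 𝔼) → 𝔼 →L[ℝ] 𝔼) :=
    hc.eventually (he ▸ ContinuousLinearEquiv.nhds e)
  obtain ⟨V, hVsub, hV, haV⟩ := mem_nhds_iff.1 (inter_mem hinv (hU.mem_nhds ha))
  refine ⟨Φ.restrOpen V hV, ?_, ?_, fun x => rfl, ?_, ?_⟩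
  · exact ⟨hfa.mem_toOpenPartialHomeomorph_source hd (by simp), haV⟩
  · exact fun x hx => (hVsub hx.2).2
  · exact hf.mono fun x hx => (hVsub hx.2).2
  · intro y hy
    have hx := (Φ.restrOpen V hV).map_target hy
    obtain ⟨e', he'⟩ := (hVsub hx.2).1
    have hfx : ContDiffAt ℝ ∞ f ((Φ.restrOpen V hV).symm y) :=
      hf.contDiffAt (hU.mem_nhds (hVsub hx.2).2)
    refine ((Φ.restrOpen V hV).contDiffAt_symm hy (f₀' := e') ?_ hfx).contDiffWithinAt
    rw [he']
    exact (hfx.differentiableAt (by simp)).hasFDerivAt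

/-- Every point of a chart is a limit of points off the coordinate hyperplanes. -/
theorem exists_generic_tendsto {M : Type*} [TopologicalSpace M] {φ : OpenPartialHomeomorph M 𝔼}
    {q : M} (hq : q ∈ φ.source) :
    ∃ γ : ℝ → M, Tendsto γ (𝓝[>] 0) (𝓝 q) ∧ ∀ᶠ t in 𝓝[>] 0, ∀ l, φ (γ t) l ≠ 0 := by
  let e : 𝔼 := WithLp.toLp 2 fun _ => 1
  have hlim : Tendsto (fun t : ℝ => φ q + t • e) (𝓝[>] 0) (𝓝 (φ q)) := by
    have : Continuous fun t : ℝ => φ q + t • e := by fun_prop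
    simpa using (this.tendsto 0).mono_left nhdsWithin_le_nhds
  refine ⟨fun t => φ.symm (φ q + t • e), ?_, ?_⟩
  · have := (φ.continuousAt_symm (φ.map_source hq)).tendsto.comp hlim
    rwa [φ.left_inv hq] at this
  · have h1 := hlim.eventually (φ.open_target.mem_nhds (φ.map_source hq))
    have h2 : ∀ᶠ t : ℝ in 𝓝[>] 0, ∀ l, φ q l + t ≠ 0 := by
      refine eventually_all.2 fun l => ?_
      by_cases h : φ q l = 0
      · filter_upwards [self_mem_nhdsWithin] with t ht
        rw [h, zero_add]; exact ne_of_gt ht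
      · have : Tendsto (fun t : ℝ => φ q l + t) (𝓝[>] 0) (𝓝 (φ q l)) := by
          have : Continuous fun t : ℝ => φ q l + t := by fun_prop
          simpa using (this.tendsto 0).mono_left nhdsWithin_le_nhds
        exact this.eventually_ne h
    filter_upwards [h1, h2] with t ht ht' l
    rw [φ.right_inv ht]
    simpa [e] using ht' l

end Euclid

section ChangeOfChart

variable {m : ℕ} {M : Type*} [TopologicalSpace M] [ChartedSpace (EuclideanSpace ℝ (Fin m)) M]

local notation "𝔼" => EuclideanSpace ℝ (Fin m)

theorem smoothFixing_tendsto {p : M} (f : smoothFixing (M := M) m p) :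
    Tendsto ((f : Function.End M) : M → M) (𝓝 p) (𝓝 p) := by
  have h : Tendsto ((f : Function.End M) : M → M) (𝓝 p) (𝓝 ((f : Function.End M) p)) :=
    f.2.2.self_of_nhds.continuousAt
  rwa [f.2.1] at h

/-- A smooth map which fixes all points near `p` off the coordinate hyperplanes fixes all points
near `p`. -/
theorem eventually_eq_of_generic [T2Space M] {φ : OpenPartialHomeomorph M 𝔼} {p : M}
    (hp : p ∈ φ.source) (f : smoothFixing (M := M) m p)
    (hf : ∀ᶠ q in 𝓝 p, (∀ l, φ q l ≠ 0) → (f : Function.End M) q = q) :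
    ∀ᶠ q in 𝓝 p, (f : Function.End M) q = q := by
  filter_upwards [eventually_eventually_nhds.2 hf, f.2.2, φ.open_source.mem_nhds hp]
    with q hq hfq hqs
  obtain ⟨γ, hγ, hgen⟩ := exists_generic_tendsto hqs
  have h1 : Tendsto (fun t => (f : Function.End M) (γ t)) (𝓝[>] 0)
      (𝓝 ((f : Function.End M) q)) := hfq.continuousAt.tendsto.comp hγ
  refine tendsto_nhds_unique (h1.congr' ?_) hγ
  filter_upwards [hγ.eventually hq, hgen] with t ht ht'
  exact ht ht'

/-- A loop is trivial if and only if its representative is the identity near `p`. -/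
theorem loop_eq_one_iff {p : M} {rk rl : DiffGerm m p} {fk fl : smoothFixing (M := M) m p}
    (hk : (rk : (germCon (M := M) m p).Quotient) = fk)
    (hl : (rl : (germCon (M := M) m p).Quotient) = fl) :
    rl * rk * rl * rk = 1 ↔
      ∀ᶠ q in 𝓝 p, ((fl * fk * fl * fk : smoothFixing (M := M) m p) : Function.End M) q = q := by
  rw [← Units.val_inj]
  simp only [Units.val_mul, hk, hl, Units.val_one, ← Con.coe_mul, ← Con.coe_one]
  rw [Con.eq]
  rfl

theorem trans_mem_maximalAtlas [IsManifold (𝓡 m) ∞ M] {φ : OpenPartialHomeomorph M 𝔼}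
    (hφ : φ ∈ IsManifold.maximalAtlas (𝓡 m) ∞ M) {ψ : OpenPartialHomeomorph 𝔼 𝔼}
    (hψ : ContDiffOn ℝ ∞ ψ ψ.source) (hψ' : ContDiffOn ℝ ∞ ψ.symm ψ.target) :
    φ.trans ψ ∈ IsManifold.maximalAtlas (𝓡 m) ∞ M := by
  refine (φ.trans ψ).mem_maximalAtlas_of_contMDiffOn ?_ ?_
  · rw [φ.trans_source]
    exact hψ.contMDiffOn.comp ((contMDiffOn_of_mem_maximalAtlas hφ).mono inter_subset_left)
      inter_subset_right
  · rw [φ.trans_target]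
    exact (contMDiffOn_symm_of_mem_maximalAtlas hφ).comp
      (hψ'.contMDiffOn.mono inter_subset_left) inter_subset_right

theorem coordVec_trans {φ : OpenPartialHomeomorph M 𝔼}
    (hφ : φ ∈ IsManifold.maximalAtlas (𝓡 m) ∞ M) {ψ : OpenPartialHomeomorph 𝔼 𝔼}
    (hψ : ContDiffOn ℝ ∞ ψ ψ.source) {q : M} (hq : q ∈ φ.source) (hq' : φ q ∈ ψ.source)
    (v : TangentSpace (𝓡 m) q) :
    coordVec (φ.trans ψ) q v = fderiv ℝ ψ (φ q) (coordVec φ q v) := by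
  have h1 : mfderiv (𝓡 m) (𝓡 m) (ψ ∘ φ) q =
      (mfderiv (𝓡 m) (𝓡 m) ψ (φ q)).comp (mfderiv (𝓡 m) (𝓡 m) φ q) :=
    mfderiv_comp (I' := 𝓡 m) q
      ((hψ.contDiffAt (ψ.open_source.mem_nhds hq')).contMDiffAt.mdifferentiableAt (by simp))
      ((mdifferentiable_of_mem_maximalAtlas hφ).mdifferentiableAt hq)
  rw [mfderiv_eq_fderiv] at h1
  exact DFunLike.congr_fun h1 v

theorem lift_trans {φ : OpenPartialHomeomorph M 𝔼}
    (hφ : φ ∈ IsManifold.maximalAtlas (𝓡 m) ∞ M) {ψ : OpenPartialHomeomorph 𝔼 𝔼}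
    (hψ : ContDiffOn ℝ ∞ ψ.symm ψ.target) {y : 𝔼} (hy : y ∈ ψ.target) (hy' : ψ.symm y ∈ φ.target)
    (v : 𝔼) :
    lift (φ.trans ψ) y v = lift φ (ψ.symm y) (fderiv ℝ ψ.symm y v) := by
  have h1 : mfderiv (𝓡 m) (𝓡 m) (φ.symm ∘ ψ.symm) y =
      (mfderiv (𝓡 m) (𝓡 m) φ.symm (ψ.symm y)).comp (mfderiv (𝓡 m) (𝓡 m) ψ.symm y) :=
    mfderiv_comp (I' := 𝓡 m) y
      ((mdifferentiable_of_mem_maximalAtlas hφ).mdifferentiableAt_symm hy')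
      ((hψ.contDiffAt (ψ.open_target.mem_nhds hy)).contMDiffAt.mdifferentiableAt (by simp))
  rw [mfderiv_eq_fderiv] at h1
  exact DFunLike.congr_fun h1 v

end ChangeOfChart

section Web

variable {m n : ℕ} {c : Fin n → ℕ} {M : Type*} [TopologicalSpace M]
  [ChartedSpace (EuclideanSpace ℝ (Fin m)) M] [IsManifold (𝓡 m) ∞ M] {W : DivFreeWeb m n c M}

local notation "𝔼" => EuclideanSpace ℝ (Fin m)

/-- Adapted charts may be recentered at any point of their domain by a translation. -/
theorem IsAdapted.exists_recenter {φ : OpenPartialHomeomorph M 𝔼} {p : M} (hφ : W.IsAdapted φ p)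
    {x₀ : 𝔼} (hx₀ : x₀ ∈ φ.target) :
    ∃ φ' : OpenPartialHomeomorph M 𝔼, W.IsAdapted φ' (φ.symm x₀) ∧
      ∀ k l, fderiv ℝ (fun y => fderiv ℝ (fun z => Real.log (density W.vol φ' z)) y
          (EuclideanSpace.single l (1 : ℝ))) 0 (EuclideanSpace.single k (1 : ℝ)) =
        fderiv ℝ (fun y => fderiv ℝ (fun z => Real.log (density W.vol φ z)) y
          (EuclideanSpace.single l (1 : ℝ))) x₀ (EuclideanSpace.single k (1 : ℝ)) := by
  let τ : OpenPartialHomeomorph 𝔼 𝔼 := (Homeomorph.addRight (-x₀)).toOpenPartialHomeomorph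
  have hτ : ∀ x, τ x = x - x₀ := fun x => (sub_eq_add_neg x x₀).symm
  have hτ' : ∀ x, τ.symm x = x + x₀ := fun x => by
    change x + - -x₀ = _
    rw [neg_neg]
  have cτ : ContDiff ℝ ∞ τ := by
    rw [show (τ : 𝔼 → 𝔼) = fun x => x - x₀ from funext hτ]; fun_prop
  have cτ' : ContDiff ℝ ∞ τ.symm := by
    rw [show (τ.symm : 𝔼 → 𝔼) = fun x => x + x₀ from funext hτ']; fun_prop
  have hsource : (φ.trans τ).source = φ.source := by
    rw [φ.trans_source]; ext; simp [τ]
  have dτ : ∀ x, fderiv ℝ τ x = ContinuousLinearMap.id ℝ 𝔼 := fun x => by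
    rw [show (τ : 𝔼 → 𝔼) = fun x => x - x₀ from funext hτ, fderiv_sub_const]; simp
  have dτ' : ∀ x, fderiv ℝ τ.symm x = ContinuousLinearMap.id ℝ 𝔼 := fun x => by
    rw [show (τ.symm : 𝔼 → 𝔼) = fun x => x + x₀ from funext hτ', fderiv_add_const]; simp
  have hval : ∀ q, (φ.trans τ) q = φ q - x₀ := fun q => hτ (φ q)
  obtain ⟨a, b, hab⟩ := hφ.exists_target
  have htarget : (φ.trans τ).target =
      openBox (fun k => a k - x₀ k) (fun k => b k - x₀ k) := by
    rw [φ.trans_target]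
    ext y
    have h1 : y ∈ τ.target ∩ τ.symm ⁻¹' φ.target ↔ y + x₀ ∈ φ.target := by
      rw [← hτ']
      exact ⟨fun h => h.2, fun h => ⟨trivial, h⟩⟩
    rw [h1, hab]
    refine forall_congr' fun k => ?_
    rw [PiLp.add_apply]
    constructor <;> rintro ⟨h1, h2⟩ <;> constructor <;> linarith
  refine ⟨φ.trans τ, ⟨trans_mem_maximalAtlas hφ.1 cτ.contDiffOn cτ'.contDiffOn, ?_, ?_,
    ⟨_, _, htarget⟩, ?_⟩, ?_⟩
  · rw [hsource]; exact φ.map_target hx₀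
  · rw [hval, φ.right_inv hx₀, sub_self]
  · refine (W.straightens_iff (σ := id)).1 fun j q hq v => ?_
    rw [hsource] at hq
    rw [hφ.straightens j q hq v]
    simp only [coordVec_trans hφ.1 cτ.contDiffOn hq trivial, dτ]
    rfl
  · intro k l
    have hden : ∀ z ∈ (φ.trans τ).target,
        density W.vol (φ.trans τ) z = density W.vol φ (z + x₀) := by
      intro z hz
      rw [φ.trans_target] at hz
      have h1 : density W.vol (φ.trans τ) z = density W.vol φ (τ.symm z) := by
        refine congrArg (W.vol (φ.symm (τ.symm z))) (funext fun k => ?_)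
        have := lift_trans hφ.1 cτ'.contDiffOn hz.1 hz.2 (EuclideanSpace.single k 1)
        rw [dτ'] at this
        exact this
      rw [h1, hτ']
    have h0 : (0 : 𝔼) ∈ (φ.trans τ).target := by
      have h := (φ.trans τ).map_source (x := φ.symm x₀)
        (by rw [hsource]; exact φ.map_target hx₀)
      rwa [hval, φ.right_inv hx₀, sub_self] at h
    have hev : (fun z => Real.log (density W.vol (φ.trans τ) z)) =ᶠ[𝓝 0]
        fun z => Real.log (density W.vol φ (z + x₀)) := by
      filter_upwards [(φ.trans τ).open_target.mem_nhds h0] with z hz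
      rw [hden z hz]
    have hev' : (fun y => fderiv ℝ (fun z => Real.log (density W.vol (φ.trans τ) z)) y
        (EuclideanSpace.single l (1 : ℝ))) =ᶠ[𝓝 0]
        fun y => fderiv ℝ (fun z => Real.log (density W.vol φ z)) (y + x₀)
          (EuclideanSpace.single l (1 : ℝ)) := by
      filter_upwards [hev.fderiv (𝕜 := ℝ)] with y hy
      rw [hy, fderiv_comp_add_right x₀ (f := fun z => Real.log (density W.vol φ z))]
    rw [hev'.fderiv_eq, fderiv_comp_add_right x₀
      (f := fun y => fderiv ℝ (fun z => Real.log (density W.vol φ z)) y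
          (EuclideanSpace.single l (1 : ℝ))), zero_add]

/-! ### Volume-preserving reflections -/

/-- The volume of the box between the center of the chart and the point with coordinates `x`. -/
noncomputable def cornerVol (W : DivFreeWeb m n c M) (φ : OpenPartialHomeomorph M 𝔼) (x : 𝔼) : ℝ :=
  |∫ y in box 0 x, density W.vol φ y|

theorem volIn_coordBox {φ : OpenPartialHomeomorph M 𝔼} {p : M} (hφ : W.IsAdapted φ p) {q : M}
    (hq : q ∈ φ.source) : W.volIn φ (coordBox φ p q) = W.cornerVol φ (φ q) := by
  rw [volIn, image_coordBox hφ hφ.2.1 hq, hφ.2.2.1, cornerVol]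

theorem cornerVol_eq {φ : OpenPartialHomeomorph M 𝔼} {p : M} (hφ : W.IsAdapted φ p) {x : 𝔼}
    (hx : x ∈ φ.target) : W.cornerVol φ x = ∫ y in box 0 x, |density W.vol φ y| := by
  obtain ⟨a, b, hab⟩ := hφ.exists_target
  have hsub : box 0 x ⊆ φ.target := hab ▸ box_subset_openBox (hab ▸ hφ.zero_mem) (hab ▸ hx)
  rw [← volIn_box hφ hφ.zero_mem hx, volIn, image_symm_image hsub, cornerVol]

theorem IsAdapted.box_subset {φ : OpenPartialHomeomorph M 𝔼} {p : M} (hφ : W.IsAdapted φ p)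
    {x y : 𝔼} (hx : x ∈ φ.target) (hy : y ∈ φ.target) : box x y ⊆ φ.target := by
  obtain ⟨a, b, hab⟩ := hφ.exists_target
  exact hab ▸ box_subset_openBox (hab ▸ hx) (hab ▸ hy)

theorem IsAdapted.upd_mem {φ : OpenPartialHomeomorph M 𝔼} {p : M} (hφ : W.IsAdapted φ p)
    {x y : 𝔼} (hx : x ∈ φ.target) (hy : y ∈ φ.target) (k : Fin m) : upd x k (y k) ∈ φ.target := by
  obtain ⟨a, b, hab⟩ := hφ.exists_target
  exact hab ▸ upd_mem_openBox (hab ▸ hx) (hab ▸ hy) k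

theorem continuousOn_abs_density {φ : OpenPartialHomeomorph M 𝔼} {p : M} (hφ : W.IsAdapted φ p) :
    ContinuousOn (fun x => |density W.vol φ x|) φ.target :=
  (contDiffOn_density (W := W) hφ.1).continuousOn.abs

theorem cornerVol_pos {φ : OpenPartialHomeomorph M 𝔼} {p : M} (hφ : W.IsAdapted φ p) {x : 𝔼}
    (hx : x ∈ φ.target) (h0 : ∀ l, x l ≠ 0) : 0 < W.cornerVol φ x := by
  have hsub := hφ.box_subset hφ.zero_mem hx
  rw [cornerVol_eq hφ hx]
  exact setIntegral_box_pos ((continuousOn_abs_density hφ).mono hsub)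
    (fun y hy => abs_pos.2 (density_ne_zero hφ.1 (hsub hy))) fun l => (h0 l).symm

theorem cornerVol_eq_zero {φ : OpenPartialHomeomorph M 𝔼} {x : 𝔼} {l : Fin m} (h : x l = 0) :
    W.cornerVol φ x = 0 := by
  rw [cornerVol, Measure.restrict_eq_zero.2 (volume_box_of_eq (k := l) (by simp [h]))]
  simp

/-- Away from the coordinate hyperplanes, a volume-preserving reflection changes the sign of the
`k`-th coordinate and preserves the other ones. -/
theorem eventually_reflection {φ : OpenPartialHomeomorph M 𝔼} {p : M} (hφ : W.IsAdapted φ p)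
    {k : Fin m} {f : M → M}
    (hf : ∀ᶠ q in 𝓝 p, (∀ l, φ q l ≠ φ p l) → f q ∈ φ.source ∧ f q ≠ q ∧
      BoxAdjacent φ k (coordBox φ p q) (coordBox φ p (f q)) ∧
      W.volIn φ (coordBox φ p q) = W.volIn φ (coordBox φ p (f q))) :
    ∀ᶠ q in 𝓝 p, q ∈ φ.source ∧ ((∀ l, φ q l ≠ 0) → f q ∈ φ.source ∧ ∃ a, a * φ q k < 0 ∧
      φ (f q) = upd (φ q) k a ∧ W.cornerVol φ (φ (f q)) = W.cornerVol φ (φ q)) := by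
  filter_upwards [hf, φ.open_source.mem_nhds hφ.2.1] with q hq hqs
  refine ⟨hqs, fun hgen => ?_⟩
  rw [hφ.2.2.1] at hq
  obtain ⟨hfs, -, ⟨⟨u, hu, v, hv, huv⟩, s, hs⟩, hvol⟩ := hq hgen
  rw [volIn_coordBox hφ hqs, volIn_coordBox hφ hfs] at hvol
  refine ⟨hfs, ?_⟩
  have himg : box 0 (φ q) ∪ box 0 (φ (f q)) = box (φ u) (φ v) := by
    rw [← image_coordBox hφ hu hv, ← huv, image_union, image_coordBox hφ hφ.2.1 hqs,
      image_coordBox hφ hφ.2.1 hfs, hφ.2.2.1]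
  have hs' : ∀ x ∈ box 0 (φ q) ∩ box 0 (φ (f q)), x k = s := by
    intro x hx
    have hxt := hφ.box_subset hφ.zero_mem (φ.map_source hqs) hx.1
    have := hs (φ.symm x) ⟨⟨φ.map_target hxt, ?_⟩, ⟨φ.map_target hxt, ?_⟩⟩
    · rwa [φ.right_inv hxt] at this
    · rw [φ.right_inv hxt, hφ.2.2.1]; exact hx.1
    · rw [φ.right_inv hxt, hφ.2.2.1]; exact hx.2
  set x := φ q with hx
  set y := φ (f q) with hy
  have hypos : 0 < W.cornerVol φ y := hvol ▸ cornerVol_pos hφ (φ.map_source hqs) hgen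
  have hy0 : ∀ l, y l ≠ 0 := fun l hl => hypos.ne' (cornerVol_eq_zero hl)
  have hs0 : s = 0 := by
    have := hs' 0 ⟨fun l => by simp, fun l => by simp⟩
    simpa using this.symm
  -- if the `k`-th coordinates had the same sign, the intersection would not lie in `x_k = 0`
  have hsign : y k * x k < 0 := by
    by_contra hcon
    have hpos : 0 < y k * x k :=
      lt_of_le_of_ne (not_lt.1 hcon) (mul_ne_zero (hy0 k) (hgen k)).symm
    obtain ⟨t, ht0, ht1, ht2⟩ : ∃ t : ℝ, t ≠ 0 ∧ t ∈ uIcc 0 (x k) ∧ t ∈ uIcc 0 (y k) := by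
      rcases le_total |x k| |y k| with h | h
      · refine ⟨x k, hgen k, right_mem_uIcc, ?_⟩
        rw [mem_uIcc]
        rcases pos_and_pos_or_neg_and_neg_of_mul_pos hpos with ⟨h1, h2⟩ | ⟨h1, h2⟩
        · rw [abs_of_pos h1, abs_of_pos h2] at h; left; exact ⟨h2.le, h⟩
        · rw [abs_of_neg h1, abs_of_neg h2] at h; right; exact ⟨by linarith, h2.le⟩
      · refine ⟨y k, hy0 k, ?_, right_mem_uIcc⟩
        rw [mem_uIcc]
        rcases pos_and_pos_or_neg_and_neg_of_mul_pos hpos with ⟨h1, h2⟩ | ⟨h1, h2⟩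
        · rw [abs_of_pos h1, abs_of_pos h2] at h; left; exact ⟨h1.le, h⟩
        · rw [abs_of_neg h1, abs_of_neg h2] at h; right; exact ⟨by linarith, h1.le⟩
    have hmem : ∀ {z : 𝔼}, t ∈ uIcc 0 (z k) → upd (0 : 𝔼) k t ∈ box 0 z := by
      intro z hz l
      by_cases hl : l = k
      · subst hl; simpa using hz
      · simp [upd_apply, hl]
    have := hs' (upd 0 k t) ⟨hmem ht1, hmem ht2⟩
    rw [upd_same, hs0] at this
    exact ht0 this
  have hxU : x ∈ box (φ u) (φ v) := himg ▸ Or.inl fun l => right_mem_uIcc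
  have hyU : y ∈ box (φ u) (φ v) := himg ▸ Or.inr fun l => right_mem_uIcc
  have hsgn : ∀ {r t : ℝ}, r * t < 0 → r ∉ uIcc 0 t := by
    intro r t hrt hmem
    rw [mem_uIcc] at hmem
    rcases hmem with ⟨h1, h2⟩ | ⟨h1, h2⟩ <;> nlinarith
  have hmix : ∀ {x y : 𝔼}, x ∈ box (φ u) (φ v) → y ∈ box (φ u) (φ v) →
      upd x k (y k) ∈ box (φ u) (φ v) := by
    intro x y hx hy l
    by_cases hl : l = k
    · subst hl; simpa using hy l
    · simpa [upd_apply, hl] using hx l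
  refine ⟨y k, hsign, ?_, hvol.symm⟩
  ext l
  by_cases hl : l = k
  · subst hl; simp
  rw [upd_of_ne hl]
  have h1 : upd x k (y k) ∈ box 0 y := by
    have := hmix hxU hyU
    rw [← himg] at this
    refine this.resolve_left fun h => hsgn hsign ?_
    simpa using h k
  have h2 : upd y k (x k) ∈ box 0 x := by
    have := hmix hyU hxU
    rw [← himg] at this
    refine this.resolve_right fun h => hsgn (mul_comm (y k) (x k) ▸ hsign) ?_
    simpa using h k
  have e1 := h1 l
  have e2 := h2 l
  simp only [upd_of_ne hl, PiLp.zero_apply, mem_uIcc] at e1 e2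
  rcases e1 with ⟨a1, a2⟩ | ⟨a1, a2⟩ <;> rcases e2 with ⟨b1, b2⟩ | ⟨b1, b2⟩ <;> linarith

theorem Flat.cornerVol_cross (hflat : W.Flat) {φ : OpenPartialHomeomorph M 𝔼} {p : M}
    (hφ : W.IsAdapted φ p) {k l : Fin m} (hkl : W.block k ≠ W.block l) {x : 𝔼} {a b : ℝ}
    (hx : x ∈ φ.target) (hxa : upd x k a ∈ φ.target) (hxb : upd x l b ∈ φ.target)
    (hxab : upd (upd x k a) l b ∈ φ.target) :
    W.cornerVol φ x * W.cornerVol φ (upd (upd x k a) l b) =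
      W.cornerVol φ (upd x k a) * W.cornerVol φ (upd x l b) := by
  obtain ⟨a', b', hab⟩ := hφ.exists_target
  let S : 𝔼 → Set 𝔼 := fun x => {z | ∀ j, W.block j = W.block k → z j ∈ uIcc 0 (x j)}
  let T : 𝔼 → Set 𝔼 := fun x => {z | ∀ j, W.block j ≠ W.block k → z j ∈ uIcc 0 (x j)}
  have hST : ∀ x y z : 𝔼, (∀ j, z j = if W.block j = W.block k then x j else y j) →
      S x ∩ T y = box 0 z := by
    intro x y z hz
    ext w
    constructor
    · rintro ⟨h1, h2⟩ j
      rw [hz j]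
      split_ifs with hj
      · exact h1 j hj
      · exact h2 j hj
    · intro h
      refine ⟨fun j hj => ?_, fun j hj => ?_⟩
      · have := h j; rwa [hz j, if_pos hj] at this
      · have := h j; rwa [hz j, if_neg hj] at this
  have hkl' : k ≠ l := fun h => hkl (by rw [h])
  have e1 := hST x x x fun j => by simp
  have e2 := hST x (upd x l b) (upd x l b) fun j => by
    simp only [upd_apply]; split_ifs with h1 h2 <;> simp_all
  have e3 := hST (upd x k a) x (upd x k a) fun j => by
    simp only [upd_apply]; split_ifs with h1 h2 <;> simp_all
  have e4 := hST (upd x k a) (upd x l b) (upd (upd x k a) l b) fun j => by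
    simp only [upd_apply]; split_ifs <;> simp_all
  have hS : ∀ x, ∀ y z : 𝔼, (∀ j, W.block j = W.block k → y j = z j) → (y ∈ S x ↔ z ∈ S x) := by
    intro x y z hyz
    exact forall_congr' fun j => forall_congr' fun hj => by rw [hyz j hj]
  have hT : ∀ x, ∀ y z : 𝔼, (∀ j, W.block j ≠ W.block k → y j = z j) → (y ∈ T x ↔ z ∈ T x) := by
    intro x y z hyz
    exact forall_congr' fun j => forall_congr' fun hj => by rw [hyz j hj]
  have hm : ∀ x : 𝔼, MeasurableSet (box 0 x) := fun x => (isCompact_box 0 x).measurableSet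
  have hb : ∀ {x}, x ∈ φ.target → box 0 x ⊆ openBox a' b' := fun hx =>
    hab ▸ hφ.box_subset hφ.zero_mem hx
  have hsm : ContDiffOn ℝ ∞ (density W.vol φ) (openBox a' b') := hab ▸ contDiffOn_density hφ.1
  have := MixedFlat.setIntegral_cross (hab ▸ hflat φ p hφ) hsm
    (fun x hx => density_ne_zero hφ.1 (hab ▸ hx)) (hab ▸ hφ.zero_mem) (W.block k)
    (hS x) (hS (upd x k a)) (hT x) (hT (upd x l b)) (e1 ▸ hm _) (e2 ▸ hm _) (e3 ▸ hm _) (e4 ▸ hm _)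
    (e1 ▸ hb hx) (e2 ▸ hb hxb) (e3 ▸ hb hxa) (e4 ▸ hb hxab)
  rw [e1, e2, e3, e4] at this
  rwa [cornerVol_eq hφ hx, cornerVol_eq hφ hxa, cornerVol_eq hφ hxb, cornerVol_eq hφ hxab]

/-- On a given side of the hyperplane `x_k = 0`, the `k`-th coordinate of a corner is determined by
the volume of the box and the other coordinates. -/
theorem eq_of_cornerVol_upd_eq {φ : OpenPartialHomeomorph M 𝔼} {p : M} (hφ : W.IsAdapted φ p)
    {x : 𝔼} {k : Fin m} {a b : ℝ} (hx : ∀ j, j ≠ k → x j ≠ 0) (hab : 0 < a * b)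
    (ha : upd x k a ∈ φ.target) (hb : upd x k b ∈ φ.target)
    (h : W.cornerVol φ (upd x k a) = W.cornerVol φ (upd x k b)) : a = b := by
  have sa := hφ.box_subset hφ.zero_mem ha
  have sb := hφ.box_subset hφ.zero_mem hb
  have hc := continuousOn_abs_density hφ
  rw [cornerVol_eq hφ ha, cornerVol_eq hφ hb] at h
  exact eq_of_setIntegral_box_eq hx hab (hc.mono sa) (hc.mono sb)
    (fun y hy => abs_pos.2 (density_ne_zero hφ.1 (sa hy)))
    (fun y hy => abs_pos.2 (density_ne_zero hφ.1 (sb hy))) h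

theorem chartHolonomy_eq_bot_iff {φ : OpenPartialHomeomorph M 𝔼} {p : M} :
    W.chartHolonomy φ p = ⊥ ↔ ∀ g ∈ W.loops φ p, g = 1 := by
  rw [chartHolonomy, Subgroup.map_eq_bot_iff_of_injective _ (Subgroup.subtype_injective _)]
  constructor
  · intro h g hg
    have hmem : g ∈ W.reflectionGroup φ p := by
      obtain ⟨k, l, -, rk, rl, hk, hl, rfl⟩ := hg
      have h1 : rk ∈ W.reflectionGroup φ p := Subgroup.subset_closure ⟨k, hk⟩
      have h2 : rl ∈ W.reflectionGroup φ p := Subgroup.subset_closure ⟨l, hl⟩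
      exact mul_mem (mul_mem (mul_mem h2 h1) h2) h1
    have h1 : (⟨g, hmem⟩ : W.reflectionGroup φ p) ∈ Subgroup.normalClosure
        {g : W.reflectionGroup φ p | (g : DiffGerm m p) ∈ W.loops φ p} :=
      Subgroup.subset_normalClosure hg
    rw [h, Subgroup.mem_bot] at h1
    exact congrArg Subtype.val h1
  · intro h
    rw [eq_bot_iff]
    refine Subgroup.normalClosure_le_normal fun g hg => ?_
    exact Subgroup.mem_bot.2 (Subtype.ext (h g hg))

theorem holonomy_eq_bot_iff {p : M} :
    W.holonomy p = ⊥ ↔ ∀ φ, W.IsAdapted φ p → ∀ g ∈ W.loops φ p, g = 1 := by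
  simp only [holonomy, iSup_eq_bot, chartHolonomy_eq_bot_iff]

/-- The coordinates of the points which a loop of reflections visits when it starts at a point off
the coordinate hyperplanes: the boxes between `p` and these points all have the same volume. -/
theorem eventually_loop {φ : OpenPartialHomeomorph M 𝔼} {p : M} (hφ : W.IsAdapted φ p)
    {k l : Fin m} (hkl : k ≠ l) {fk fl : smoothFixing (M := M) m p}
    (hfk : ∀ᶠ q in 𝓝 p, (∀ l, φ q l ≠ φ p l) → (fk : Function.End M) q ∈ φ.source ∧
      (fk : Function.End M) q ≠ q ∧
      BoxAdjacent φ k (coordBox φ p q) (coordBox φ p ((fk : Function.End M) q)) ∧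
      W.volIn φ (coordBox φ p q) = W.volIn φ (coordBox φ p ((fk : Function.End M) q)))
    (hfl : ∀ᶠ q in 𝓝 p, (∀ l, φ q l ≠ φ p l) → (fl : Function.End M) q ∈ φ.source ∧
      (fl : Function.End M) q ≠ q ∧
      BoxAdjacent φ l (coordBox φ p q) (coordBox φ p ((fl : Function.End M) q)) ∧
      W.volIn φ (coordBox φ p q) = W.volIn φ (coordBox φ p ((fl : Function.End M) q)))
    {U : Set 𝔼} (hU : U ∈ 𝓝 0) :
    ∀ᶠ q in 𝓝 p, (∀ j, φ q j ≠ 0) → q ∈ φ.source ∧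
      ((fl * fk * fl * fk : smoothFixing (M := M) m p) : Function.End M) q ∈ φ.source ∧
      ∃ a b a' b' : ℝ,
        φ (((fl * fk * fl * fk : smoothFixing (M := M) m p) : Function.End M) q) =
          upd (upd (φ q) k a') l b' ∧
        a * φ q k < 0 ∧ b * φ q l < 0 ∧ a' * a < 0 ∧ b' * b < 0 ∧
        (φ q ∈ U ∧ upd (φ q) k a ∈ U ∧ upd (upd (φ q) k a) l b ∈ U ∧
          upd (upd (φ q) l b) k a' ∈ U ∧ upd (upd (φ q) k a') l b' ∈ U) ∧
        W.cornerVol φ (upd (φ q) k a) = W.cornerVol φ (φ q) ∧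
        W.cornerVol φ (upd (upd (φ q) k a) l b) = W.cornerVol φ (φ q) ∧
        W.cornerVol φ (upd (upd (φ q) l b) k a') = W.cornerVol φ (φ q) ∧
        W.cornerVol φ (upd (upd (φ q) k a') l b') = W.cornerVol φ (φ q) := by
  have hUp : ∀ᶠ q in 𝓝 p, φ q ∈ U :=
    (φ.continuousAt hφ.2.1).eventually (by rwa [hφ.2.2.1])
  have Pk := (eventually_reflection hφ hfk).and hUp
  have Pl := (eventually_reflection hφ hfl).and hUp
  have tk := smoothFixing_tendsto fk
  have tl := smoothFixing_tendsto fl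
  filter_upwards [Pk, tk.eventually Pl, tk.eventually (tl.eventually Pk),
    tk.eventually (tl.eventually (tk.eventually Pl)),
    tk.eventually (tl.eventually (tk.eventually (tl.eventually hUp)))] with q h1 h2 h3 h4 h5 hgen
  change _ ∧ (fl : Function.End M) ((fk : Function.End M) ((fl : Function.End M)
    ((fk : Function.End M) q))) ∈ φ.source ∧ ∃ a b a' b' : ℝ,
      φ ((fl : Function.End M) ((fk : Function.End M) ((fl : Function.End M)
    ((fk : Function.End M) q)))) = _ ∧ _
  set q1 := (fk : Function.End M) q with hq1
  set q2 := (fl : Function.End M) q1 with hq2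
  set q3 := (fk : Function.End M) q2 with hq3
  set q4 := (fl : Function.End M) q3 with hq4
  have gen : ∀ {x : 𝔼} {j : Fin m} {a : ℝ}, (∀ l, x l ≠ 0) → a * x j < 0 →
      ∀ l, upd x j a l ≠ 0 := by
    intro x j a hx ha l
    by_cases hl : l = j
    · subst hl; rw [upd_same]; rintro rfl; simp at ha
    · rw [upd_of_ne hl]; exact hx l
  obtain ⟨s1, a, n1, e1, v1⟩ := h1.1.2 hgen
  have g1 := gen hgen n1
  rw [← e1] at g1
  obtain ⟨s2, b, n2, e2, v2⟩ := h2.1.2 g1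
  have g2 := gen g1 n2
  rw [← e2] at g2
  obtain ⟨s3, a', n3, e3, v3⟩ := h3.1.2 g2
  have g3 := gen g2 n3
  rw [← e3] at g3
  obtain ⟨s4, b', n4, e4, v4⟩ := h4.1.2 g3
  have e2' : φ q2 = upd (upd (φ q) k a) l b := by rw [e2, e1]
  have e3' : φ q3 = upd (upd (φ q) l b) k a' := by
    rw [e3, e2']; ext j; simp only [upd_apply]; grind
  have e4' : φ q4 = upd (upd (φ q) k a') l b' := by
    rw [e4, e3']; ext j; simp only [upd_apply]; grind
  have w2 := v2.trans v1
  have w3 := v3.trans w2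
  have w4 := v4.trans w3
  rw [e1, upd_of_ne hkl.symm] at n2
  rw [e2', upd_of_ne hkl, upd_same] at n3
  rw [e3', upd_of_ne hkl.symm, upd_same] at n4
  refine ⟨h1.1.1, s4, a, b, a', b', e4', n1, n2, n3, n4, ⟨h1.2, e1 ▸ h2.2, e2' ▸ h3.2, e3' ▸ h4.2,
    e4' ▸ h5⟩, e1 ▸ v1, e2' ▸ w2, e3' ▸ w3, e4' ▸ w4⟩

theorem pos_of_mul_neg_of_mul_neg {r s t : ℝ} (h1 : r * s < 0) (h2 : t * r < 0) : 0 < t * s := by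
  have hr : r ≠ 0 := by rintro rfl; simp at h1
  have h3 : 0 < r ^ 2 * (t * s) := by nlinarith [mul_pos_of_neg_of_neg h1 h2]
  exact (mul_pos_iff_of_pos_left (by positivity)).1 h3

/-- Starting at a point with coordinates `x`, a loop visits the points with coordinates
`x[k → a]`, `x[k → a, l → b]`, `x[k → a', l → b]`, `x[k → a', l → b']`, whose boxes have equal
volumes. By the proportion between the volumes of boxes, that of `x[l → b]` has the same volume
too, which forces `a' = x_k` and then `b' = x_l`. -/
theorem Flat.holonomy_eq_bot [T2Space M] (hflat : W.Flat) (p : M) : W.holonomy p = ⊥ := by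
  rw [holonomy_eq_bot_iff]
  rintro φ hφ _ ⟨k, l, hkl, rk, rl, ⟨fk, hk, hfk⟩, ⟨fl, hl, hfl⟩, rfl⟩
  rw [loop_eq_one_iff hk hl]
  refine eventually_eq_of_generic hφ.2.1 _ ?_
  have hkl' : k ≠ l := fun h => hkl (by rw [h])
  filter_upwards [eventually_loop hφ hkl' hfk hfl (φ.open_target.mem_nhds hφ.zero_mem)]
    with q hq hgen
  obtain ⟨hqs, hqs', a, b, a', b', heq, n1, n2, n3, n4, ⟨tx, t1, t2, t3, t4⟩, v1, v2, v3, v4⟩ :=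
    hq hgen
  set x := φ q with hx
  have hxl : upd x l (x l) = x := by ext j; simp only [upd_apply]; grind
  have hxk : upd (upd x l b) k (x k) = upd x l b := by ext j; simp only [upd_apply]; grind
  have txb : upd x l b ∈ φ.target := by
    have := hφ.upd_mem tx t2 l
    rwa [upd_same] at this
  have hcross := hflat.cornerVol_cross hφ hkl tx t1 txb t2
  rw [v2, v1] at hcross
  have hxb : W.cornerVol φ (upd x l b) = W.cornerVol φ x :=
    (mul_left_cancel₀ (cornerVol_pos hφ tx hgen).ne' hcross).symm
  have ha : a' = x k := by
    refine eq_of_cornerVol_upd_eq hφ (x := upd x l b) (k := k) ?_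
      (pos_of_mul_neg_of_mul_neg n1 n3) t3 (by rwa [hxk]) (by rw [hxk, v3, hxb])
    intro j hj
    by_cases hjl : j = l
    · subst hjl; rw [upd_same]; rintro rfl; simp at n2
    · rw [upd_of_ne hjl]; exact hgen j
  have hxx : upd x k a' = x := by rw [ha]; ext j; simp only [upd_apply]; grind
  rw [hxx] at heq v4 t4
  have hb : b' = x l :=
    eq_of_cornerVol_upd_eq hφ (x := x) (k := l) (fun j _ => hgen j)
      (pos_of_mul_neg_of_mul_neg n2 n4) t4 (by rwa [hxl]) (by rw [hxl, v4])
  refine φ.injOn hqs' hqs ?_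
  rw [heq, hb, hxl]

end Web

section Euclid

variable {m : ℕ}

local notation "𝔼" => EuclideanSpace ℝ (Fin m)

/-! ### Existence of volume-preserving reflections -/

/-- The reflection is conjugate to `x_k ↦ -x_k` by the map which replaces `x_k` by the signed
volume of the box between `0` and `x`, divided by the other coordinates. -/
theorem exists_reflection {h : 𝔼 → ℝ} {U : Set 𝔼} (hU : IsOpen U) (hh : ContDiffOn ℝ ∞ h U)
    (hx : (0 : 𝔼) ∈ U) (h0 : h 0 ≠ 0) (k : Fin m) :
    ∃ R : 𝔼 → 𝔼, R 0 = 0 ∧ (∀ᶠ x in 𝓝 0, ContDiffAt ℝ ∞ R x) ∧ (∀ᶠ x in 𝓝 0, R (R x) = x) ∧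
      ∀ᶠ x in 𝓝 0, (∀ l, x l ≠ 0) → R x k * x k < 0 ∧ (∀ j, j ≠ k → R x j = x j) ∧
        |∫ y in box 0 (R x), h y| = |∫ y in box 0 x, h y| := by
  obtain ⟨g, hg, hgh⟩ := exists_contDiff_eventuallyEq hU hh hx
  let A : 𝔼 → ℝ := fun q => avg g 0 q
  have hA : ContDiff ℝ ∞ A :=
    (contDiff_avg hg).comp (by fun_prop : ContDiff ℝ ∞ fun q : 𝔼 => ((0 : 𝔼), q))
  have hA0 : A 0 ≠ 0 := by
    change avg g 0 0 ≠ 0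
    rw [avg_zero, hgh.self_of_nhds]; exact h0
  let E : 𝔼 → 𝔼 := fun x => x + (x k * (A x - 1)) • EuclideanSpace.single k (1 : ℝ)
  have hEk : ∀ x, E x k = x k * A x := fun x => by simp [E]; ring
  have hEj : ∀ x j, j ≠ k → E x j = x j := fun x j hj => by simp [E, hj]
  have hE : ContDiff ℝ ∞ E := by
    have : ContDiff ℝ ∞ fun x : 𝔼 => x k := by fun_prop
    exact contDiff_id.add ((this.mul (hA.sub contDiff_const)).smul contDiff_const)
  have hdE : HasFDerivAt E (ContinuousLinearMap.id ℝ 𝔼 +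
      (((A 0 - 1) • (EuclideanSpace.proj k : 𝔼 →L[ℝ] ℝ)).smulRight
        (EuclideanSpace.single k (1 : ℝ)))) 0 := by
    have h1 : HasFDerivAt (fun x : 𝔼 => x k) (EuclideanSpace.proj k : 𝔼 →L[ℝ] ℝ) 0 :=
      (EuclideanSpace.proj k : 𝔼 →L[ℝ] ℝ).hasFDerivAt
    have h2 := (hA.differentiable (by simp) 0).hasFDerivAt.sub_const 1
    have h3 := (hasFDerivAt_id (𝕜 := ℝ) (0 : 𝔼)).add
      ((h1.mul h2).smul_const (EuclideanSpace.single k (1 : ℝ)))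
    refine h3.congr_fderiv ?_
    ext v
    simp
  have hinj : Function.Injective (fderiv ℝ E 0) := by
    rw [hdE.fderiv]
    refine (injective_iff_map_eq_zero _).2 fun v hv => ?_
    have hvj : ∀ j, j ≠ k → v j = 0 := fun j hj => by
      have := congrArg (fun w : 𝔼 => w j) hv
      simpa [hj] using this
    have hvk : A 0 * v k = 0 := by
      have := congrArg (fun w : 𝔼 => w k) hv
      simp at this
      linarith
    ext j
    by_cases hj : j = k
    · subst hj; simpa [hA0] using hvk
    · exact hvj j hj
  obtain ⟨Ψ, h0Ψ, -, hΨ, -, hΨs⟩ := exists_openPartialHomeomorph isOpen_univ hE.contDiffOn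
    (mem_univ (0 : 𝔼)) hinj
  let σ : 𝔼 → 𝔼 := fun x => x - (2 * x k) • EuclideanSpace.single k (1 : ℝ)
  have hσk : ∀ x, σ x k = -x k := fun x => by simp [σ]; ring
  have hσj : ∀ x j, j ≠ k → σ x j = x j := fun x j hj => by simp [σ, hj]
  have hσσ : ∀ x, σ (σ x) = x := fun x => by
    ext j
    by_cases hj : j = k
    · subst hj; rw [hσk, hσk, neg_neg]
    · rw [hσj _ _ hj, hσj _ _ hj]
  have hσ : ContDiff ℝ ∞ σ := by fun_prop
  have hE0 : E 0 = 0 := by simp [E]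
  have hσ0 : σ 0 = 0 := by simp [σ]
  have hσE : ContDiff ℝ ∞ fun x => σ (E x) := hσ.comp hE
  let R : 𝔼 → 𝔼 := fun x => Ψ.symm (σ (E x))
  have hR0 : R 0 = 0 := by
    change Ψ.symm (σ (E 0)) = 0
    rw [hE0, hσ0]
    have := Ψ.left_inv h0Ψ
    rwa [hΨ, hE0] at this
  have htar : ∀ᶠ x in 𝓝 (0 : 𝔼), σ (E x) ∈ Ψ.target := by
    refine hσE.continuous.continuousAt.eventually (Ψ.open_target.mem_nhds ?_)
    have := Ψ.map_source h0Ψ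
    rwa [hΨ, hE0, ← hσ0, ← hE0] at this
  have hRs : ∀ᶠ x in 𝓝 (0 : 𝔼), ContDiffAt ℝ ∞ R x := by
    filter_upwards [htar] with x hx
    exact (hΨs.contDiffAt (Ψ.open_target.mem_nhds hx)).comp x hσE.contDiffAt
  have hER : ∀ᶠ x in 𝓝 (0 : 𝔼), E (R x) = σ (E x) := by
    filter_upwards [htar] with x hx
    rw [← hΨ]; exact Ψ.right_inv hx
  have hRlim : Tendsto R (𝓝 0) (𝓝 0) := by
    have := hRs.self_of_nhds.continuousAt.tendsto
    rwa [hR0] at this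
  refine ⟨R, hR0, hRs, ?_, ?_⟩
  · filter_upwards [hER, Ψ.open_source.mem_nhds h0Ψ] with x hx hxs
    change Ψ.symm (σ (E (R x))) = x
    rw [hx, hσσ, ← hΨ, Ψ.left_inv hxs]
  obtain ⟨δ, hδ, hball⟩ := exists_forall_abs_le_mem (N := {x | g x = h x}) hgh
  have hsmall : ∀ᶠ x in 𝓝 (0 : 𝔼), ∀ j, |x j| ≤ δ := by
    refine eventually_all.2 fun j => ?_
    have : Tendsto (fun x : 𝔼 => |x j|) (𝓝 0) (𝓝 |(0 : 𝔼) j|) := by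
      have : Continuous fun x : 𝔼 => |x j| := by fun_prop
      exact this.tendsto 0
    exact this.eventually_le_const (by simpa using hδ)
  have hvol : ∀ᶠ x in 𝓝 (0 : 𝔼), |∫ y in box 0 x, h y| = |∏ j, x j| * |A x| := by
    filter_upwards [hsmall] with x hx
    have e : ∫ y in box 0 x, h y = ∫ y in box 0 x, g y := by
      refine setIntegral_congr_fun (isCompact_box 0 x).measurableSet fun y hy => (hball y ?_).symm
      intro j
      have := abs_sub_left_of_mem_uIcc (hy j)
      simp only [PiLp.zero_apply, sub_zero] at this
      exact this.trans (hx j)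
    have := setIntegral_box g 0 x
    rw [zero_add] at this
    rw [e, this, abs_mul, abs_abs]
  have hApos : ∀ᶠ x in 𝓝 (0 : 𝔼), 0 < A x * A 0 :=
    (hA.continuous.mul continuous_const).continuousAt.eventually_const_lt
      (mul_self_pos.2 hA0)
  filter_upwards [hER, hvol, hRlim.eventually hvol, hApos, hRlim.eventually hApos]
    with x e1 v1 v2 p1 p2 hgen
  have ek : R x k * A (R x) = -(x k * A x) := by rw [← hEk, e1, hσk, hEk]
  have ej : ∀ j, j ≠ k → R x j = x j := fun j hj => by
    rw [← hEj (R x) j hj, e1, hσj _ _ hj, hEj _ _ hj]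
  have hAA : 0 < A (R x) * A x := by
    have h1 : 0 < (A 0) ^ 2 * (A (R x) * A x) := by nlinarith [mul_pos p1 p2]
    exact (mul_pos_iff_of_pos_left (by positivity)).1 h1
  have hAx : A x ≠ 0 := right_ne_zero_of_mul hAA.ne'
  refine ⟨?_, ej, ?_⟩
  · have h1 : (A (R x) * A x) * (R x k * x k) = -(x k * A x) ^ 2 := by
      linear_combination (A x * x k) * ek
    have h2 : 0 < (x k * A x) ^ 2 := by
      have := mul_ne_zero (hgen k) hAx
      positivity
    by_contra hcon
    nlinarith [mul_nonneg hAA.le (not_lt.1 hcon)]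
  · rw [v1, v2]
    have hupd : R x = upd x k (R x k) := by
      ext j
      by_cases hj : j = k
      · subst hj; simp
      · rw [upd_of_ne hj, ej j hj]
    have hprod := prod_upd x k (R x k)
    rw [← hupd] at hprod
    have h1 : ((∏ j, R x j) * A (R x)) * x k = -((∏ j, x j) * A x) * x k := by
      linear_combination A (R x) * hprod + (∏ j, x j) * ek
    have h2 := mul_right_cancel₀ (hgen k) h1
    rw [← abs_mul, ← abs_mul, h2, abs_neg]

end Euclid

section Web

variable {m n : ℕ} {c : Fin n → ℕ} {M : Type*} [TopologicalSpace M]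
  [ChartedSpace (EuclideanSpace ℝ (Fin m)) M] [IsManifold (𝓡 m) ∞ M] {W : DivFreeWeb m n c M}

local notation "𝔼" => EuclideanSpace ℝ (Fin m)

theorem IsAdapted.boxAdjacent_coordBox {φ : OpenPartialHomeomorph M 𝔼} {p : M}
    (hφ : W.IsAdapted φ p) {k : Fin m} {q q' : M} (hq : q ∈ φ.source) (hq' : q' ∈ φ.source)
    (hsign : φ q' k * φ q k < 0) (hne : ∀ j, j ≠ k → φ q' j = φ q j) :
    BoxAdjacent φ k (coordBox φ p q) (coordBox φ p q') := by
  have hopp : (0 : ℝ) ∈ uIcc (φ q' k) (φ q k) := by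
    rw [mem_uIcc]
    rcases mul_neg_iff.1 hsign with ⟨h1, h2⟩ | ⟨h1, h2⟩
    · exact Or.inr ⟨h2.le, h1.le⟩
    · exact Or.inl ⟨h1.le, h2.le⟩
  have hu : upd (0 : 𝔼) k (φ q' k) ∈ φ.target :=
    hφ.upd_mem hφ.zero_mem (φ.map_source hq') k
  refine ⟨⟨φ.symm (upd 0 k (φ q' k)), φ.map_target hu, q, hq, ?_⟩, 0, ?_⟩
  · ext x
    simp only [coordBox, mem_union, mem_ofPred_eq, hφ.2.2.1, φ.right_inv hu, ← and_or_left]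
    refine and_congr_right fun _ => ?_
    have key := Set.ext_iff.1 (box_eq_union (u := upd (0 : 𝔼) k (φ q' k)) (v := φ q) (k := k)
      (s := 0) (by rwa [upd_same])) (φ x)
    simp only [box, mem_union, mem_ofPred_eq] at key
    rw [key, or_comm]
    refine or_congr (forall_congr' fun j => ?_) (forall_congr' fun j => ?_)
    · by_cases hj : j = k
      · subst hj; simp [uIcc_comm]
      · simp [upd_of_ne hj, hne j hj]
    · by_cases hj : j = k
      · subst hj; simp
      · simp [upd_of_ne hj]
  · rintro x ⟨h1, h2⟩
    have e1 := h1.2 k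
    have e2 := h2.2 k
    simp only [hφ.2.2.1, PiLp.zero_apply, mem_uIcc] at e1 e2
    rcases mul_neg_iff.1 hsign with ⟨s1, s2⟩ | ⟨s1, s2⟩ <;>
      rcases e1 with e1 | e1 <;> rcases e2 with e2 | e2 <;> linarith [e1.1, e1.2, e2.1, e2.2]

theorem exists_isReflection {φ : OpenPartialHomeomorph M 𝔼} {p : M} (hφ : W.IsAdapted φ p)
    (k : Fin m) : ∃ r, W.IsReflection φ p k r := by
  obtain ⟨R, hR0, hRs, hRR, hR⟩ := exists_reflection φ.open_target (contDiffOn_density hφ.1)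
    hφ.zero_mem (density_ne_zero hφ.1 hφ.zero_mem (W := W)) k
  have hlim : Tendsto φ (𝓝 p) (𝓝 0) := by
    have := φ.continuousAt hφ.2.1
    rwa [ContinuousAt, hφ.2.2.1] at this
  have hRlim : Tendsto R (𝓝 0) (𝓝 0) := by
    have := hRs.self_of_nhds.continuousAt.tendsto
    rwa [hR0] at this
  have hmem : ∀ᶠ q in 𝓝 p, R (φ q) ∈ φ.target :=
    (hRlim.comp hlim).eventually (φ.open_target.mem_nhds hφ.zero_mem)
  let f : M → M := fun q => φ.symm (R (φ q))
  have hfp : f p = p := by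
    change φ.symm (R (φ p)) = p
    rw [hφ.2.2.1, hR0, hφ.symm_zero]
  have hfs : ∀ᶠ q in 𝓝 p, ContMDiffAt (𝓡 m) (𝓡 m) ∞ f q := by
    filter_upwards [hmem, φ.open_source.mem_nhds hφ.2.1, hlim.eventually hRs] with q h1 h2 h3
    have c1 := (contMDiffOn_of_mem_maximalAtlas hφ.1).contMDiffAt (φ.open_source.mem_nhds h2)
    have c2 := (contMDiffOn_symm_of_mem_maximalAtlas hφ.1).contMDiffAt (φ.open_target.mem_nhds h1)
    exact c2.comp q (h3.contMDiffAt.comp q c1)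
  have hff : ∀ᶠ q in 𝓝 p, f (f q) = q := by
    filter_upwards [hmem, φ.open_source.mem_nhds hφ.2.1, hlim.eventually hRR] with q h1 h2 h3
    change φ.symm (R (φ (φ.symm (R (φ q))))) = q
    rw [φ.right_inv h1, h3, φ.left_inv h2]
  let F : smoothFixing (M := M) m p := ⟨f, hfp, hfs⟩
  have hunit : (F : (germCon (M := M) m p).Quotient) * F = 1 := by
    rw [← Con.coe_mul, ← Con.coe_one, Con.eq]
    exact hff
  refine ⟨⟨F, F, hunit, hunit⟩, F, rfl, ?_⟩
  filter_upwards [hmem, φ.open_source.mem_nhds hφ.2.1, hlim.eventually hR] with q h1 h2 h3 hgen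
  rw [hφ.2.2.1] at hgen
  obtain ⟨hsign, hj, hv⟩ := h3 hgen
  change f q ∈ φ.source ∧ f q ≠ q ∧ BoxAdjacent φ k (coordBox φ p q) (coordBox φ p (f q)) ∧
    W.volIn φ (coordBox φ p q) = W.volIn φ (coordBox φ p (f q))
  have hfq : f q ∈ φ.source := φ.map_target h1
  have hval : φ (f q) = R (φ q) := φ.right_inv h1
  refine ⟨hfq, fun h => ?_, hφ.boxAdjacent_coordBox h2 hfq (by rwa [hval]) (by rwa [hval]), ?_⟩
  · rw [h] at hval
    rw [← hval] at hsign
    nlinarith [mul_self_nonneg (φ q k)]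
  · rw [volIn_coordBox hφ h2, volIn_coordBox hφ hfq, hval]
    exact hv.symm

/-- If a loop of reflections is trivial, then it only visits four points, whose boxes have equal
volumes; this contradicts `exists_box_mul_box_ne` if a mixed second derivative of `log |h|` does not
vanish at `p`. -/
theorem flat_of_holonomy_eq_bot (hhol : ∀ p, W.holonomy p = ⊥) : W.Flat := by
  intro φ₀ p₀ hφ₀ x₀ hx₀ k l hkl
  obtain ⟨φ, hφ, hlog⟩ := hφ₀.exists_recenter hx₀
  rw [← hlog]
  by_contra hne
  set p := φ₀.symm x₀
  have hkl' : k ≠ l := fun h => hkl (by rw [h])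
  obtain ⟨ε, hε, hbox⟩ := exists_box_mul_box_ne φ.open_target (contDiffOn_density hφ.1)
    hφ.zero_mem (density_ne_zero hφ.1 hφ.zero_mem (W := W)) hkl' hne
  obtain ⟨rk, hrk⟩ := exists_isReflection hφ k
  obtain ⟨rl, hrl⟩ := exists_isReflection hφ l
  have hloop : rl * rk * rl * rk = 1 :=
    holonomy_eq_bot_iff.1 (hhol p) φ hφ _ ⟨k, l, hkl, rk, rl, hrk, hrl, rfl⟩
  obtain ⟨fk, hk, hfk⟩ := hrk
  obtain ⟨fl, hl, hfl⟩ := hrl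
  rw [loop_eq_one_iff hk hl] at hloop
  have hpath := eventually_loop hφ hkl' hfk hfl (Metric.ball_mem_nhds 0 hε)
  obtain ⟨γ, hγ, hgen⟩ := exists_generic_tendsto hφ.2.1
  obtain ⟨t, h1, h2, hgen⟩ := ((hγ.eventually hloop).and ((hγ.eventually hpath).and hgen)).exists
  set q := γ t
  obtain ⟨hqs, -, a, b, a', b', heq, n1, n2, n3, n4, ⟨tx, t1, t2, t3, t4⟩, v1, v2, v3, v4⟩ :=
    h2 hgen
  rw [h1] at heq
  set x := φ q
  have ha : a' = x k := by
    have := congrArg (fun y : 𝔼 => y k) heq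
    simpa [upd_of_ne hkl'] using this.symm
  have hxb : upd (upd x l b) k a' = upd x l b := by
    rw [ha]; ext j; simp only [upd_apply]; grind
  rw [hxb] at t3 v3
  have hne' : ∀ {r s : ℝ}, r * s < 0 → r ≠ s ∧ r ≠ 0 := by
    intro r s h
    refine ⟨?_, ?_⟩
    · rintro rfl; nlinarith [mul_self_nonneg r]
    · rintro rfl; simp at h
  refine hbox 0 (Metric.mem_ball_self hε) x tx a b t1 t3 t2 (hne' n1).1 (hne' n2).1 hgen
    (hne' n1).2 (hne' n2).2 ?_
  simp only [zero_add]
  change W.cornerVol φ x * W.cornerVol φ _ = W.cornerVol φ _ * W.cornerVol φ _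
  rw [v1, v2, v3]

end Web

section Web

variable {m n : ℕ} {c : Fin n → ℕ} {M : Type*} [TopologicalSpace M]
  [ChartedSpace (EuclideanSpace ℝ (Fin m)) M] [IsManifold (𝓡 m) ∞ M] {W : DivFreeWeb m n c M}

local notation "𝔼" => EuclideanSpace ℝ (Fin m)

/-! ### Existence of adapted charts -/

theorem iInf_tangent_eq_bot (W : DivFreeWeb m n c M) (p : M) : ⨅ i, (W.fol i).tangent p = ⊥ := by
  have hc : ∀ i, Module.finrank ℝ (TangentSpace (𝓡 m) p ⧸ (W.fol i).tangent p) = c i := by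
    intro i
    obtain ⟨U, -, hp, f, -, hf⟩ := (W.fol i).exists_submersion p
    obtain ⟨hsurj, hker⟩ := hf p hp
    let L : TangentSpace (𝓡 m) p →ₗ[ℝ] EuclideanSpace ℝ (Fin (c i)) :=
      (mfderiv (𝓡 m) (𝓡 (c i)) f p).toLinearMap
    have hL : (W.fol i).tangent p = LinearMap.ker L := by
      ext v; exact hker v
    rw [hL, (L.quotKerEquivOfSurjective hsurj).finrank_eq, finrank_euclideanSpace_fin]
  have h1 := W.general_position p
  simp only [hc, W.sum_codim] at h1
  have : FiniteDimensional ℝ (TangentSpace (𝓡 m) p) :=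
    inferInstanceAs (FiniteDimensional ℝ 𝔼)
  have h2 := Submodule.finrank_quotient_add_finrank (⨅ i, (W.fol i).tangent p)
  have h3 : Module.finrank ℝ (TangentSpace (𝓡 m) p) = m := finrank_euclideanSpace_fin (𝕜 := ℝ)
  rw [h1, h3] at h2
  exact Submodule.finrank_eq_zero.1 (by omega)

/-- The local submersions which define the foliations form, together, a system of coordinates. -/
theorem exists_isAdapted (W : DivFreeWeb m n c M) (p : M) : ∃ φ, W.IsAdapted φ p := by
  choose U hU hpU f hf hfd using fun i => (W.fol i).exists_submersion p
  let χ : OpenPartialHomeomorph M 𝔼 := chartAt 𝔼 p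
  have hχ : χ ∈ IsManifold.maximalAtlas (𝓡 m) ∞ M := IsManifold.chart_mem_maximalAtlas p
  have hpχ : p ∈ χ.source := mem_chart_source 𝔼 p
  let V : Set 𝔼 := χ.target ∩ χ.symm ⁻¹' ⋂ i, U i
  have hV : IsOpen V := χ.isOpen_inter_preimage_symm (isOpen_iInter_of_finite hU)
  have hpV : χ p ∈ V := ⟨χ.map_source hpχ, by
    rw [mem_preimage, χ.left_inv hpχ]; exact mem_iInter.2 hpU⟩
  let G : 𝔼 → 𝔼 := fun x => W.ofBlks fun i s => f i (χ.symm x) s - f i p s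
  have hGidx : ∀ x i s, G x (W.idx i s) = f i (χ.symm x) s - f i p s := fun x i s =>
    congrFun (W.blk_ofBlks (fun i s => f i (χ.symm x) s - f i p s) i) s
  have hfs : ∀ i, ContDiffOn ℝ ∞ (f i ∘ χ.symm) V := fun i =>
    contMDiffOn_iff_contDiffOn.1 ((hf i).comp
      ((contMDiffOn_symm_of_mem_maximalAtlas hχ).mono inter_subset_left)
      fun x hx => mem_iInter.1 hx.2 i)
  have hGs : ContDiffOn ℝ ∞ G V := by
    refine contDiffOn_euclidean.2 fun k => ?_
    obtain ⟨s, hs⟩ := W.exists_idx_eq k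
    rw [← hs]
    simp only [hGidx]
    exact (contDiffOn_euclidean.1 (hfs _) s).sub contDiffOn_const
  have hGd : ∀ x ∈ V, ∀ v i s, fderiv ℝ G x v (W.idx i s) =
      (show EuclideanSpace ℝ (Fin (c i)) from
        mfderiv (𝓡 m) (𝓡 (c i)) (f i) (χ.symm x) (lift χ x v)) s := by
    intro x hx v i s
    have h1 : MDifferentiableAt (𝓡 m) (𝓡 (c i)) (f i) (χ.symm x) :=
      ((hf i).contMDiffAt ((hU i).mem_nhds (mem_iInter.1 hx.2 i))).mdifferentiableAt (by simp)
    obtain ⟨h2, h3⟩ := hasFDerivAt_comp_symm hχ hx.1 h1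
    have h4 := ((hGs.contDiffAt (hV.mem_nhds hx)).differentiableAt (by simp)).hasFDerivAt
    have h5 := (EuclideanSpace.proj (W.idx i s) : 𝔼 →L[ℝ] ℝ).hasFDerivAt.comp x h4
    have h6 := ((EuclideanSpace.proj s : EuclideanSpace ℝ (Fin (c i)) →L[ℝ] ℝ).hasFDerivAt.comp x
      h2).sub_const (f i p s)
    have h7 := h5.unique (h6.congr_of_eventuallyEq (Eventually.of_forall fun y => hGidx y i s))
    exact (DFunLike.congr_fun h7 v).trans (congrArg (fun w : EuclideanSpace ℝ (Fin (c i)) => w s)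
      (h3 v))
  have hker : ∀ x ∈ V, ∀ v i, lift χ x v ∈ (W.fol i).tangent (χ.symm x) ↔
      ∀ s, fderiv ℝ G x v (W.idx i s) = 0 := by
    intro x hx v i
    rw [(hfd i _ (mem_iInter.1 hx.2 i)).2]
    simp only [hGd x hx]
    constructor
    · intro h s
      exact congrArg (fun w : EuclideanSpace ℝ (Fin (c i)) => w s) h
    · intro h
      exact PiLp.ext h
  have hinj : Function.Injective (fderiv ℝ G (χ p)) := by
    refine (injective_iff_map_eq_zero _).2 fun v hv => ?_
    have h1 : lift χ (χ p) v ∈ ⨅ i, (W.fol i).tangent (χ.symm (χ p)) :=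
      (Submodule.mem_iInf _).2 fun i => (hker _ hpV v i).2 fun s => by rw [hv]; rfl
    rw [iInf_tangent_eq_bot, Submodule.mem_bot] at h1
    rw [← coordVec_lift hχ hpV.1 v, h1]
    exact map_zero (mfderiv (𝓡 m) (𝓡 m) χ (χ.symm (χ p)))
  obtain ⟨Ψ, hpΨ, hΨV, hΨG, hΨs, hΨs'⟩ := exists_openPartialHomeomorph hV hGs hpV hinj
  have hG0 : G (χ p) = 0 := by
    refine W.eq_of_blk_eq fun i => funext fun s => ?_
    refine (hGidx _ i s).trans ?_
    rw [χ.left_inv hpχ, sub_self]; rfl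
  have h0 : (0 : 𝔼) ∈ (χ.trans Ψ).target := by
    have h : p ∈ (χ.trans Ψ).source := by
      rw [χ.trans_source]; exact ⟨hpχ, hpΨ⟩
    have := (χ.trans Ψ).map_source h
    rwa [χ.coe_trans, Function.comp_apply, hΨG, hG0] at this
  obtain ⟨δ, hδ, hbox⟩ := exists_forall_abs_le_mem ((χ.trans Ψ).open_target.mem_nhds h0)
  let B : Set 𝔼 := openBox (fun _ => -δ) fun _ => δ
  have hB : B ⊆ (χ.trans Ψ).target := fun x hx => hbox x fun j =>
    abs_le.2 ⟨(hx j).1.le, (hx j).2.le⟩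
  let ι : OpenPartialHomeomorph 𝔼 𝔼 := OpenPartialHomeomorph.ofSet B (isOpen_openBox _ _)
  have hmem := trans_mem_maximalAtlas hχ hΨs hΨs'
  have hsource : ∀ {q}, q ∈ ((χ.trans Ψ).trans ι).source ↔ q ∈ (χ.trans Ψ).source ∧
      (χ.trans Ψ) q ∈ B := by
    intro q
    rw [OpenPartialHomeomorph.trans_source]; rfl
  have hpS : p ∈ (χ.trans Ψ).source := by
    rw [χ.trans_source]; exact ⟨hpχ, hpΨ⟩
  have hval : (χ.trans Ψ) p = 0 := by
    rw [χ.coe_trans, Function.comp_apply, hΨG, hG0]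
  refine ⟨(χ.trans Ψ).trans ι, trans_mem_maximalAtlas hmem contDiffOn_id contDiffOn_id, ?_, ?_,
    ⟨fun _ => -δ, fun _ => δ, ?_⟩, ?_⟩
  · rw [hsource, hval]
    exact ⟨hpS, fun k => by simpa using hδ⟩
  · exact hval
  · rw [OpenPartialHomeomorph.trans_target]
    exact inter_eq_left.2 hB
  · refine (W.straightens_iff (σ := id)).1 fun j q hq v => ?_
    obtain ⟨hq1, hq2⟩ := hsource.1 hq
    have hq3 := hq1
    rw [χ.trans_source] at hq3
    have hxV : χ q ∈ V := hΨV hq3.2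
    have e1 : coordVec ((χ.trans Ψ).trans ι) q v = fderiv ℝ G (χ q) (coordVec χ q v) := by
      rw [coordVec_trans hmem contDiffOn_id hq1 hq2, coordVec_trans hχ hΨs hq3.1 hq3.2,
        show (Ψ : 𝔼 → 𝔼) = G from funext hΨG]
      have : fderiv ℝ ι ((χ.trans Ψ) q) = ContinuousLinearMap.id ℝ 𝔼 := fderiv_id
      rw [this]; rfl
    rw [e1, ← W.forall_idx_iff (i := id j), id]
    have h2 := hker (χ q) hxV (coordVec χ q v) j
    -- the tangent spaces at `χ.symm (χ q)` and at `q` are equal, but not by definition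
    have h3 : ∀ q', q' = q → ∀ v' : TangentSpace (𝓡 m) q', (v' : 𝔼) = (v : 𝔼) →
        (v' ∈ (W.fol j).tangent q' ↔ v ∈ (W.fol j).tangent q) := by
      rintro q' rfl v' rfl; rfl
    rw [← h2]
    refine (h3 _ (χ.left_inv hq3.1) _ ?_).symm
    exact DFunLike.congr_fun ((mdifferentiable_of_mem_maximalAtlas hχ).symm_comp_deriv hq3.1) v

/-- The volume form in a chart. -/
theorem vol_eq_density_mul_det {φ : OpenPartialHomeomorph M 𝔼}
    (hφ : φ ∈ IsManifold.maximalAtlas (𝓡 m) ∞ M) {x : 𝔼} (hx : x ∈ φ.target)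
    (v : Fin m → TangentSpace (𝓡 m) (φ.symm x)) :
    W.vol (φ.symm x) v = density W.vol φ x *
      Matrix.det (Matrix.of fun k l => coordVec φ (φ.symm x) (v l) k) := by
  let L : 𝔼 →ₗ[ℝ] TangentSpace (𝓡 m) (φ.symm x) := (mfderiv (𝓡 m) (𝓡 m) φ.symm x).toLinearMap
  let e := (EuclideanSpace.basisFun (Fin m) ℝ).toBasis
  have h1 := AlternatingMap.eq_smul_basis_det e ((W.vol (φ.symm x)).compLinearMap L)
  have h2 := DFunLike.congr_fun h1 fun l => coordVec φ (φ.symm x) (v l)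
  have h3 : (fun l => L (coordVec φ (φ.symm x) (v l))) = v := funext fun l =>
    lift_coordVec hφ hx (v l)
  have h4 : ((W.vol (φ.symm x)).compLinearMap L) e = density W.vol φ x := by
    refine congrArg (W.vol (φ.symm x)) (funext fun k => ?_)
    simp only [e, OrthonormalBasis.coe_toBasis, EuclideanSpace.basisFun_apply]
    rfl
  have h5 : ((W.vol (φ.symm x)).compLinearMap L) (fun l => coordVec φ (φ.symm x) (v l)) =
      W.vol (φ.symm x) v := congrArg (W.vol (φ.symm x)) h3
  rw [← h5, h2, h4]
  simp only [AlternatingMap.smul_apply, smul_eq_mul, Module.Basis.det_apply]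
  congr 2

end Web

/-! ### Webs with a local equivalence to the standard one are flat -/

/-- A determinant identity for matrices whose rows in `R` are supported in the columns `S` and whose
other rows are supported in the other columns: replacing the rows in `R` multiplies the determinant
by a factor which does not depend on the other rows. -/
theorem det_mul_det_of_rows {m : ℕ} {X X' Y Y' : Matrix (Fin m) (Fin m) ℝ} (R S : Fin m → Prop)
    (hX : X.det ≠ 0) (hX' : ∀ r, ¬ R r → X' r = X r) (hY : ∀ r, R r → Y r = X r)
    (hYR : ∀ r, R r → Y' r = X' r) (hY' : ∀ r, ¬ R r → Y' r = Y r)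
    (sX : ∀ r s, R r → ¬ S s → X r s = 0) (sX' : ∀ r s, R r → ¬ S s → X' r s = 0)
    (tX : ∀ r s, ¬ R r → S s → X r s = 0) : X.det * Y'.det = X'.det * Y.det := by
  classical
  have hu : IsUnit X.det := isUnit_iff_ne_zero.2 hX
  let T := X' * X⁻¹
  have hT : T * X = X' := Matrix.nonsing_inv_mul_cancel_right X X' hu
  have hinj : ∀ w : Fin m → ℝ, (∀ s, ∑ t, w t * X t s = 0) → w = 0 := fun w hw =>
    Matrix.eq_zero_of_vecMul_eq_zero hX (funext hw)
  have hTX : ∀ r s, ∑ t, T r t * X t s = X' r s := fun r s => by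
    rw [← hT, Matrix.mul_apply]
  have h1 : ∀ r, ¬ R r → ∀ t, T r t = if t = r then 1 else 0 := by
    intro r hr
    have : (fun t => T r t - if t = r then 1 else 0) = 0 := by
      refine hinj _ fun s => ?_
      simp only [sub_mul, Finset.sum_sub_distrib, hTX, hX' r hr, ite_mul, one_mul, zero_mul,
        Finset.sum_ite_eq', Finset.mem_univ, if_true, sub_self]
    exact fun t => sub_eq_zero.1 (congrFun this t)
  have h2 : ∀ r, R r → ∀ t, ¬ R t → T r t = 0 := by
    intro r hr
    have : (fun t => if R t then 0 else T r t) = 0 := by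
      refine hinj _ fun s => ?_
      by_cases hs : S s
      · refine Finset.sum_eq_zero fun t _ => ?_
        split_ifs with ht
        · rw [zero_mul]
        · rw [tX t s ht hs, mul_zero]
      · refine (Finset.sum_congr rfl fun t _ => ?_).trans ((hTX r s).trans (sX' r s hr hs))
        split_ifs with ht
        · rw [sX t s ht hs, zero_mul, mul_zero]
        · rfl
    intro t ht
    simpa [ht] using congrFun this t
  have hTY : T * Y = Y' := by
    ext r s
    rw [Matrix.mul_apply]
    by_cases hr : R r
    · rw [hYR r hr, ← hTX r s]
      refine Finset.sum_congr rfl fun t _ => ?_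
      by_cases ht : R t
      · rw [hY t ht]
      · rw [h2 r hr t ht, zero_mul, zero_mul]
    · simp only [h1 r hr, ite_mul, one_mul, zero_mul, Finset.sum_ite_eq', Finset.mem_univ, if_true,
        hY' r hr]
  have e1 : T.det * X.det = X'.det := by rw [← Matrix.det_mul, hT]
  have e2 : T.det * Y.det = Y'.det := by rw [← Matrix.det_mul, hTY]
  rw [← e1, ← e2]
  ring

/-- If the mixed differences of `L` at `x` in the directions `u` and `v` vanish for small steps,
then so does the mixed derivative. -/
theorem fderiv_fderiv_eq_zero_of_mixed_difference {E : Type} [NormedAddCommGroup E]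
    [NormedSpace ℝ E] {L : E → ℝ} {x u v : E} (hL : ContDiffAt ℝ ∞ L x)
    (h : ∀ᶠ s : ℝ in 𝓝 0, ∀ᶠ t : ℝ in 𝓝 0,
      L (x + s • u + t • v) + L x = L (x + s • u) + L (x + t • v)) :
    fderiv ℝ (fun y => fderiv ℝ L y v) x u = 0 := by
  have hline : ∀ y w : E, HasDerivAt (fun t : ℝ => y + t • w) w 0 := fun y w => by
    simpa using ((hasDerivAt_id (0 : ℝ)).smul_const w).const_add y
  have hder : ∀ {F : E → ℝ} {y : E} (w : E), DifferentiableAt ℝ F y →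
      HasDerivAt (fun t : ℝ => F (y + t • w)) (fderiv ℝ F y w) 0 := fun w hF =>
    HasFDerivAt.comp_hasDerivAt_of_eq (0 : ℝ) hF.hasFDerivAt (hline _ w) (by simp)
  have hlim : Tendsto (fun s : ℝ => x + s • u) (𝓝 0) (𝓝 x) := by
    have : Continuous fun s : ℝ => x + s • u := by fun_prop
    simpa using this.tendsto 0
  have hLd : ∀ᶠ y in 𝓝 x, DifferentiableAt ℝ L y :=
    ((hL.of_le (m := 1) (by simp)).eventually (by simp)).mono fun y hy =>
      hy.differentiableAt (by simp)
  have hconst : (fun s : ℝ => fderiv ℝ L (x + s • u) v) =ᶠ[𝓝 0] fun _ => fderiv ℝ L x v := by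
    filter_upwards [h, hlim.eventually hLd] with s hs hd
    have h1 := hder v hd
    have h2 := ((hder v hLd.self_of_nhds).const_add (L (x + s • u))).sub_const (L x)
    refine h1.unique (h2.congr_of_eventuallyEq ?_)
    filter_upwards [hs] with t ht
    linarith
  have hd2 : DifferentiableAt ℝ (fun y => fderiv ℝ L y v) x :=
    ((hL.fderiv_right (m := ∞) (by simp)).differentiableAt (by simp)).clm_apply
      (differentiableAt_const v)
  exact (hder u hd2).unique ((hasDerivAt_const (0 : ℝ) _).congr_of_eventuallyEq hconst)

section Web

variable {m n : ℕ} {c : Fin n → ℕ} {M : Type*} [TopologicalSpace M]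
  [ChartedSpace (EuclideanSpace ℝ (Fin m)) M] [IsManifold (𝓡 m) ∞ M] {W : DivFreeWeb m n c M}

local notation "𝔼" => EuclideanSpace ℝ (Fin m)

/-- In an adapted chart `ψ` the density is the Jacobian determinant of `φ ∘ ψ⁻¹`, where `φ` is a
local equivalence with the standard web. Since `φ ∘ ψ⁻¹` maps blocks to blocks, it factorizes. -/
theorem LocallyTrivial.flat (htriv : W.LocallyTrivial) : W.Flat := by
  intro ψ p hψ x₀ hx₀ k l hkl
  obtain ⟨φ, hφ, hxφ, -, ⟨σ, hσ⟩, hvol⟩ := htriv (ψ.symm x₀)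
  have sφ : W.Straightens φ σ := W.straightens_iff.2 hσ
  have sψ := hψ.straightens
  have hN : IsOpen (ψ.target ∩ ψ.symm ⁻¹' φ.source) := ψ.isOpen_inter_preimage_symm φ.open_source
  obtain ⟨ε, hε, hball⟩ := Metric.isOpen_iff.1 hN x₀ ⟨hx₀, hxφ⟩
  set B := Metric.ball x₀ ε with hB
  have hBo : IsOpen B := Metric.isOpen_ball
  have hx₀B : x₀ ∈ B := Metric.mem_ball_self hε
  set F : 𝔼 → 𝔼 := φ ∘ ψ.symm with hF
  let e : Fin m → 𝔼 := fun j => EuclideanSpace.single j (1 : ℝ)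
  let J : 𝔼 → Matrix (Fin m) (Fin m) ℝ := fun y => Matrix.of fun r s => fderiv ℝ F y (e s) r
  have hJ : ∀ y ∈ B, density W.vol ψ y = (J y).det := by
    intro y hy
    have h1 := hvol (ψ.symm y) (hball hy).2 fun s => lift ψ y (e s)
    refine h1.trans (congrArg Matrix.det ?_)
    ext r s
    exact congrArg (fun w : 𝔼 => w r) ((hasFDerivAt_transition hφ hψ.1 (hball hy).1
      (hball hy).2).2 (e s)).symm
  -- the `r`-th row of the Jacobian only depends on the coordinates in the block `σ⁻¹ (block r)`
  have hrow : ∀ y ∈ B, ∀ v, y + v ∈ B → ∀ j r, W.block r = σ j → (∀ s, W.block s = j → v s = 0) →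
      J (y + v) r = J y r := by
    intro y hy v hyv j r hr hv
    have hcomp : ∀ z ∈ B, ∀ w, fderiv ℝ F z w r = fderiv ℝ (fun z => F z r) z w := by
      intro z hz w
      have h1 := (hasFDerivAt_transition hφ hψ.1 (hball hz).1 (hball hz).2).1
      have h2 := (EuclideanSpace.proj r : 𝔼 →L[ℝ] ℝ).hasFDerivAt.comp z h1
      exact (DFunLike.congr_fun h2.fderiv w).symm
    have hev : (fun z => F (z + v) r) =ᶠ[𝓝 y] fun z => F z r := by
      have : Tendsto (fun z => z + v) (𝓝 y) (𝓝 (y + v)) :=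
        (continuous_add_const v).tendsto y
      filter_upwards [hBo.mem_nhds hy, this.eventually (hBo.mem_nhds hyv)] with z hz hzv
      exact sφ.transition_eq hφ hψ.1 sψ (convex_ball x₀ ε) (fun x hx => hball hx) hzv hz
        (fun s hs => by simp [hv s hs]) hr
    funext s
    change fderiv ℝ F (y + v) (e s) r = fderiv ℝ F y (e s) r
    rw [hcomp _ hyv, hcomp _ hy, ← hev.fderiv_eq, fderiv_comp_add_right v (f := fun z => F z r)]
  have hsupp : ∀ y ∈ B, ∀ j r s, W.block r = σ j → W.block s ≠ j → J y r s = 0 := by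
    intro y hy j r s hr hs
    refine (sφ.fderiv_transition hφ hψ.1 sψ (hball hy).1 (hball hy).2 j (e s)).1 ?_ r hr
    intro t ht
    have : t ≠ s := by rintro rfl; exact hs ht
    simp [e, this]
  refine fderiv_fderiv_eq_zero_of_mixed_difference
    (((contDiffOn_density hψ.1).contDiffAt (ψ.open_target.mem_nhds hx₀)).log
      (density_ne_zero hψ.1 hx₀)) ?_
  have hlim : ∀ (y w : 𝔼), y ∈ B → ∀ᶠ t : ℝ in 𝓝 0, y + t • w ∈ B := by
    intro y w hy
    have : Tendsto (fun t : ℝ => y + t • w) (𝓝 0) (𝓝 y) := by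
      have : Continuous fun t : ℝ => y + t • w := by fun_prop
      simpa using this.tendsto 0
    exact this.eventually (hBo.mem_nhds hy)
  filter_upwards [hlim x₀ (e k) hx₀B] with s hs
  filter_upwards [hlim x₀ (e l) hx₀B, hlim _ (e l) hs] with t ht hst
  have hks : ∀ j, j ≠ W.block k → ∀ i, W.block i = j → (s • e k : 𝔼) i = 0 := by
    rintro j hj i rfl
    have : i ≠ k := by rintro rfl; exact hj rfl
    simp [e, this]
  have hlt : ∀ i, W.block i = W.block k → (t • e l : 𝔼) i = 0 := by
    intro i hi
    have : i ≠ l := by rintro rfl; exact hkl hi.symm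
    simp [e, this]
  have hσs : ∀ r, ¬ W.block r = σ (W.block k) → ∃ j, W.block r = σ j ∧ j ≠ W.block k := by
    intro r hr
    refine ⟨σ.symm (W.block r), (σ.apply_symm_apply _).symm, ?_⟩
    intro h
    exact hr (by rw [← h, σ.apply_symm_apply])
  have hdet := det_mul_det_of_rows (X := J x₀) (X' := J (x₀ + s • e k)) (Y := J (x₀ + t • e l))
    (Y' := J (x₀ + s • e k + t • e l)) (fun r => W.block r = σ (W.block k))
    (fun i => W.block i = W.block k) (hJ x₀ hx₀B ▸ density_ne_zero hψ.1 hx₀)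
    (fun r hr => by
      obtain ⟨j, hj, hjk⟩ := hσs r hr
      exact hrow x₀ hx₀B _ hs j r hj (hks j hjk))
    (fun r hr => hrow x₀ hx₀B _ ht _ r hr hlt)
    (fun r hr => hrow _ hs _ hst _ r hr hlt)
    (fun r hr => by
      obtain ⟨j, hj, hjk⟩ := hσs r hr
      have h1 : x₀ + s • e k + t • e l = x₀ + t • e l + s • e k := by abel
      rw [h1] at hst ⊢
      exact hrow _ ht _ hst j r hj (hks j hjk))
    (fun r i hr hi => hsupp x₀ hx₀B _ r i hr hi)
    (fun r i hr hi => hsupp _ hs _ r i hr hi)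
    (fun r i hr hi => by
      obtain ⟨j, hj, hjk⟩ := hσs r hr
      exact hsupp x₀ hx₀B j r i hj fun h => hjk (h.symm.trans hi))
  rw [← hJ _ hx₀B, ← hJ _ hs, ← hJ _ ht, ← hJ _ hst] at hdet
  have nz : ∀ y ∈ B, density W.vol ψ y ≠ 0 := fun y hy => density_ne_zero hψ.1 (hball hy).1
  rw [← Real.log_mul (nz _ hst) (nz _ hx₀B), ← Real.log_mul (nz _ hs) (nz _ ht), ← hdet, mul_comm]

end Web

section Euclid

variable {m : ℕ}

local notation "𝔼" => EuclideanSpace ℝ (Fin m)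

/-! ### Block-diagonal linear maps -/

theorem clm_apply_eq_sum (A : 𝔼 →L[ℝ] 𝔼) (v : 𝔼) (k : Fin m) :
    A v k = ∑ j, A (EuclideanSpace.single j (1 : ℝ)) k * v j := by
  conv_lhs => rw [sum_smul_single v, map_sum]
  simp [Finset.sum_apply, mul_comm]

theorem injective_of_det_ne_zero {A : 𝔼 →L[ℝ] 𝔼}
    (h : Matrix.det (Matrix.of fun k j => A (EuclideanSpace.single j (1 : ℝ)) k) ≠ 0) :
    Function.Injective A := by
  refine (injective_iff_map_eq_zero _).2 fun v hv => ?_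
  have h1 : Matrix.mulVec (Matrix.of fun k j => A (EuclideanSpace.single j (1 : ℝ)) k)
      (fun j => v j) = 0 := by
    funext k
    exact (clm_apply_eq_sum A v k).symm.trans (by rw [hv]; rfl)
  exact PiLp.ext (congrFun (Matrix.eq_zero_of_mulVec_eq_zero h h1))

/-- An injective block-diagonal map preserves and reflects the vanishing of a block. -/
theorem blockDiagonal_vanish_iff {ι : Type} {β : Fin m → ι} {A : 𝔼 →L[ℝ] 𝔼}
    (hA : Function.Injective A)
    (hβ : ∀ k j, β k ≠ β j → A (EuclideanSpace.single j (1 : ℝ)) k = 0) (i : ι) (w : 𝔼) :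
    (∀ k, β k = i → w k = 0) ↔ ∀ k, β k = i → A w k = 0 := by
  constructor
  · intro h k hk
    rw [clm_apply_eq_sum]
    refine Finset.sum_eq_zero fun j _ => ?_
    by_cases hj : β j = i
    · rw [h j hj, mul_zero]
    · rw [hβ k j fun h => hj (h.symm.trans hk), zero_mul]
  · intro h k hk
    have h1 : A (mask (fun k => β k = i) w) = 0 := by
      ext l
      rw [clm_apply_eq_sum]
      by_cases hl : β l = i
      · rw [PiLp.zero_apply, ← h l hl, clm_apply_eq_sum]
        refine Finset.sum_congr rfl fun j _ => ?_
        by_cases hj : β j = i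
        · rw [mask_apply, if_pos hj]
        · rw [hβ l j fun h => hj (h.symm.trans hl), zero_mul, zero_mul]
      · refine Finset.sum_eq_zero fun j _ => ?_
        by_cases hj : β j = i
        · rw [hβ l j fun h => hl (h.trans hj), zero_mul]
        · rw [mask_apply, if_neg hj, mul_zero]
    have h2 := congrArg (fun v : 𝔼 => v k) (hA (h1.trans (map_zero A).symm))
    simpa [mask_apply, hk] using h2

/-! ### Primitives along a coordinate -/

theorem hasDerivAt_comp_upd {F : 𝔼 → ℝ} {x : 𝔼} (hF : DifferentiableAt ℝ F x) (j : Fin m) :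
    HasDerivAt (fun s => F (upd x j s)) (fderiv ℝ F x (EuclideanSpace.single j (1 : ℝ))) (x j) := by
  have h1 : HasDerivAt (fun s : ℝ => upd x j s) (EuclideanSpace.single j (1 : ℝ)) (x j) := by
    simp only [upd_eq_add]
    simpa using (((hasDerivAt_id (x j)).sub_const (x j)).smul_const
      (EuclideanSpace.single j (1 : ℝ))).const_add x
  refine HasFDerivAt.comp_hasDerivAt_of_eq (x j) hF.hasFDerivAt h1 ?_
  ext i
  simp only [upd_apply]
  split_ifs with h
  · rw [h]
  · rfl

/-- The primitive `∫_0^{x_k} G` of `G` along the `k`-th coordinate, in a form which is manifestly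
smooth in all coordinates. -/
noncomputable def primitive (G : 𝔼 → ℝ) (k : Fin m) (x : 𝔼) : ℝ :=
  x k * ∫ t in Icc (0 : ℝ) 1, G (upd x k (t * x k))

theorem contDiff_primitive {G : 𝔼 → ℝ} (hG : ContDiff ℝ ∞ G) (k : Fin m) :
    ContDiff ℝ ∞ (primitive G k) := by
  have h1 : ContDiff ℝ ∞ fun p : 𝔼 × ℝ => upd p.1 k (p.2 * p.1 k) := by
    simp only [upd_eq_add]
    fun_prop
  have h2 : ContDiff ℝ ∞ fun x : 𝔼 => x k := by fun_prop
  exact h2.mul (contDiff_setIntegral_param (f := fun (x : 𝔼) (t : ℝ) => G (upd x k (t * x k)))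
    (hG.comp h1) isCompact_Icc)

/-- The fundamental theorem of calculus, along the `k`-th coordinate. -/
theorem fderiv_primitive_same {G : 𝔼 → ℝ} (hG : ContDiff ℝ ∞ G) (k : Fin m) (x : 𝔼) :
    fderiv ℝ (primitive G k) x (EuclideanSpace.single k (1 : ℝ)) = G x := by
  have hcont : Continuous fun u : ℝ => G (upd x k u) := by
    simp only [upd_eq_add]
    exact hG.continuous.comp (by fun_prop)
  have h1 : (fun s => primitive G k (upd x k s)) = fun s => ∫ u in (0 : ℝ)..s, G (upd x k u) := by
    funext s
    have hupd : ∀ a, upd (upd x k s) k a = upd x k a := fun a => by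
      ext j; simp only [upd_apply]; split_ifs <;> rfl
    simp only [primitive, upd_same, hupd]
    rw [integral_Icc_eq_integral_Ioc, ← intervalIntegral.integral_of_le zero_le_one,
      intervalIntegral.mul_integral_comp_mul_right (f := fun u => G (upd x k u)), zero_mul, one_mul]
  have h2 := hasDerivAt_comp_upd ((contDiff_primitive hG k).differentiable (by simp) x) k
  rw [h1] at h2
  have hx : upd x k (x k) = x := by
    ext j; simp only [upd_apply]; split_ifs with h
    · rw [h]
    · rfl
  have h3 := h2.unique (intervalIntegral.integral_hasDerivAt_right (hcont.intervalIntegrable _ _)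
    (hcont.stronglyMeasurableAtFilter _ _) hcont.continuousAt)
  rwa [hx] at h3

theorem fderiv_primitive_of_ne {G : 𝔼 → ℝ} (hG : ContDiff ℝ ∞ G) {k j : Fin m} (hjk : j ≠ k)
    (hj : ∀ x s, G (upd x j s) = G x) (x : 𝔼) :
    fderiv ℝ (primitive G k) x (EuclideanSpace.single j (1 : ℝ)) = 0 := by
  have h1 : (fun s => primitive G k (upd x j s)) = fun _ => primitive G k x := by
    funext s
    simp only [primitive, upd_of_ne hjk.symm, upd_comm hjk, hj]
  have h2 := hasDerivAt_comp_upd ((contDiff_primitive hG k).differentiable (by simp) x) j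
  rw [h1] at h2
  exact h2.unique (hasDerivAt_const _ _)

/-! ### Coordinates in which the volume form is the standard one -/

theorem contDiff_mask (κ : Fin m → Prop) : ContDiff ℝ ∞ (mask κ : 𝔼 → 𝔼) := by
  refine contDiff_euclidean.2 fun k => ?_
  simp only [mask_apply]
  split_ifs
  · fun_prop
  · exact contDiff_const

/-- If the mixed derivatives of `log |h|` vanish, then `h` is a product of functions of the
individual blocks of coordinates. -/
theorem MixedFlat.div_eq_prod {ι : Type} [Fintype ι] [DecidableEq ι] {β : Fin m → ι} {h : 𝔼 → ℝ}
    {a b : Fin m → ℝ}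
    (hflat : MixedFlat β h (openBox a b)) (hh : ContDiffOn ℝ ∞ h (openBox a b))
    (h0 : ∀ x ∈ openBox a b, h x ≠ 0) (h00 : (0 : 𝔼) ∈ openBox a b)
    (hpos : ∀ x ∈ openBox a b, 0 < h x / h 0) {x : 𝔼} (hx : x ∈ openBox a b) :
    h x / h 0 = ∏ i, h (mask (fun k => β k = i) x) / h 0 := by
  have key : ∀ s : Finset ι, h (mask (fun k => β k ∈ s) x) / h 0 =
      ∏ i ∈ s, h (mask (fun k => β k = i) x) / h 0 := by
    intro s
    induction s using Finset.induction_on with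
    | empty =>
      have : mask (fun k => β k ∈ (∅ : Finset ι)) x = 0 := by ext k; simp [mask_apply]
      rw [this, Finset.prod_empty, div_self (h0 0 h00)]
    | insert i s hi ih =>
      rw [Finset.prod_insert hi, ← ih]
      have hy := mask_mem_openBox h00 hx fun k => β k = i
      have hz := mask_mem_openBox h00 hx fun k => β k ∈ s
      have hs : mask (fun k => β k = i) x + mask (fun k => β k ∈ s) x =
          mask (fun k => β k ∈ insert i s) x := by
        ext k; simp only [PiLp.add_apply, mask_apply, Finset.mem_insert]; grind
      have hyz := mask_mem_openBox h00 hx fun k => β k ∈ insert i s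
      have hadd := hflat.log_add hh h0 (y := mask (fun k => β k = i) x)
        (z := mask (fun k => β k ∈ s) x) (fun k l hkl => by simp only [mask_apply]; grind) h00 hy hz
        (by rwa [hs])
      rw [hs] at hadd
      refine Real.log_injOn_pos (hpos _ hyz) (mul_pos (hpos _ hy) (hpos _ hz)) ?_
      rw [Real.log_mul (hpos _ hy).ne' (hpos _ hz).ne', Real.log_div (h0 _ hyz) (h0 0 h00),
        Real.log_div (h0 _ hy) (h0 0 h00), Real.log_div (h0 _ hz) (h0 0 h00)]
      linarith
  have := key Finset.univ
  have hu : mask (fun k => β k ∈ (Finset.univ : Finset ι)) x = x := by ext k; simp [mask_apply]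
  rwa [hu] at this

/-- A product over blocks, written as a product over the coordinates in which the factor of a block
is attributed to its first coordinate. -/
theorem prod_first_of_block {ι : Type} [Fintype ι] [DecidableEq ι] {β : Fin m → ι} {f : ι → ℝ}
    (hf : ∀ i, (∀ k, β k ≠ i) → f i = 1) [DecidablePred fun k => ∀ l, β l = β k → k ≤ l] :
    (∏ k, if ∀ l, β l = β k → k ≤ l then f (β k) else 1) = ∏ i, f i := by
  rw [← Finset.prod_fiberwise Finset.univ β]
  refine Finset.prod_congr rfl fun i _ => ?_
  by_cases hi : ∃ k, β k = i
  · have hne : (Finset.univ.filter fun k => β k = i).Nonempty := by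
      obtain ⟨k, hk⟩ := hi
      exact ⟨k, by simpa using hk⟩
    set k₀ := (Finset.univ.filter fun k => β k = i).min' hne with hk₀
    have hβ : β k₀ = i := (Finset.mem_filter.1 (Finset.min'_mem _ hne)).2
    have hle : ∀ l, β l = i → k₀ ≤ l := fun l hl => Finset.min'_le _ _ (by simpa using hl)
    rw [Finset.prod_eq_single k₀, if_pos fun l hl => hle l (hl.trans hβ), hβ]
    · intro k hk hkk
      have hk' : β k = i := (Finset.mem_filter.1 hk).2
      exact if_neg fun h => hkk (le_antisymm (h k₀ (hβ.trans hk'.symm)) (hle k hk'))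
    · intro h
      exact absurd (Finset.min'_mem _ hne) h
  · push Not at hi
    rw [hf i hi, Finset.filter_eq_empty_iff.2 fun k _ => hi k, Finset.prod_empty]

/-- If the mixed derivatives of `log |h|` vanish, then `h` is, near `0`, the Jacobian determinant of
a local diffeomorphism which preserves the blocks of coordinates. -/
theorem MixedFlat.exists_coordinates {ι : Type} [Fintype ι] [DecidableEq ι] (hm : 0 < m)
    {β : Fin m → ι} {h : 𝔼 → ℝ} {U : Set 𝔼} (hU : IsOpen U) (hflat : MixedFlat β h U)
    (hh : ContDiffOn ℝ ∞ h U) (h0 : ∀ x ∈ U, h x ≠ 0) (h00 : (0 : 𝔼) ∈ U) :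
    ∃ Ψ : OpenPartialHomeomorph 𝔼 𝔼, 0 ∈ Ψ.source ∧ Ψ.source ⊆ U ∧ Ψ 0 = 0 ∧
      ContDiffOn ℝ ∞ Ψ Ψ.source ∧ ContDiffOn ℝ ∞ Ψ.symm Ψ.target ∧ ∀ x ∈ Ψ.source,
        (∀ k j, β k ≠ β j → fderiv ℝ Ψ x (EuclideanSpace.single j (1 : ℝ)) k = 0) ∧
        Matrix.det (Matrix.of fun k j => fderiv ℝ Ψ x (EuclideanSpace.single j (1 : ℝ)) k) =
          h x := by
  classical
  obtain ⟨g, hg, hgh⟩ := exists_contDiff_eventuallyEq hU hh h00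
  have hpos : ∀ᶠ x in 𝓝 (0 : 𝔼), 0 < h x / h 0 := by
    have hc := (hh.contDiffAt (hU.mem_nhds h00)).continuousAt.div_const (h 0)
    refine hc.eventually_const_lt ?_
    change 0 < h 0 / h 0
    rw [div_self (h0 0 h00)]
    exact one_pos
  obtain ⟨δ, hδ, hball⟩ := exists_forall_abs_le_mem ((hgh.and hpos).and (hU.mem_nhds h00))
  let B : Set 𝔼 := openBox (fun _ => -δ) fun _ => δ
  have hB : ∀ x ∈ B, (g x = h x ∧ 0 < h x / h 0) ∧ x ∈ U := fun x hx =>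
    hball x fun j => abs_le.2 ⟨(hx j).1.le, (hx j).2.le⟩
  have hBU : B ⊆ U := fun x hx => (hB x hx).2
  have hB0 : (0 : 𝔼) ∈ B := fun k => by simpa using hδ
  -- the factors of `h` from the individual blocks, attributed to the first coordinate of the block;
  -- the coordinate `0`, which exists as `m > 0`, also carries the constant `h 0` with its sign
  let z : Fin m := ⟨0, hm⟩
  let G : Fin m → 𝔼 → ℝ := fun k x => (if k = z then g 0 else 1) *
    if ∀ l, β l = β k → k ≤ l then g (mask (fun j => β j = β k) x) / g 0 else 1
  have hGs : ∀ k, ContDiff ℝ ∞ (G k) := by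
    intro k
    refine contDiff_const.mul ?_
    by_cases hk : ∀ l, β l = β k → k ≤ l
    · simp only [if_pos hk]
      exact (hg.comp (contDiff_mask _)).div_const _
    · simp only [if_neg hk]
      exact contDiff_const
  have hGprod : ∀ x ∈ B, ∏ k, G k x = h x := by
    intro x hx
    have hmem : ∀ i, mask (fun j => β j = i) x ∈ B := fun i => mask_mem_openBox hB0 hx _
    have e0 := (hB 0 hB0).1.1
    rw [Finset.prod_mul_distrib, Finset.prod_ite_eq', if_pos (Finset.mem_univ z),
      prod_first_of_block (f := fun i => g (mask (fun j => β j = i) x) / g 0)]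
    · simp only [fun i => (hB _ (hmem i)).1.1, e0]
      rw [← MixedFlat.div_eq_prod (β := β) (fun y hy => hflat y (hBU hy)) (hh.mono hBU)
        (fun y hy => h0 y (hBU hy)) hB0 (fun y hy => (hB y hy).1.2) hx,
        mul_div_cancel₀ _ (h0 0 h00)]
    · intro i hi
      have : mask (fun j => β j = i) x = 0 := by ext k; simp [mask_apply, hi]
      rw [this, e0, div_self (h0 0 h00)]
  have hGupd : ∀ k j, (β k ≠ β j ∨ j < k) → ∀ x s, G k (upd x j s) = G k x := by
    intro k j hkj x s
    simp only [G]
    by_cases hk : ∀ l, β l = β k → k ≤ l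
    · simp only [if_pos hk]
      congr 3
      refine mask_congr fun i hi => upd_of_ne ?_
      rintro rfl
      rcases hkj with h | h
      · exact h hi.symm
      · exact absurd (hk i hi) (not_le.2 h)
    · simp only [if_neg hk]
  let f : 𝔼 → 𝔼 := fun x => WithLp.toLp 2 fun k => primitive (G k) k x
  have hf : ContDiff ℝ ∞ f := contDiff_euclidean.2 fun k => contDiff_primitive (hGs k) k
  have hfd : ∀ x v k, fderiv ℝ f x v k = fderiv ℝ (primitive (G k) k) x v := by
    intro x v k
    have h2 := (EuclideanSpace.proj k : 𝔼 →L[ℝ] ℝ).hasFDerivAt.comp x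
      (hf.differentiable (by simp) x).hasFDerivAt
    exact (DFunLike.congr_fun h2.fderiv v).symm
  have hzero : ∀ x k j, (β k ≠ β j ∨ j < k) →
      fderiv ℝ f x (EuclideanSpace.single j (1 : ℝ)) k = 0 := by
    intro x k j hkj
    rw [hfd]
    refine fderiv_primitive_of_ne (hGs k) ?_ (hGupd k j hkj) x
    rintro rfl
    rcases hkj with h | h
    · exact h rfl
    · exact lt_irrefl _ h
  -- the Jacobian matrix is upper triangular with diagonal entries `G k x`
  have hdet : ∀ x ∈ B,
      Matrix.det (Matrix.of fun k j => fderiv ℝ f x (EuclideanSpace.single j (1 : ℝ)) k) =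
        h x := by
    intro x hx
    refine (Matrix.det_of_isUpperTriangular fun k j hkj => hzero x k j (Or.inr hkj)).trans ?_
    rw [← hGprod x hx]
    refine Finset.prod_congr rfl fun k _ => ?_
    rw [hfd, fderiv_primitive_same (hGs k)]
  obtain ⟨Ψ, h0Ψ, hΨB, hΨf, hΨs, hΨs'⟩ := exists_openPartialHomeomorph
    (isOpen_openBox (fun _ => -δ) fun _ => δ) hf.contDiffOn hB0
    (injective_of_det_ne_zero (by rw [hdet 0 hB0]; exact h0 0 h00))
  refine ⟨Ψ, h0Ψ, hΨB.trans hBU, ?_, hΨs, hΨs', fun x hx => ?_⟩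
  · rw [hΨf]
    ext k
    simp [f, primitive]
  · rw [show (Ψ : 𝔼 → 𝔼) = f from funext hΨf]
    exact ⟨fun k j hkj => hzero x k j (Or.inl hkj), hdet x (hΨB hx)⟩

end Euclid

section Web

variable {m n : ℕ} {c : Fin n → ℕ} {M : Type*} [TopologicalSpace M]
  [ChartedSpace (EuclideanSpace ℝ (Fin m)) M] [IsManifold (𝓡 m) ∞ M] {W : DivFreeWeb m n c M}

local notation "𝔼" => EuclideanSpace ℝ (Fin m)

/-! ### Flat webs are locally trivial -/

/-- Coordinates whose Jacobian determinant is the density turn an adapted chart into a local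
equivalence with the standard web. -/
theorem Flat.locallyTrivial (hm : 0 < m) (hflat : W.Flat) : W.LocallyTrivial := by
  intro p
  obtain ⟨φ, hφ⟩ := W.exists_isAdapted p
  obtain ⟨Ψ, h0, hsub, hΨ0, hΨs, hΨs', hΨ⟩ := (hflat φ p hφ).exists_coordinates hm φ.open_target
    (contDiffOn_density hφ.1) (fun x hx => density_ne_zero hφ.1 hx) hφ.zero_mem
  have hinj : ∀ x ∈ Ψ.source, Function.Injective (fderiv ℝ Ψ x) := fun x hx =>
    injective_of_det_ne_zero (by rw [(hΨ x hx).2]; exact density_ne_zero hφ.1 (hsub hx))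
  have hsource : ∀ {q}, q ∈ (φ.trans Ψ).source → q ∈ φ.source ∧ φ q ∈ Ψ.source := by
    intro q hq
    rwa [φ.trans_source] at hq
  refine ⟨φ.trans Ψ, trans_mem_maximalAtlas hφ.1 hΨs hΨs', ?_, ?_, ⟨1, ?_⟩, ?_⟩
  · rw [φ.trans_source]
    exact ⟨hφ.2.1, by rw [mem_preimage, hφ.2.2.1]; exact h0⟩
  · rw [φ.coe_trans, Function.comp_apply, hφ.2.2.1, hΨ0]
  · refine (W.straightens_iff (σ := (1 : Equiv.Perm (Fin n)))).1 fun j q hq v => ?_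
    obtain ⟨h1, h2⟩ := hsource hq
    rw [hφ.straightens j q h1 v, coordVec_trans hφ.1 hΨs h1 h2]
    exact blockDiagonal_vanish_iff (hinj _ h2) (hΨ _ h2).1 j _
  · intro q hq v
    obtain ⟨h1, h2⟩ := hsource hq
    obtain ⟨x, hx, rfl⟩ : ∃ x ∈ φ.target, φ.symm x = q := ⟨φ q, φ.map_source h1, φ.left_inv h1⟩
    rw [φ.right_inv hx] at h2
    rw [vol_eq_density_mul_det hφ.1 hx, ← (hΨ x h2).2, ← Matrix.det_mul]
    congr 1
    ext k l
    rw [Matrix.mul_apply, Matrix.of_apply, coordDiff_eq,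
      coordVec_trans hφ.1 hΨs h1 (by rwa [φ.right_inv hx]), φ.right_inv hx, clm_apply_eq_sum]
    rfl

end Web

end DivFreeWeb

/-! ### The equivalence -/

theorem mainTheorem2 {m n : ℕ} (hm : 0 < m) {c : Fin n → ℕ} {M : Type*} [TopologicalSpace M]
    [T2Space M] [SecondCountableTopology M] [ChartedSpace (EuclideanSpace ℝ (Fin m)) M]
    [IsManifold (𝓡 m) ∞ M] (W : DivFreeWeb m n c M) :
    List.TFAE [
      W.LocallyTrivial,
      W.VolumeCondition,
      W.CutCondition,
      ∀ p : M, W.holonomy p = ⊥,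
      ∃ K, W.IsNonuniformityTensor K ∧ ∀ p v w, K p v w = 0] := by
  rw [W.tensor_eq_zero_iff_flat]
  tfae_have 1 → 5 := fun h => h.flat
  tfae_have 5 → 1 := fun h => h.locallyTrivial hm
  tfae_have 5 → 2 := fun h => h.volumeCondition
  tfae_have 2 → 3 := fun h => h.cutCondition
  tfae_have 3 → 5 := fun h => h.flat
  tfae_have 5 → 4 := fun h p => h.holonomy_eq_bot p
  tfae_have 4 → 5 := DivFreeWeb.flat_of_holonomy_eq_bot
  tfae_finish
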